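/- Let $N$ be a nonempty compact smooth manifold without boundary of dimension $n+1$, $n\ge 2$, with a smooth Riemannian metric, and let $g:N\to(0,\infty)$ be continuous. Let $W:\mathbb R\to[0,\infty)$ be of class $C^2$ with $W^{-1}(0)=\{-1,1\}$, $W''(\pm1)>0$, and with quadratic growth outside $[-2,2]$: there are $\kappa>0$ and $C$ with $W(s)\ge\kappa s^2$ and $|W''(s)|\le C$ for $|s|\ge2$. For $\varepsilon>0$ and $u\in W^{1,2}(N)$ set $$\mathcal E_\varepsilon(u)=\int_N\varepsilon\frac{|\nabla u|^2}{2}+\int_N\frac{W(u)}{\varepsilon},\qquad \mathcal F_{\varepsilon,g}(u)=\mathcal E_\varepsilon(u)-\int_N g\,u .$$ A critical point $u$ of $\mathcal F_{\varepsilon,g}$ is called stable if $\frac{d^2}{ds^2}\big|_{s=0}\mathcal F_{\varepsilon,g}(u+s\varphi)\ge0$ for all $\varphi\in W^{1,2}(N)$; its Morse index is the largest dimension of a subspace of $W^{1,2}(N)$ on which this second variation is negative definite. Let $c$ be a constant with $c\,W''(-1)>\max_N g$ and $c\,W''(1)>\max_N g$. Then there are $\varepsilon_0>0$, $L>0$ and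 $K<\infty$ such that the following holds for every $\varepsilon\in(0,\varepsilon_0)$. 1. $\mathcal F_{\varepsilon,g}$ has a stable critical point $a_\varepsilon$ with $-1<a_\varepsilon<-1+c\varepsilon$ almost everywhere, and a stable critical point $b_\varepsilon$ with $1<b_\varepsilon<1+c\varepsilon$ almost everywhere. 2. For all stable critical points $a_\varepsilon$, $b_\varepsilon$ with these bounds, let $\Gamma$ be the set of continuous paths $\gamma:[-1,1]\to W^{1,2}(N)$ with $\gamma(-1)=a_\varepsilon$ and $\gamma(1)=b_\varepsilon$. Then $$\beta_\varepsilon=\inf_{\gamma\in\Gamma}\ \sup_{u\in\gamma([-1,1])}\mathcal F_{\varepsilon,g}(u)$$ is a critical value: there is a critical point $u_\varepsilon\in W^{1,2}(N)$ of $\mathcal F_{\varepsilon,g}$ with $\mathcal F_{\varepsilon,g}(u_\varepsilon)=\beta_\varepsilon$ and Morse index at most $1$. 3. Every critical point $u_\varepsilon$ of $\mathcal F_{\varepsilon,g}$ with $\mathcal F_{\varepsilon,g}(u_\varepsilon)=\beta_\varepsilon$, in particular the one in 2, satisfies $L\le\mathcal E_\varepsilon(u_\varepsilon)\le K$. -/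

import Mathlib

open MeasureTheory Bundle Set
open scoped Manifold ContDiff

set_option linter.unusedSectionVars false

namespace AllenCahn
noncomputable section

section Riemannian

variable {d : ℕ} {N : Type*} [TopologicalSpace N] [ChartedSpace (EuclideanSpace ℝ (Fin d)) N]
  [RiemannianBundle (fun x : N => TangentSpace (𝓡 d) x)]

instance finiteDimensional_tangentSpace (x : N) : FiniteDimensional ℝ (TangentSpace (𝓡 d) x) :=
  inferInstanceAs (FiniteDimensional ℝ (EuclideanSpace ℝ (Fin d)))

instance completeSpace_tangentSpace (x : N) : CompleteSpace (TangentSpace (𝓡 d) x) :=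
  FiniteDimensional.complete ℝ (TangentSpace (𝓡 d) x)

/-- The differential `du_x` of a real function on `N`, as a linear form on the tangent space. -/
def differential (u : N → ℝ) (x : N) : TangentSpace (𝓡 d) x →L[ℝ] ℝ :=
  mfderiv (𝓡 d) 𝓘(ℝ, ℝ) u x

/-- The Riemannian gradient: the Riesz representative of `du_x` for the inner product on `T_x N`. -/
def grad (u : N → ℝ) (x : N) : TangentSpace (𝓡 d) x :=
  (InnerProductSpace.toDual ℝ (TangentSpace (𝓡 d) x)).symm (differential u x)

/-- The coordinate vector `∂_i` of the chart at `x₀`, at the point with coordinates `y`. -/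
def coordField (x₀ : N) (i : Fin d) (y : EuclideanSpace ℝ (Fin d)) :
    TangentSpace (𝓡 d) ((chartAt (EuclideanSpace ℝ (Fin d)) x₀).symm y) :=
  mfderiv (𝓡 d) (𝓡 d) (chartAt (EuclideanSpace ℝ (Fin d)) x₀).symm y
    (EuclideanSpace.single i (1 : ℝ) : EuclideanSpace ℝ (Fin d))

/-- The matrix `g_ij(y) = ⟨∂_i, ∂_j⟩` of the metric in the chart at `x₀`. -/
def gram (x₀ : N) (y : EuclideanSpace ℝ (Fin d)) : Matrix (Fin d) (Fin d) ℝ :=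
  Matrix.gram ℝ fun i => coordField x₀ i y

variable [IsManifold (𝓡 d) ∞ N]

theorem continuousOn_coordField (x₀ : N) (i : Fin d) :
    ContinuousOn (fun y => (⟨(chartAt (EuclideanSpace ℝ (Fin d)) x₀).symm y, coordField x₀ i y⟩ :
      TangentBundle (𝓡 d) N)) (chartAt (EuclideanSpace ℝ (Fin d)) x₀).target := by
  set e := chartAt (EuclideanSpace ℝ (Fin d)) x₀ with he
  have h1 : ContMDiffOn (𝓡 d) (𝓡 d) ∞ e.symm e.target := contMDiffOn_chart_symm
  have h2 := h1.continuousOn_tangentMapWithin (by norm_cast) e.open_target.uniqueMDiffOn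
  have h3 : Continuous (fun y : EuclideanSpace ℝ (Fin d) =>
      (⟨y, (EuclideanSpace.single i (1 : ℝ) : EuclideanSpace ℝ (Fin d))⟩ :
        TangentBundle (𝓡 d) (EuclideanSpace ℝ (Fin d)))) := by
    have h4 := (tangentBundleModelSpaceHomeomorph (𝓡 d)).symm.continuous
    rw [tangentBundleModelSpaceHomeomorph_coe_symm] at h4
    exact h4.comp (Continuous.prodMk continuous_id continuous_const)
  refine (h2.comp h3.continuousOn (fun y hy => hy)).congr fun y hy => ?_
  simp only [Function.comp, tangentMapWithin, coordField]
  rw [mfderivWithin_of_isOpen e.open_target hy]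

theorem linearIndependent_coordField (x₀ : N) {y : EuclideanSpace ℝ (Fin d)}
    (hy : y ∈ (chartAt (EuclideanSpace ℝ (Fin d)) x₀).target) :
    LinearIndependent ℝ (fun i => coordField x₀ i y) := by
  have hc : (chartAt (EuclideanSpace ℝ (Fin d)) x₀).MDifferentiable (𝓡 d) (𝓡 d) :=
    mdifferentiable_chart x₀
  have h0 : LinearIndependent ℝ (fun i : Fin d =>
      (EuclideanSpace.single i (1 : ℝ) : EuclideanSpace ℝ (Fin d))) := by
    have h1 := (EuclideanSpace.basisFun (Fin d) ℝ).toBasis.linearIndependent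
    have h2 : ((EuclideanSpace.basisFun (Fin d) ℝ).toBasis :
        Fin d → EuclideanSpace ℝ (Fin d)) = fun i => EuclideanSpace.single i (1 : ℝ) := by
      funext i; simp
    rw [h2] at h1
    exact h1
  have hk : LinearMap.ker (mfderiv (𝓡 d) (𝓡 d)
      (chartAt (EuclideanSpace ℝ (Fin d)) x₀).symm y).toLinearMap = ⊥ := by
    rw [LinearMap.ker_eq_bot]
    exact (hc.symm.mfderiv_injective hy)
  exact h0.map' _ hk

theorem gram_det_ne_zero (x₀ : N) {y : EuclideanSpace ℝ (Fin d)}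
    (hy : y ∈ (chartAt (EuclideanSpace ℝ (Fin d)) x₀).target) : (gram x₀ y).det ≠ 0 := by
  have h : (gram x₀ y).PosDef :=
    Matrix.posDef_gram_of_linearIndependent (𝕜 := ℝ) (linearIndependent_coordField x₀ hy)
  exact h.det_pos.ne'

theorem inner_grad_coordField (u : N → ℝ) (x₀ : N) (i : Fin d) (y : EuclideanSpace ℝ (Fin d)) :
    inner ℝ (grad (d := d) u ((chartAt (EuclideanSpace ℝ (Fin d)) x₀).symm y)) (coordField x₀ i y) =
      mfderiv (𝓡 d) 𝓘(ℝ, ℝ) u ((chartAt (EuclideanSpace ℝ (Fin d)) x₀).symm y)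
        (coordField x₀ i y) :=
  InnerProductSpace.toDual_symm_apply

theorem continuousOn_inner_grad_coordField {u : N → ℝ} (hu : ContMDiff (𝓡 d) 𝓘(ℝ, ℝ) ∞ u)
    (x₀ : N) (i : Fin d) :
    ContinuousOn (fun y => inner ℝ (grad (d := d) u ((chartAt (EuclideanSpace ℝ (Fin d)) x₀).symm y))
      (coordField x₀ i y)) (chartAt (EuclideanSpace ℝ (Fin d)) x₀).target := by
  have hc : (chartAt (EuclideanSpace ℝ (Fin d)) x₀).MDifferentiable (𝓡 d) (𝓡 d) :=
    mdifferentiable_chart x₀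
  have h1 : ContMDiffOn (𝓡 d) (𝓡 d) ∞ (chartAt (EuclideanSpace ℝ (Fin d)) x₀).symm
    (chartAt (EuclideanSpace ℝ (Fin d)) x₀).target := contMDiffOn_chart_symm
  have h2 : ContDiffOn ℝ ∞ (u ∘ (chartAt (EuclideanSpace ℝ (Fin d)) x₀).symm)
      (chartAt (EuclideanSpace ℝ (Fin d)) x₀).target :=
    contMDiffOn_iff_contDiffOn.1 (hu.comp_contMDiffOn h1)
  have h3 := h2.continuousOn_fderiv_of_isOpen
    (chartAt (EuclideanSpace ℝ (Fin d)) x₀).open_target (by norm_cast)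
  refine (h3.clm_apply (continuousOn_const (c := EuclideanSpace.single i (1 : ℝ)))).congr
    fun y hy => ?_
  have h4 : fderiv ℝ (u ∘ (chartAt (EuclideanSpace ℝ (Fin d)) x₀).symm) y =
      (mfderiv (𝓡 d) 𝓘(ℝ, ℝ) u ((chartAt (EuclideanSpace ℝ (Fin d)) x₀).symm y)).comp
        (mfderiv (𝓡 d) (𝓡 d) (chartAt (EuclideanSpace ℝ (Fin d)) x₀).symm y) := by
    rw [← mfderiv_comp y (hu.mdifferentiable (by simp) _) (hc.symm.mdifferentiableAt hy),
      mfderiv_eq_fderiv]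
  refine (inner_grad_coordField u x₀ i y).trans ?_
  change _ = fderiv ℝ (u ∘ (chartAt (EuclideanSpace ℝ (Fin d)) x₀).symm) y
    (EuclideanSpace.single i (1 : ℝ))
  rw [h4]
  rfl

theorem inner_grad_grad (u v : N → ℝ) (x₀ : N) {y : EuclideanSpace ℝ (Fin d)}
    (hy : y ∈ (chartAt (EuclideanSpace ℝ (Fin d)) x₀).target) :
    inner ℝ (grad (d := d) u ((chartAt (EuclideanSpace ℝ (Fin d)) x₀).symm y))
        (grad (d := d) v ((chartAt (EuclideanSpace ℝ (Fin d)) x₀).symm y)) =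
      ∑ i, ∑ j, (gram x₀ y)⁻¹ i j *
        inner ℝ (grad (d := d) u ((chartAt (EuclideanSpace ℝ (Fin d)) x₀).symm y)) (coordField x₀ j y) *
        inner ℝ (grad (d := d) v ((chartAt (EuclideanSpace ℝ (Fin d)) x₀).symm y)) (coordField x₀ i y) := by
  have hli := linearIndependent_coordField x₀ hy
  have hspan := hli.span_eq_top_of_card_eq_finrank' (by
    rw [Fintype.card_fin]; exact (finrank_euclideanSpace_fin (𝕜 := ℝ) (n := d)).symm)
  have hmem : grad (d := d) u ((chartAt (EuclideanSpace ℝ (Fin d)) x₀).symm y) ∈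
      Submodule.span ℝ (Set.range fun i => coordField x₀ i y) := by rw [hspan]; trivial
  obtain ⟨c, hc⟩ := (Submodule.mem_span_range_iff_exists_fun ℝ).1 hmem
  have hG : (fun j => inner ℝ (grad (d := d) u ((chartAt (EuclideanSpace ℝ (Fin d)) x₀).symm y))
      (coordField x₀ j y)) = (gram x₀ y).mulVec c := by
    funext j
    rw [← hc, sum_inner]
    simp only [Matrix.mulVec, dotProduct, gram, Matrix.gram_apply, inner_smul_left]
    refine Finset.sum_congr rfl fun i _ => ?_
    rw [real_inner_comm]; simp [mul_comm]
  have hc' : ∀ i, c i = ∑ j, (gram x₀ y)⁻¹ i j *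
      inner ℝ (grad (d := d) u ((chartAt (EuclideanSpace ℝ (Fin d)) x₀).symm y)) (coordField x₀ j y) := by
    intro i
    have : ((gram x₀ y)⁻¹).mulVec ((gram x₀ y).mulVec c) = c := by
      rw [Matrix.mulVec_mulVec, Matrix.nonsing_inv_mul _
        (isUnit_iff_ne_zero.2 (gram_det_ne_zero x₀ hy)), Matrix.one_mulVec]
    rw [← hG] at this
    exact (congrFun this i).symm
  conv_lhs => rw [← hc, sum_inner]
  refine Finset.sum_congr rfl fun i _ => ?_
  rw [inner_smul_left, ← Finset.sum_mul, ← hc' i, real_inner_comm]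
  simp

variable [IsContMDiffRiemannianBundle (𝓡 d) ∞ (EuclideanSpace ℝ (Fin d))
  (fun x : N => TangentSpace (𝓡 d) x)]

theorem continuousOn_gram (x₀ : N) :
    ContinuousOn (fun y => gram x₀ y) (chartAt (EuclideanSpace ℝ (Fin d)) x₀).target := by
  have : IsContinuousRiemannianBundle (EuclideanSpace ℝ (Fin d))
      (fun x : N => TangentSpace (𝓡 d) x) := by
    obtain ⟨g, hg, h⟩ := IsContMDiffRiemannianBundle.exists_contMDiff (IB := 𝓡 d) (n := ∞)
      (F := EuclideanSpace ℝ (Fin d)) (E := fun x : N => TangentSpace (𝓡 d) x)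
    exact ⟨g, hg.continuous, h⟩
  refine continuousOn_pi.2 fun i => continuousOn_pi.2 fun j => ?_
  exact (continuousOn_coordField x₀ i).inner_bundle (continuousOn_coordField x₀ j)

theorem continuous_inner_grad {u v : N → ℝ} (hu : ContMDiff (𝓡 d) 𝓘(ℝ, ℝ) ∞ u)
    (hv : ContMDiff (𝓡 d) 𝓘(ℝ, ℝ) ∞ v) :
    Continuous fun x => inner ℝ (grad (d := d) u x) (grad (d := d) v x) := by
  rw [continuous_iff_continuousAt]
  intro x₀
  have hG : ContinuousOn (fun y => (gram x₀ y)⁻¹)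
      (chartAt (EuclideanSpace ℝ (Fin d)) x₀).target := by
    have h1 := continuousOn_gram (d := d) x₀
    simp only [Matrix.inv_def]
    intro y hy
    have h2 : ContinuousWithinAt (fun y => (gram x₀ y).det)
        (chartAt (EuclideanSpace ℝ (Fin d)) x₀).target y :=
      (Continuous.matrix_det continuous_id).continuousAt.comp_continuousWithinAt (h1 y hy)
    have h3 : ContinuousWithinAt (fun y => (gram x₀ y).adjugate)
        (chartAt (EuclideanSpace ℝ (Fin d)) x₀).target y :=
      (Continuous.matrix_adjugate continuous_id).continuousAt.comp_continuousWithinAt (h1 y hy)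
    simp only [Ring.inverse_eq_inv']
    exact (h2.inv₀ (gram_det_ne_zero x₀ hy)).smul h3
  have hh : ContinuousOn (fun y =>
      inner ℝ (grad (d := d) u ((chartAt (EuclideanSpace ℝ (Fin d)) x₀).symm y))
        (grad (d := d) v ((chartAt (EuclideanSpace ℝ (Fin d)) x₀).symm y)))
      (chartAt (EuclideanSpace ℝ (Fin d)) x₀).target := by
    refine ContinuousOn.congr ?_ fun y hy => inner_grad_grad u v x₀ hy
    refine continuousOn_finsetSum _ fun i _ => continuousOn_finsetSum _ fun j _ => ?_
    refine ((ContinuousOn.mul ?_ (continuousOn_inner_grad_coordField hu x₀ j)).mul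
      (continuousOn_inner_grad_coordField hv x₀ i))
    exact continuousOn_pi.1 (continuousOn_pi.1 hG i) j
  set e := chartAt (EuclideanSpace ℝ (Fin d)) x₀ with he
  have hcomp := hh.comp e.continuousOn e.mapsTo
  refine (hcomp.congr fun x hx => ?_).continuousAt
    (e.open_source.mem_nhds (mem_chart_source _ x₀))
  simp only [Function.comp]
  rw [e.left_inv hx]

end Riemannian

section Volume
variable {d : ℕ} {N : Type*} [TopologicalSpace N] [ChartedSpace (EuclideanSpace ℝ (Fin d)) N]
  [RiemannianBundle (fun x : N => TangentSpace (𝓡 d) x)]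
  [MeasurableSpace N] [BorelSpace N]

/-- The Riemannian volume `√(det g_ij) dy` on the domain of the chart at `x₀`, as a measure on `N`
carried by that domain. -/
def chartVolume (x₀ : N) : Measure N :=
  Measure.map (chartAt (EuclideanSpace ℝ (Fin d)) x₀).symm
    ((volume.restrict (chartAt (EuclideanSpace ℝ (Fin d)) x₀).target).withDensity
      fun y => ENNReal.ofReal (Real.sqrt (gram x₀ y).det))

variable [T2Space N] [CompactSpace N] [IsManifold (𝓡 d) ∞ N]

variable (d N) in
/-- A smooth partition of unity subordinate to the chart domains. -/
def chartPartition : SmoothPartitionOfUnity N (𝓡 d) N univ :=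
  Classical.choose (SmoothPartitionOfUnity.exists_isSubordinate_chartAt_source (𝓡 d) N)

variable (d N) in
/-- The Riemannian volume measure of `N`: the chart volumes glued by a partition of unity. By the
change of variables formula it does not depend on the partition. -/
def vol : Measure N :=
  Measure.sum fun x₀ : N =>
    (chartVolume (d := d) x₀).withDensity fun x => ENNReal.ofReal (chartPartition d N x₀ x)

variable [IsContMDiffRiemannianBundle (𝓡 d) ∞ (EuclideanSpace ℝ (Fin d))
  (fun x : N => TangentSpace (𝓡 d) x)]

theorem chartVolume_lt_top (x₀ : N) {K : Set N} (hK : IsCompact K)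
    (hs : K ⊆ (chartAt (EuclideanSpace ℝ (Fin d)) x₀).source) :
    chartVolume (d := d) x₀ K < ⊤ := by
  have hcs := continuousOn_gram (d := d) x₀
  unfold chartVolume
  set e := chartAt (EuclideanSpace ℝ (Fin d)) x₀ with he
  have hmt : MeasurableSet e.target := e.open_target.measurableSet
  have hae : AEMeasurable e.symm ((volume.restrict e.target).withDensity
      fun y => ENNReal.ofReal (Real.sqrt (gram x₀ y).det)) :=
    (e.continuousOn_symm.aemeasurable hmt).mono_ac (withDensity_absolutelyContinuous _ _)
  rw [Measure.map_apply_of_aemeasurable hae hK.measurableSet]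
  have hc : IsCompact (e '' K) := hK.image_of_continuousOn (e.continuousOn.mono hs)
  have hct : e '' K ⊆ e.target := (e.mapsTo.mono_left hs).image_subset
  have hnull : ((volume.restrict e.target).withDensity
      fun y => ENNReal.ofReal (Real.sqrt (gram x₀ y).det)) (e.target)ᶜ = 0 :=
    withDensity_absolutelyContinuous _ _ (by simp [Measure.restrict_apply hmt.compl])
  have hsub : e.symm ⁻¹' K ⊆ e '' K ∪ e.targetᶜ := by
    intro y hy
    by_cases h : y ∈ e.target
    · exact Or.inl ⟨e.symm y, hy, e.right_inv h⟩
    · exact Or.inr h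
  refine (measure_mono hsub).trans_lt ((measure_union_le _ _).trans_lt ?_)
  rw [hnull, add_zero, withDensity_apply _ hc.measurableSet,
    Measure.restrict_restrict_of_subset hct]
  have hcont : ContinuousOn (fun y => Real.sqrt (gram x₀ y).det) (e '' K) :=
    (Real.continuous_sqrt.comp (Continuous.matrix_det continuous_id)).comp_continuousOn
      (hcs.mono hct)
  exact (hcont.integrableOn_compact hc).lintegral_lt_top

instance isFiniteMeasure_vol : IsFiniteMeasure (vol d N) := by
  refine ⟨?_⟩
  rw [vol, Measure.sum_apply _ MeasurableSet.univ]
  have hsub : ∀ x₀ : N, tsupport (chartPartition d N x₀) ⊆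
      (chartAt (EuclideanSpace ℝ (Fin d)) x₀).source :=
    Classical.choose_spec (SmoothPartitionOfUnity.exists_isSubordinate_chartAt_source (𝓡 d) N)
  have hfin := (chartPartition d N).locallyFinite.finite_nonempty_of_compact
  have hz : ∀ x₀ : N, x₀ ∉ hfin.toFinset →
      ((chartVolume (d := d) x₀).withDensity
        fun x => ENNReal.ofReal (chartPartition d N x₀ x)) univ = 0 := by
    intro x₀ hx
    simp only [Set.Finite.mem_toFinset, Set.mem_ofPred_eq, Set.not_nonempty_iff_eq_empty,
      Function.support_eq_empty_iff] at hx
    simp [hx]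
  rw [tsum_eq_sum (s := hfin.toFinset) (fun x₀ hx => hz x₀ hx)]
  refine ENNReal.sum_lt_top.2 fun x₀ _ => ?_
  rw [withDensity_apply _ MeasurableSet.univ, Measure.restrict_univ]
  have hle : ∀ x, ENNReal.ofReal (chartPartition d N x₀ x) ≤
      (tsupport (chartPartition d N x₀)).indicator (fun _ => 1) x := by
    intro x
    by_cases hx : x ∈ tsupport (chartPartition d N x₀)
    · rw [indicator_of_mem hx]
      exact ENNReal.ofReal_le_one.2 ((chartPartition d N).le_one x₀ x)
    · rw [image_eq_zero_of_notMem_tsupport hx]; simp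
  refine (lintegral_mono hle).trans_lt ?_
  have hcl : IsClosed (tsupport (chartPartition d N x₀)) := isClosed_tsupport _
  rw [lintegral_indicator hcl.measurableSet]
  simpa using chartVolume_lt_top x₀ hcl.isCompact (hsub x₀)

theorem integrable_vol {f : N → ℝ} (hf : Continuous f) : Integrable f (vol d N) :=
  hf.integrable_of_hasCompactSupport (HasCompactSupport.of_compactSpace f)

end Volume

section Sobolev
variable (d : ℕ) (N : Type*) [TopologicalSpace N] [ChartedSpace (EuclideanSpace ℝ (Fin d)) N]

/-- The smooth real functions on `N`. -/
def SmoothFn : Type _ := ContMDiffMap (𝓡 d) 𝓘(ℝ, ℝ) N ℝ ∞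

instance smoothFnAddCommGroup : AddCommGroup (SmoothFn d N) :=
  inferInstanceAs (AddCommGroup (ContMDiffMap (𝓡 d) 𝓘(ℝ, ℝ) N ℝ ∞))

instance smoothFnModule : Module ℝ (SmoothFn d N) :=
  inferInstanceAs (Module ℝ (ContMDiffMap (𝓡 d) 𝓘(ℝ, ℝ) N ℝ ∞))

variable {d N}

/-- The underlying function. -/
def SmoothFn.toFun (u : SmoothFn d N) : N → ℝ := u.1

theorem SmoothFn.contMDiff (u : SmoothFn d N) : ContMDiff (𝓡 d) 𝓘(ℝ, ℝ) ∞ u.toFun := u.2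

variable [RiemannianBundle (fun x : N => TangentSpace (𝓡 d) x)]
  [MeasurableSpace N] [BorelSpace N] [T2Space N] [CompactSpace N] [IsManifold (𝓡 d) ∞ N]
  [IsContMDiffRiemannianBundle (𝓡 d) ∞ (EuclideanSpace ℝ (Fin d))
    (fun x : N => TangentSpace (𝓡 d) x)]

/-- The inner product `∫ (u v + ⟨∇u, ∇v⟩)` of `W^{1,2}` on smooth functions. -/
def sobolevInner (u v : SmoothFn d N) : ℝ :=
  ∫ x, (u.toFun x * v.toFun x + inner ℝ (grad (d := d) u.toFun x) (grad (d := d) v.toFun x))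
    ∂(vol d N)

theorem SmoothFn.add_apply (u v : SmoothFn d N) (x : N) :
    (u + v).toFun x = u.toFun x + v.toFun x :=
  congrFun (ContMDiffMap.coe_add (𝕜 := ℝ) (I := 𝓡 d) (I' := 𝓘(ℝ, ℝ)) (n := ∞) u v) x

theorem SmoothFn.smul_apply (c : ℝ) (u : SmoothFn d N) (x : N) :
    (c • u).toFun x = c * u.toFun x :=
  congrFun (ContMDiffMap.coe_smul (𝕜 := ℝ) (I := 𝓡 d) (n := ∞) c u) x

theorem grad_add (u v : SmoothFn d N) (x : N) :
    grad (d := d) (u + v).toFun x = grad (d := d) u.toFun x + grad (d := d) v.toFun x := by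
  have h : differential (d := d) (u + v).toFun x =
      differential (d := d) u.toFun x + differential (d := d) v.toFun x := by
    rw [show (u + v).toFun = u.toFun + v.toFun from funext (SmoothFn.add_apply u v)]
    exact mfderiv_add (u.contMDiff.mdifferentiable (by simp) x)
      (v.contMDiff.mdifferentiable (by simp) x)
  unfold grad
  rw [h, map_add]

theorem grad_smul (c : ℝ) (u : SmoothFn d N) (x : N) :
    grad (d := d) (c • u).toFun x = c • grad (d := d) u.toFun x := by
  have h : differential (d := d) (c • u).toFun x = c • differential (d := d) u.toFun x := by
    rw [show (c • u).toFun = c • u.toFun from funext (SmoothFn.smul_apply c u)]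
    exact const_smul_mfderiv (u.contMDiff.mdifferentiable (by simp) x) c
  unfold grad
  rw [h, (InnerProductSpace.toDual ℝ (TangentSpace (𝓡 d) x)).symm.map_smulₛₗ, conj_trivial]

theorem integrable_sobolevInner (u v : SmoothFn d N) :
    Integrable (fun x => u.toFun x * v.toFun x +
      inner ℝ (grad (d := d) u.toFun x) (grad (d := d) v.toFun x)) (vol d N) :=
  integrable_vol ((u.contMDiff.continuous.mul v.contMDiff.continuous).add
    (continuous_inner_grad u.contMDiff v.contMDiff))

instance sobolevCore : PreInnerProductSpace.Core ℝ (SmoothFn d N) where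
  inner := sobolevInner
  conj_inner_symm u v := by
    simp only [sobolevInner, conj_trivial]
    refine integral_congr_ae (Filter.Eventually.of_forall fun x => ?_)
    simp only [mul_comm (v.toFun x), real_inner_comm]
  re_inner_nonneg u := by
    simp only [sobolevInner, RCLike.re_to_real]
    exact integral_nonneg fun x => add_nonneg (mul_self_nonneg _) real_inner_self_nonneg
  add_left u v w := by
    simp only [sobolevInner]
    rw [← integral_add (integrable_sobolevInner u w) (integrable_sobolevInner v w)]
    refine integral_congr_ae (Filter.Eventually.of_forall fun x => ?_)
    simp only [grad_add, inner_add_left]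
    rw [SmoothFn.add_apply]; ring
  smul_left u v c := by
    simp only [sobolevInner, conj_trivial]
    rw [← integral_const_mul]
    refine integral_congr_ae (Filter.Eventually.of_forall fun x => ?_)
    simp only [grad_smul, inner_smul_left, conj_trivial]
    rw [SmoothFn.smul_apply]; ring

instance smoothFnSeminormed : SeminormedAddCommGroup (SmoothFn d N) :=
  InnerProductSpace.Core.toSeminormedAddCommGroup (𝕜 := ℝ)

instance smoothFnInnerProductSpace : InnerProductSpace ℝ (SmoothFn d N) := InnerProductSpace.ofCore sobolevCore

theorem norm_sq_smoothFn (u : SmoothFn d N) :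
    ‖u‖ ^ 2 = ∫ x, (u.toFun x ^ 2 + ‖grad (d := d) u.toFun x‖ ^ 2) ∂(vol d N) := by
  have h : inner ℝ u u = sobolevInner u u := rfl
  rw [← real_inner_self_eq_norm_sq, h, sobolevInner]
  refine integral_congr_ae (Filter.Eventually.of_forall fun x => ?_)
  simp only [real_inner_self_eq_norm_sq, sq]

variable (d N) in
/-- The Sobolev space `W^{1,2}(N)` of the closed manifold `N`: the Hilbert space obtained by
completing the smooth functions for the norm `(∫ u² + |∇u|²)^{1/2}`. -/
abbrev W12 : Type _ := UniformSpace.Completion (SmoothFn d N)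

theorem SmoothFn.memLp (u : SmoothFn d N) : MemLp u.toFun 2 (vol d N) :=
  u.contMDiff.continuous.memLp_of_hasCompactSupport (HasCompactSupport.of_compactSpace _)

theorem SmoothFn.norm_toLp_sq (u : SmoothFn d N) :
    ‖u.memLp.toLp u.toFun‖ ^ 2 = ∫ x, u.toFun x ^ 2 ∂(vol d N) := by
  rw [← real_inner_self_eq_norm_sq, L2.inner_def]
  refine integral_congr_ae ?_
  filter_upwards [u.memLp.coeFn_toLp] with x hx
  rw [hx]; simp [sq]

theorem SmoothFn.norm_toLp_le (u : SmoothFn d N) : ‖u.memLp.toLp u.toFun‖ ≤ 1 * ‖u‖ := by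
  rw [one_mul]
  refine le_of_sq_le_sq ?_ (norm_nonneg _)
  rw [u.norm_toLp_sq, norm_sq_smoothFn]
  have h1 : Integrable (fun x => u.toFun x ^ 2) (vol d N) :=
    integrable_vol (u.contMDiff.continuous.pow 2)
  refine integral_mono h1 ?_ fun x => le_add_of_nonneg_right (sq_nonneg _)
  refine (integrable_sobolevInner u u).congr (Filter.Eventually.of_forall fun x => ?_)
  simp only [real_inner_self_eq_norm_sq, sq]

variable (d N) in
def smoothToL2 : SmoothFn d N →L[ℝ] Lp ℝ 2 (vol d N) :=
  LinearMap.mkContinuous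
    { toFun := fun u => u.memLp.toLp u.toFun
      map_add' := fun u v => by
        rw [← MemLp.toLp_add]
        exact MemLp.toLp_congr _ _ (Filter.Eventually.of_forall (SmoothFn.add_apply u v))
      map_smul' := fun c u => by
        rw [RingHom.id_apply, ← MemLp.toLp_const_smul]
        exact MemLp.toLp_congr _ _ (Filter.Eventually.of_forall (SmoothFn.smul_apply c u)) } 1 SmoothFn.norm_toLp_le

variable (d N) in
/-- The inclusion `W^{1,2}(N) → L²(N)`, the continuous extension of the inclusion of smooth functions.
The function underlying `u : W12 d N` is `toL2 d N u`. -/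
def toL2 : W12 d N →L[ℝ] Lp ℝ 2 (vol d N) :=
  (smoothToL2 d N).extend UniformSpace.Completion.toComplL

theorem toL2_coe (u : SmoothFn d N) : toL2 d N u = u.memLp.toLp u.toFun := 
  (smoothToL2 d N).extend_eq UniformSpace.Completion.denseRange_coe
    (UniformSpace.Completion.isUniformInducing_coe _) u

/-- The Dirichlet integral `∫ |∇u|²` on `W^{1,2}(N)`. It is continuous and has its usual value on
smooth functions, see `continuous_dirichlet` and `dirichlet_coe`. -/
def dirichlet (u : W12 d N) : ℝ := ‖u‖ ^ 2 - ‖toL2 d N u‖ ^ 2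

theorem continuous_dirichlet : Continuous (dirichlet : W12 d N → ℝ) :=
  (continuous_norm.pow 2).sub ((toL2 d N).continuous.norm.pow 2)

theorem dirichlet_coe (u : SmoothFn d N) :
    dirichlet (u : W12 d N) = ∫ x, ‖grad (d := d) u.toFun x‖ ^ 2 ∂(vol d N) := by
  have h1 : Integrable (fun x => u.toFun x ^ 2) (vol d N) :=
    integrable_vol (u.contMDiff.continuous.pow 2)
  have h2 : Integrable (fun x => ‖grad (d := d) u.toFun x‖ ^ 2) (vol d N) := by
    refine (integrable_vol (continuous_inner_grad u.contMDiff u.contMDiff)).congr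
      (Filter.Eventually.of_forall fun x => ?_)
    simp only [real_inner_self_eq_norm_sq]
  rw [dirichlet, UniformSpace.Completion.norm_coe, toL2_coe, u.norm_toLp_sq, norm_sq_smoothFn,
    integral_add h1 h2]
  ring

end Sobolev

section Functionals

/-- Double-well potentials `W : ℝ → [0, ∞)` of class `C²` with zeros exactly at `±1`, both
nondegenerate, and with quadratic growth outside `[-2, 2]`: there `W` is bounded below by a positive
multiple of `s²` and `W''` is bounded (so that `W'` grows at most linearly, `W` quadratically). -/
structure IsDoubleWell (W : ℝ → ℝ) : Prop where
  contDiff : ContDiff ℝ 2 W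
  nonneg : ∀ s, 0 ≤ W s
  zero_iff : ∀ s, W s = 0 ↔ s = -1 ∨ s = 1
  second_deriv_neg_one : 0 < iteratedDeriv 2 W (-1)
  second_deriv_one : 0 < iteratedDeriv 2 W 1
  lower_growth : ∃ κ > 0, ∀ s, 2 ≤ |s| → κ * s ^ 2 ≤ W s
  upper_growth : ∃ C, ∀ s, 2 ≤ |s| → |iteratedDeriv 2 W s| ≤ C

variable {d : ℕ} {N : Type*} [TopologicalSpace N] [ChartedSpace (EuclideanSpace ℝ (Fin d)) N]
  [RiemannianBundle (fun x : N => TangentSpace (𝓡 d) x)]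
  [MeasurableSpace N] [BorelSpace N] [T2Space N] [CompactSpace N] [IsManifold (𝓡 d) ∞ N]
  [IsContMDiffRiemannianBundle (𝓡 d) ∞ (EuclideanSpace ℝ (Fin d))
    (fun x : N => TangentSpace (𝓡 d) x)]

/-- The Allen--Cahn energy `E_ε(u) = ∫ ε |∇u|² / 2 + ∫ W(u) / ε`. -/
def energyE (W : ℝ → ℝ) (ε : ℝ) (u : W12 d N) : ℝ :=
  ε / 2 * dirichlet u + ε⁻¹ * ∫ x, W (toL2 d N u x) ∂(vol d N)

/-- The inhomogeneous functional `F_{ε,g}(u) = E_ε(u) - ∫ g u`. -/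
def energyF (W : ℝ → ℝ) (g : N → ℝ) (ε : ℝ) (u : W12 d N) : ℝ :=
  energyE W ε u - ∫ x, g x * toL2 d N u x ∂(vol d N)

/-- `u` is a critical point of `F_{ε,g}`: the derivative of the functional on the Hilbert space
`W^{1,2}(N)` exists and vanishes at `u`. -/
def IsCriticalPoint (W : ℝ → ℝ) (g : N → ℝ) (ε : ℝ) (u : W12 d N) : Prop :=
  HasFDerivAt (energyF W g ε) (0 : W12 d N →L[ℝ] ℝ) u

/-- The second variation `d²/ds² F_{ε,g}(u + s φ)` at `s = 0`. -/
def secondVariation (W : ℝ → ℝ) (g : N → ℝ) (ε : ℝ) (u φ : W12 d N) : ℝ :=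
  iteratedDeriv 2 (fun s : ℝ => energyF W g ε (u + s • φ)) 0

/-- Stability: the second variation is nonnegative. -/
def IsStable (W : ℝ → ℝ) (g : N → ℝ) (ε : ℝ) (u : W12 d N) : Prop :=
  ∀ φ : W12 d N, 0 ≤ secondVariation W g ε u φ

/-- The Morse index: the supremum of the dimensions of the subspaces of `W^{1,2}(N)` on which the
second variation at `u` is negative definite. -/
def morseIndex (W : ℝ → ℝ) (g : N → ℝ) (ε : ℝ) (u : W12 d N) : ℕ∞ :=
  ⨆ (V : Submodule ℝ (W12 d N)) (_ : ∀ φ ∈ V, φ ≠ 0 → secondVariation W g ε u φ < 0),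
    Cardinal.toENat (Module.rank ℝ V)

/-- Stable critical points `a` of `F_{ε,g}` with `-1 < a < -1 + c ε`. -/
structure IsLowerValley (W : ℝ → ℝ) (g : N → ℝ) (c ε : ℝ) (a : W12 d N) : Prop where
  critical : IsCriticalPoint W g ε a
  stable : IsStable W g ε a
  bounds : ∀ᵐ x ∂(vol d N), -1 < toL2 d N a x ∧ toL2 d N a x < -1 + c * ε

/-- Stable critical points `b` of `F_{ε,g}` with `1 < b < 1 + c ε`. -/
structure IsUpperValley (W : ℝ → ℝ) (g : N → ℝ) (c ε : ℝ) (b : W12 d N) : Prop where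
  critical : IsCriticalPoint W g ε b
  stable : IsStable W g ε b
  bounds : ∀ᵐ x ∂(vol d N), 1 < toL2 d N b x ∧ toL2 d N b x < 1 + c * ε

/-- The continuous paths `γ : [-1, 1] → W^{1,2}(N)` from `a` to `b`. -/
def admissiblePaths (a b : W12 d N) : Set C(Icc (-1 : ℝ) 1, W12 d N) :=
  {γ | γ ⟨-1, by norm_num⟩ = a ∧ γ ⟨1, by norm_num⟩ = b}

/-- The min-max value: the infimum over the admissible paths from `a` to `b` of the supremum of
`F_{ε,g}` along the path, computed in the extended reals. -/
def minMaxValue (W : ℝ → ℝ) (g : N → ℝ) (ε : ℝ) (a b : W12 d N) : EReal :=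
  ⨅ γ ∈ admissiblePaths a b, ⨆ t, (energyF W g ε (γ t) : EReal)

end Functionals

end

end AllenCahn

set_option linter.unusedSectionVars false

/-! The functional has mountain pass geometry on `W12`, uniformly in ε. Since `W''` is bounded, its
gradient is Lipschitz; since `W` grows quadratically, it is coercive. The gradient is `ε • u` plus a
term that depends continuously on the L² class of `u` alone, so Rellich's theorem
(`isCompactOperator_toL2`) gives the Palais-Smale condition (`exists_tendsto_of_palaisSmale`).

Valleys (`IsDoubleWell.exists_valley`). Near a well `z` the derivative `W'` is strongly monotone.
Extending it to a strongly monotone function on the line makes the functional strongly convex, with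
a critical point found by a contraction. Two constants in `(z, z + c ε)` act as sub- and
supersolution, so a smooth truncation that does not raise the energy must fix this minimizer; it
therefore takes values where the extension agrees with `W'`, and it is a stable critical point of
the original functional.

Barrier (`exists_barrier`). Let `h` be a smooth step from 0 to 1 and fix a small `r`. Every path
from the lower to the upper valley crosses the slice `∫ h(u) = r`. There the Sobolev inequality with
exponent 1, applied to `h(u)`, together with the Modica-Mortola bound of `|∇h(u)|` by the energy
density, is an isoperimetric inequality: its exponent `d/(d-1)` exceeds 1, so for small `r` the
energy beats any prescribed multiple of `r`. What `-∫ g u` can gain is only of order `r`, up to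
errors absorbed by the energy. Hence the functional is at least `∫ g + r` on the slice, whereas on
the valleys it is at most `∫ g + O(ε)` (`IsDoubleWell.exists_energyE_le_of_near`).

Upper bound (`IsDoubleWell.exists_joinedIn`). Growing finitely many coordinate balls until they
cover `N`, and replacing the sharp interface by one of width ε, joins the constants -1 and 1 through
functions of energy bounded independently of ε; segments join these constants to the valleys.

Critical point and index (`exists_critical_not_descentPlane`). If the index were at least 2 at every
critical point of the min-max level, each would carry a plane of directions in which the functional
is strictly concave. A path is one-dimensional, so the projection of the gradient along it to such a
plane can be approximated by a nowhere vanishing one. Moving against this direction lowers the path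
near the critical points by a fixed amount; elsewhere a gradient step lowers it. The result is a
path below the min-max level.

Energy bounds. Small energy forces the functional below the barrier
(`IsDoubleWell.exists_energyF_lt_of_energyE_lt`), and the functional controls the energy from above
(`IsDoubleWell.exists_energyE_le`). -/

namespace AllenCahn
noncomputable section

/-! ### A mountain pass theorem with index information -/

section MountainPass
open Filter Topology

/-- A curve in the plane avoids the origin after a small perturbation. This is where the
one-dimensionality of paths meets the two-dimensionality of a descent plane, and it is the source of
the bound 1 for the index. -/
theorem exists_nonvanishing_approximation {α β : ℝ} (f₁ f₂ : C(Icc α β, ℝ)) {η : ℝ} (hη : 0 < η) :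
    ∃ g₁ g₂ : C(Icc α β, ℝ), (∀ t, |g₁ t - f₁ t| < η) ∧ (∀ t, |g₂ t - f₂ t| < η) ∧
      ∀ t, 0 < g₁ t ^ 2 + g₂ t ^ 2 := by
  obtain ⟨p₁, hp₁⟩ := exists_polynomial_near_continuousMap α β f₁ (η / 2) (by positivity)
  obtain ⟨p₂, hp₂⟩ := exists_polynomial_near_continuousMap α β f₂ (η / 2) (by positivity)
  let P : ℝ → ℝ × ℝ := fun x => (p₁.eval x, p₂.eval x)
  have hP : ContDiff ℝ 1 P := by
    have h1 : ContDiff ℝ 1 fun x => p₁.eval x := by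
      simp only [Polynomial.eval_eq_sum_range]; fun_prop
    have h2 : ContDiff ℝ 1 fun x => p₂.eval x := by
      simp only [Polynomial.eval_eq_sum_range]; fun_prop
    exact h1.prodMk h2
  -- The range of a merely continuous curve can have interior; that of a C¹ curve in the plane
  -- cannot. Hence the passage to polynomials, followed by a translation by a small vector outside
  -- the range.
  have hd : Dense (range P)ᶜ := hP.dense_compl_range_of_finrank_lt_finrank (by simp)
  obtain ⟨z, hz, hzd⟩ := hd.exists_mem_open Metric.isOpen_ball
    ⟨(0 : ℝ × ℝ), Metric.mem_ball_self (by positivity : 0 < η / 2)⟩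
  rw [mem_ball_zero_iff, Prod.norm_def, max_lt_iff, Real.norm_eq_abs, Real.norm_eq_abs] at hzd
  refine ⟨p₁.toContinuousMapOn _ - ContinuousMap.const _ z.1,
    p₂.toContinuousMapOn _ - ContinuousMap.const _ z.2, fun t => ?_, fun t => ?_, fun t => ?_⟩
  · have h := (ContinuousMap.norm_coe_le_norm _ t).trans_lt hp₁
    simp only [ContinuousMap.coe_sub, Pi.sub_apply, Polynomial.toContinuousMapOn_apply,
      Real.norm_eq_abs, ContinuousMap.const_apply] at h ⊢
    rw [abs_lt] at *
    constructor <;> linarith [h.1, h.2, hzd.1.1, hzd.1.2]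
  · have h := (ContinuousMap.norm_coe_le_norm _ t).trans_lt hp₂
    have h3 := hzd.2
    simp only [ContinuousMap.coe_sub, Pi.sub_apply, Polynomial.toContinuousMapOn_apply,
      Real.norm_eq_abs, ContinuousMap.const_apply] at h ⊢
    rw [abs_lt] at *
    constructor <;> linarith [h.1, h.2]
  · by_contra hcon
    apply hz
    refine ⟨t, ?_⟩
    simp only [ContinuousMap.coe_sub, Pi.sub_apply, Polynomial.toContinuousMapOn_apply,
      Polynomial.toContinuousMap_apply, ContinuousMap.const_apply, not_lt] at hcon
    have h1 : p₁.eval (t : ℝ) - z.1 = 0 := by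
      have := sq_nonneg (p₂.eval (t : ℝ) - z.2)
      exact pow_eq_zero_iff two_ne_zero |>.1 (le_antisymm (by linarith) (sq_nonneg _))
    have h2 : p₂.eval (t : ℝ) - z.2 = 0 := by
      have := sq_nonneg (p₁.eval (t : ℝ) - z.1)
      exact pow_eq_zero_iff two_ne_zero |>.1 (le_antisymm (by linarith) (sq_nonneg _))
    exact Prod.ext (sub_eq_zero.1 h1) (sub_eq_zero.1 h2)

variable {H : Type*} [NormedAddCommGroup H] [InnerProductSpace ℝ H]

/-- Near `u` the function `F`, with gradient `G`, is uniformly strictly concave in the directions of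
the plane spanned by `e₁` and `e₂`. -/
structure IsDescentPlane (F : H → ℝ) (G : H → H) (u e₁ e₂ : H) (c r : ℝ) : Prop where
  c_pos : 0 < c
  r_pos : 0 < r
  le : ∀ w ∈ Metric.ball u r, ∀ x y : ℝ, x ^ 2 + y ^ 2 = 1 → ∀ s ∈ Icc 0 r,
    F (w + s • (x • e₁ + y • e₂)) ≤ F w + s * inner ℝ (G w) (x • e₁ + y • e₂) - c * s ^ 2

theorem IsDescentPlane.mono {F : H → ℝ} {G : H → H} {u e₁ e₂ : H} {c r r' : ℝ}
    (h : IsDescentPlane F G u e₁ e₂ c r) (h0 : 0 < r') (hr : r' ≤ r) :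
    IsDescentPlane F G u e₁ e₂ c r' :=
  ⟨h.c_pos, h0, fun w hw x y hxy s hs => h.le w (Metric.ball_subset_ball hr hw) x y hxy s
    ⟨hs.1, hs.2.trans hr⟩⟩

/-- Move the path by length `ρ` in the plane, against an approximate projection of the gradient. To
first order this costs at most the approximation error `η`, and strict concavity yields the gain `c
* ρ ^ 2` whatever the size of the gradient. -/
theorem IsDescentPlane.exists_push {F : H → ℝ} {G : H → H} {u e₁ e₂ : H} {c r : ℝ}
    (h : IsDescentPlane F G u e₁ e₂ c r) (hG : Continuous G) {α β : ℝ} (γ : C(Icc α β, H))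
    {η ρ : ℝ} (hη : 0 < η) (hρ : 0 < ρ) (hρr : ρ ≤ r) :
    ∃ γ' : C(Icc α β, H), (∀ t, F (γ' t) ≤ F (γ t) + η) ∧
      (∀ t, γ t ∈ Metric.ball u (3 / 4 * r) → F (γ' t) ≤ F (γ t) + η - c * ρ ^ 2) ∧
      (∀ t, ‖γ' t - γ t‖ ≤ ρ * (‖e₁‖ + ‖e₂‖)) ∧
      ∀ t, γ t ∉ Metric.ball u r → γ' t = γ t := by
  have hr := h.r_pos
  have hc := h.c_pos
  let f (e : H) : C(Icc α β, ℝ) := ⟨fun t => inner ℝ (G (γ t)) e, by fun_prop⟩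
  -- Two components with error `η / (2 * ρ)` each, over a displacement of length `ρ`, cost `η` in
  -- total.
  obtain ⟨g₁, g₂, h₁, h₂, hpos⟩ :=
    exists_nonvanishing_approximation (f e₁) (f e₂) (η := η / (2 * ρ)) (by positivity)
  let q : Icc α β → ℝ := fun t => √(g₁ t ^ 2 + g₂ t ^ 2)
  have hq : ∀ t, 0 < q t := fun t => Real.sqrt_pos.2 (hpos t)
  have hq2 : ∀ t, q t ^ 2 = g₁ t ^ 2 + g₂ t ^ 2 := fun t => Real.sq_sqrt (hpos t).le
  have hqc : Continuous q := by fun_prop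
  let x : Icc α β → ℝ := fun t => -(g₁ t) / q t
  let y : Icc α β → ℝ := fun t => -(g₂ t) / q t
  have hxc : Continuous x := Continuous.div (by fun_prop) hqc fun t => (hq t).ne'
  have hyc : Continuous y := Continuous.div (by fun_prop) hqc fun t => (hq t).ne'
  have hxy : ∀ t, x t ^ 2 + y t ^ 2 = 1 := fun t => by
    simp only [x, y, div_pow, ← add_div, neg_sq]
    rw [← hq2]; exact div_self (pow_pos (hq t) 2).ne'
  let v : Icc α β → H := fun t => x t • e₁ + y t • e₂
  have hvc : Continuous v := by fun_prop
  have hx1 : ∀ t, |x t| ≤ 1 := fun t => by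
    rw [← sq_le_one_iff_abs_le_one]; nlinarith [hxy t, sq_nonneg (y t)]
  have hy1 : ∀ t, |y t| ≤ 1 := fun t => by
    rw [← sq_le_one_iff_abs_le_one]; nlinarith [hxy t, sq_nonneg (x t)]
  have hvn : ∀ t, ‖v t‖ ≤ ‖e₁‖ + ‖e₂‖ := fun t => by
    refine (norm_add_le _ _).trans (add_le_add ?_ ?_)
    · rw [norm_smul, Real.norm_eq_abs]; exact mul_le_of_le_one_left (norm_nonneg _) (hx1 t)
    · rw [norm_smul, Real.norm_eq_abs]; exact mul_le_of_le_one_left (norm_nonneg _) (hy1 t)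
  have hvG : ∀ t, inner ℝ (G (γ t)) (v t) ≤ η / ρ := fun t => by
    have e1 : inner ℝ (G (γ t)) (v t) = x t * f e₁ t + y t * f e₂ t := by
      simp only [v, inner_add_right, inner_smul_right]; rfl
    have e2 : x t * g₁ t + y t * g₂ t = - q t := by
      simp only [x, y]
      have := (hq t).ne'
      field_simp
      rw [hq2]; ring
    have e3 : x t * (f e₁ t - g₁ t) ≤ η / (2 * ρ) := by
      refine (le_abs_self _).trans ?_
      rw [abs_mul, abs_sub_comm]
      exact (mul_le_of_le_one_left (abs_nonneg _) (hx1 t)).trans (h₁ t).le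
    have e4 : y t * (f e₂ t - g₂ t) ≤ η / (2 * ρ) := by
      refine (le_abs_self _).trans ?_
      rw [abs_mul, abs_sub_comm]
      exact (mul_le_of_le_one_left (abs_nonneg _) (hy1 t)).trans (h₂ t).le
    have e5 : η / (2 * ρ) + η / (2 * ρ) = η / ρ := by field_simp; ring
    nlinarith [hq t]
  -- A cutoff in the distance to `u`: 1 up to `3 / 4 * r`, then affine down to 0 at `r`.
  let χ : Icc α β → ℝ := fun t => max 0 (min 1 (4 - 4 * dist (γ t) u / r))
  have hχc : Continuous χ := by fun_prop
  have hχ0 : ∀ t, 0 ≤ χ t := fun t => le_max_left _ _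
  have hχ1 : ∀ t, χ t ≤ 1 := fun t => max_le zero_le_one (min_le_left _ _)
  have hχin : ∀ t, γ t ∈ Metric.ball u (3 / 4 * r) → χ t = 1 := fun t ht => by
    have : 4 * dist (γ t) u / r ≤ 3 := by
      rw [div_le_iff₀ hr]; rw [Metric.mem_ball] at ht; linarith
    simp only [χ]
    rw [min_eq_left (by linarith), max_eq_right zero_le_one]
  have hχout : ∀ t, γ t ∉ Metric.ball u r → χ t = 0 := fun t ht => by
    have : 4 ≤ 4 * dist (γ t) u / r := by
      rw [le_div_iff₀ hr]; rw [Metric.mem_ball, not_lt] at ht; linarith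
    simp only [χ]
    exact max_eq_left ((min_le_right _ _).trans (by linarith))
  have key : ∀ t, F (γ t + (ρ * χ t) • v t) ≤ F (γ t) + η - c * (ρ * χ t) ^ 2 := fun t => by
    by_cases ht : γ t ∈ Metric.ball u r
    · have h3 := h.le (γ t) ht (x t) (y t) (hxy t) (ρ * χ t)
        ⟨mul_nonneg hρ.le (hχ0 t), (mul_le_of_le_one_right hρ.le (hχ1 t)).trans hρr⟩
      have h4 : ρ * χ t * inner ℝ (G (γ t)) (v t) ≤ η := by
        calc ρ * χ t * inner ℝ (G (γ t)) (v t) ≤ ρ * χ t * (η / ρ) :=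
              mul_le_mul_of_nonneg_left (hvG t) (mul_nonneg hρ.le (hχ0 t))
          _ = χ t * η := by field_simp
          _ ≤ η := mul_le_of_le_one_left hη.le (hχ1 t)
      change F (γ t + (ρ * χ t) • v t) ≤ _ at h3
      change _ ≤ F (γ t) + ρ * χ t * inner ℝ (G (γ t)) (v t) - _ at h3
      linarith
    · rw [hχout t ht]; simp [hη.le]
  refine ⟨⟨fun t => γ t + (ρ * χ t) • v t, by fun_prop⟩, fun t => ?_, fun t ht => ?_, fun t => ?_,
    fun t ht => ?_⟩
  · have := key t
    have h5 : 0 ≤ c * (ρ * χ t) ^ 2 := by positivity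
    simp only [ContinuousMap.coe_mk]; linarith
  · have := key t
    rw [hχin t ht, mul_one] at this
    simp only [ContinuousMap.coe_mk, hχin t ht, mul_one]; exact this
  · simp only [ContinuousMap.coe_mk, add_sub_cancel_left, norm_smul, Real.norm_eq_abs, abs_mul,
      abs_of_nonneg hρ.le, abs_of_nonneg (hχ0 t)]
    exact mul_le_mul (mul_le_of_le_one_right hρ.le (hχ1 t)) (hvn t) (norm_nonneg _) hρ.le
  · simp [hχout t ht]

/-- The pushes are made one after the other. The total drift is at most `ρ * B ≤ r u / 4`, so a
point that starts in the half ball around `u` still lies in the ball of radius `3 / 4 * r u` when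
the turn of `u` comes and then receives the full gain. The other pushes cost at most `η` each. -/
theorem exists_push_finset {F : H → ℝ} {G : H → H} (hG : Continuous G) {α β : ℝ}
    (γ : C(Icc α β, H)) (e₁ e₂ : H → H) (c r : H → ℝ) {η ρ B c₀ : ℝ} (hη : 0 < η) (hρ : 0 < ρ)
    (S : Finset H) (hS : ∀ u ∈ S, IsDescentPlane F G u (e₁ u) (e₂ u) (c u) (r u))
    (hB : ∑ u ∈ S, (‖e₁ u‖ + ‖e₂ u‖) ≤ B) (hρB : ∀ u ∈ S, ρ * B ≤ r u / 4)
    (hρr : ∀ u ∈ S, ρ ≤ r u) (hc : ∀ u ∈ S, c₀ ≤ c u) :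
    ∃ γ' : C(Icc α β, H), (∀ t, F (γ' t) ≤ F (γ t) + S.card * η) ∧
      (∀ t, (∃ u ∈ S, γ t ∈ Metric.ball u (r u / 2)) →
        F (γ' t) ≤ F (γ t) + S.card * η - c₀ * ρ ^ 2) ∧
      (∀ t, ‖γ' t - γ t‖ ≤ ρ * ∑ u ∈ S, (‖e₁ u‖ + ‖e₂ u‖)) ∧
      ∀ t, (∀ u ∈ S, γ t ∉ Metric.ball u (r u)) → γ' t = γ t := by
  classical
  induction S using Finset.induction_on with
  | empty => exact ⟨γ, by simp, by simp, by simp, by simp⟩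
  | insert j S hj ih =>
    have hsub : ∑ u ∈ S, (‖e₁ u‖ + ‖e₂ u‖) ≤ B :=
      (Finset.sum_le_sum_of_subset_of_nonneg (Finset.subset_insert j S)
        fun _ _ _ => by positivity).trans hB
    obtain ⟨γ₁, h1, h2, h3, h4⟩ := ih (fun u hu => hS u (Finset.mem_insert_of_mem hu)) hsub
      (fun u hu => hρB u (Finset.mem_insert_of_mem hu))
      (fun u hu => hρr u (Finset.mem_insert_of_mem hu))
      (fun u hu => hc u (Finset.mem_insert_of_mem hu))
    have hjm := Finset.mem_insert_self j S
    obtain ⟨γ₂, k1, k2, k3, k4⟩ := (hS j hjm).exists_push hG γ₁ hη hρ (hρr j hjm)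
    have hcard : ((insert j S).card : ℝ) = S.card + 1 := by
      rw [Finset.card_insert_of_notMem hj]; push_cast; ring
    refine ⟨γ₂, fun t => ?_, ?_, fun t => ?_, fun t ht => ?_⟩
    · rw [hcard]; linarith [k1 t, h1 t]
    · rintro t ⟨u, hu, hut⟩
      rw [hcard]
      rcases Finset.mem_insert.1 hu with rfl | hu
      · have hb : γ₁ t ∈ Metric.ball u (3 / 4 * r u) := by
          rw [Metric.mem_ball] at hut ⊢
          have h5 : dist (γ₁ t) (γ t) ≤ r u / 4 := by
            rw [dist_eq_norm]
            exact (h3 t).trans ((mul_le_mul_of_nonneg_left hsub hρ.le).trans (hρB u hjm))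
          linarith [dist_triangle (γ₁ t) (γ t) u]
        have h6 : c₀ * ρ ^ 2 ≤ c u * ρ ^ 2 := mul_le_mul_of_nonneg_right (hc u hjm) (sq_nonneg _)
        linarith [k2 t hb, h1 t]
      · linarith [h2 t ⟨u, hu, hut⟩, k1 t]
    · rw [Finset.sum_insert hj, mul_add]
      calc ‖γ₂ t - γ t‖ = ‖(γ₂ t - γ₁ t) + (γ₁ t - γ t)‖ := by rw [sub_add_sub_cancel]
        _ ≤ _ := (norm_add_le _ _).trans (add_le_add (k3 t) (h3 t))
    · have h5 := h4 t fun u hu => ht u (Finset.mem_insert_of_mem hu)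
      rw [k4 t (by rw [h5]; exact ht j hjm), h5]

/-- The mountain pass theorem for a functional with Lipschitz gradient satisfying the Palais--Smale
condition: at the min-max level there is a critical point without a descent plane. -/
theorem exists_critical_not_descentPlane {F : H → ℝ} {G : H → H} {Λ β : ℝ} (hF : Continuous F)
    (hG : Continuous G) (hΛ : 0 < Λ)
    (hFG : ∀ w h, F (w + h) ≤ F w + inner ℝ (G w) h + Λ * ‖h‖ ^ 2)
    (hPS : ∀ u : ℕ → H, Tendsto (fun k => F (u k)) atTop (𝓝 β) →
      Tendsto (fun k => G (u k)) atTop (𝓝 0) →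
      ∃ (v : H) (φ : ℕ → ℕ), StrictMono φ ∧ Tendsto (u ∘ φ) atTop (𝓝 v))
    {a b : H} (ha : G a = 0) (hb : G b = 0) (haβ : F a ≠ β) (hbβ : F b ≠ β)
    (hlow : ∀ γ ∈ {γ : C(Icc (-1 : ℝ) 1, H) | γ ⟨-1, by norm_num⟩ = a ∧ γ ⟨1, by norm_num⟩ = b},
      ∃ t, β ≤ F (γ t))
    (hup : ∀ η > 0, ∃ γ ∈ {γ : C(Icc (-1 : ℝ) 1, H) | γ ⟨-1, by norm_num⟩ = a ∧
      γ ⟨1, by norm_num⟩ = b}, ∀ t, F (γ t) < β + η) :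
    ∃ u, F u = β ∧ G u = 0 ∧ ∀ e₁ e₂ c r, ¬ IsDescentPlane F G u e₁ e₂ c r := by
  -- Assume that every critical point of level `β` has a descent plane; a path whose maximum lies
  -- below `β` will be built.
  by_contra! hcon
  set K : Set H := {u | F u = β ∧ G u = 0} with hK
  have hKc : IsCompact K := by
    rw [isCompact_iff_isSeqCompact]
    intro u hu
    obtain ⟨v, φ, hφ, hv⟩ := hPS u (by simp [fun k => (hu k).1]) (by simp [fun k => (hu k).2])
    refine ⟨v, ⟨?_, ?_⟩, φ, hφ, hv⟩
    · exact tendsto_nhds_unique ((hF.tendsto v).comp hv)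
        (tendsto_const_nhds.congr fun k => (hu (φ k)).1.symm)
    · exact tendsto_nhds_unique ((hG.tendsto v).comp hv)
        (tendsto_const_nhds.congr fun k => (hu (φ k)).2.symm)
  have hplane : ∀ u, ∃ e₁ e₂ c r, u ∈ K → IsDescentPlane F G u e₁ e₂ c r ∧
      a ∉ Metric.ball u r ∧ b ∉ Metric.ball u r := by
    intro u
    by_cases hu : u ∈ K
    · obtain ⟨e₁, e₂, c, r, h⟩ := hcon u hu.1 hu.2
      have hau : 0 < dist a u := dist_pos.2 fun h => haβ (h ▸ hu.1)
      have hbu : 0 < dist b u := dist_pos.2 fun h => hbβ (h ▸ hu.1)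
      -- The endpoints do not have the level `β`, so the balls can be shrunk to avoid them; the
      -- deformation then fixes the endpoints.
      refine ⟨e₁, e₂, c, min r (min (dist a u) (dist b u)), fun _ => ⟨h.mono
        (lt_min h.r_pos (lt_min hau hbu)) (min_le_left _ _), ?_, ?_⟩⟩
      · rw [Metric.mem_ball, not_lt]; exact (min_le_right _ _).trans (min_le_left _ _)
      · rw [Metric.mem_ball, not_lt]; exact (min_le_right _ _).trans (min_le_right _ _)
    · exact ⟨0, 0, 0, 0, fun h => absurd h hu⟩
  choose e₁ e₂ c r hpl using hplane
  obtain ⟨S, hSK, hScov⟩ := hKc.elim_nhds_subcover (fun u => Metric.ball u (r u / 2))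
    fun u hu => Metric.ball_mem_nhds _ (half_pos (hpl u hu).1.r_pos)
  obtain ⟨σ, hσ, hσK⟩ := hKc.exists_thickening_subset_open
    (isOpen_biUnion fun u _ => Metric.isOpen_ball) hScov
  -- By Palais-Smale, the gradient is bounded below at levels near `β` and away from `K`.
  obtain ⟨ν, hν, hνK⟩ : ∃ ν > 0, ∀ w, |F w - β| < ν → w ∉ Metric.thickening (σ / 2) K →
      ν ≤ ‖G w‖ := by
    by_contra! hno
    choose! u hu1 hu2 hu3 using fun k : ℕ => hno (1 / ((k : ℝ) + 1)) (by positivity)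
    have hlim : Tendsto (fun k : ℕ => 1 / ((k : ℝ) + 1)) atTop (𝓝 0) :=
      tendsto_one_div_add_atTop_nhds_zero_nat
    have hF1 : Tendsto (fun k => F (u k)) atTop (𝓝 β) := by
      rw [tendsto_iff_dist_tendsto_zero]
      exact squeeze_zero (fun _ => dist_nonneg) (fun k => (hu1 k).le) hlim
    have hG1 : Tendsto (fun k => G (u k)) atTop (𝓝 0) :=
      squeeze_zero_norm (fun k => (hu3 k).le) hlim
    obtain ⟨v, φ, hφ, hv⟩ := hPS u hF1 hG1
    have hvK : v ∈ K := ⟨tendsto_nhds_unique ((hF.tendsto v).comp hv)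
      (hF1.comp hφ.tendsto_atTop), tendsto_nhds_unique ((hG.tendsto v).comp hv)
      (hG1.comp hφ.tendsto_atTop)⟩
    have hcl : v ∈ (Metric.thickening (σ / 2) K)ᶜ :=
      Metric.isOpen_thickening.isClosed_compl.mem_of_tendsto hv
        (Eventually.of_forall fun k => hu2 (φ k))
    exact hcl (Metric.self_subset_thickening (half_pos hσ) K hvK)
  set B : ℝ := ∑ u ∈ S, (‖e₁ u‖ + ‖e₂ u‖) with hB
  have hB0 : 0 ≤ B := Finset.sum_nonneg fun _ _ => by positivity
  obtain ⟨r₀, hr₀, hr₀S⟩ : ∃ r₀ > 0, ∀ u ∈ S, r₀ ≤ r u := by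
    rcases S.eq_empty_or_nonempty with h | h
    · exact ⟨1, one_pos, by simp [h]⟩
    · obtain ⟨j, hj, hjm⟩ := S.exists_min_image r h
      exact ⟨r j, (hpl j (hSK j hj)).1.r_pos, hjm⟩
  obtain ⟨c₀, hc₀, hc₀S⟩ : ∃ c₀ > 0, ∀ u ∈ S, c₀ ≤ c u := by
    rcases S.eq_empty_or_nonempty with h | h
    · exact ⟨1, one_pos, by simp [h]⟩
    · obtain ⟨j, hj, hjm⟩ := S.exists_min_image c h
      exact ⟨c j, (hpl j (hSK j hj)).1.c_pos, hjm⟩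
  -- The bound `r₀ / 4` keeps the drift inside the balls, the bound `σ / 2` keeps it inside the
  -- covered neighbourhood of `K`. The summand 1 avoids division by zero and also gives `ρ ≤ r₀`.
  set ρ : ℝ := min (r₀ / 4) (σ / 2) / (B + 1) with hρ
  have hρ0 : 0 < ρ := div_pos (lt_min (by positivity) (by positivity)) (by positivity)
  have hρ1 : ρ * (B + 1) = min (r₀ / 4) (σ / 2) := div_mul_cancel₀ _ (by positivity)
  have hρB : ρ * B ≤ r₀ / 4 := by nlinarith [min_le_left (r₀ / 4) (σ / 2)]
  have hρσ : ρ * B ≤ σ / 2 := by nlinarith [min_le_right (r₀ / 4) (σ / 2)]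
  have hρr : ρ ≤ r₀ := by nlinarith [min_le_left (r₀ / 4) (σ / 2)]
  -- A path below `β + κ / 2`, pushed at total cost at most `κ / 2`, stays below `β + κ`. Both
  -- possible gains, `c₀ * ρ ^ 2` from a descent plane and `ν ^ 2 / (4 * Λ)` from a gradient step,
  -- are at least `κ`.
  set κ : ℝ := min (c₀ * ρ ^ 2) (min ν (ν ^ 2 / (4 * Λ))) with hκ
  have hκ0 : 0 < κ := lt_min (by positivity) (lt_min hν (by positivity))
  have hκ1 : κ ≤ c₀ * ρ ^ 2 := min_le_left _ _
  have hκ2 : κ ≤ ν := (min_le_right _ _).trans (min_le_left _ _)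
  have hκ3 : κ ≤ ν ^ 2 / (4 * Λ) := (min_le_right _ _).trans (min_le_right _ _)
  obtain ⟨γ, ⟨hγa, hγb⟩, hγ⟩ := hup (κ / 2) (by positivity)
  have hη : 0 < κ / (2 * (S.card + 1)) := by positivity
  have hSη : S.card * (κ / (2 * (S.card + 1))) ≤ κ / 2 := by
    rw [mul_div_assoc', div_le_div_iff₀ (by positivity) (by positivity)]
    nlinarith
  obtain ⟨γ₁, h1, h2, h3, h4⟩ := exists_push_finset hG γ e₁ e₂ c r hη hρ0 S
    (fun u hu => (hpl u (hSK u hu)).1) hB.ge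
    (fun u hu => hρB.trans (by linarith [hr₀S u hu])) (fun u hu => hρr.trans (hr₀S u hu)) hc₀S
  have hstep : ∀ w, F (w - (1 / (2 * Λ)) • G w) ≤ F w - ‖G w‖ ^ 2 / (4 * Λ) := by
    intro w
    have h5 := hFG w (-((1 / (2 * Λ)) • G w))
    rw [← sub_eq_add_neg, inner_neg_right, inner_smul_right, real_inner_self_eq_norm_sq, norm_neg,
      norm_smul, Real.norm_eq_abs, abs_of_pos (by positivity)] at h5
    have e : -(1 / (2 * Λ) * ‖G w‖ ^ 2) + Λ * (1 / (2 * Λ) * ‖G w‖) ^ 2 = -(‖G w‖ ^ 2 / (4 * Λ)) := by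
      field_simp; ring
    linarith
  -- The pushed path followed by a gradient step is still admissible: the pushes miss the endpoints,
  -- and the gradient vanishes there.
  obtain ⟨t, ht⟩ := hlow ⟨fun t => γ₁ t - (1 / (2 * Λ)) • G (γ₁ t), by fun_prop⟩ ⟨by
      simp only [ContinuousMap.coe_mk]
      rw [h4 _ (by rw [hγa]; exact fun u hu => (hpl u (hSK u hu)).2.1), hγa, ha]; simp, by
      simp only [ContinuousMap.coe_mk]
      rw [h4 _ (by rw [hγb]; exact fun u hu => (hpl u (hSK u hu)).2.2), hγb, hb]; simp⟩
  simp only [ContinuousMap.coe_mk] at ht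
  have h5 := hstep (γ₁ t)
  have h6 : 0 ≤ ‖G (γ₁ t)‖ ^ 2 / (4 * Λ) := by positivity
  -- Either `γ t` lay in one of the half balls and the push gained `c₀ * ρ ^ 2`, or `γ₁ t` is
  -- outside the `σ / 2`-neighbourhood of `K` and the gradient step gains.
  by_cases hin : ∃ u ∈ S, γ t ∈ Metric.ball u (r u / 2)
  · linarith [h2 t hin, hγ t]
  · have h7 : γ₁ t ∉ Metric.thickening (σ / 2) K := by
      intro hmem
      obtain ⟨z, hz, hzd⟩ := Metric.mem_thickening_iff.1 hmem
      have h8 : dist (γ t) (γ₁ t) ≤ σ / 2 := by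
        rw [dist_comm, dist_eq_norm]; exact (h3 t).trans hρσ
      have h9 := @hσK (γ t) (Metric.mem_thickening_iff.2 ⟨z, hz, by
        linarith [dist_triangle (γ t) (γ₁ t) z]⟩)
      simp only [mem_iUnion, exists_prop] at h9
      exact hin h9
    have h8 : |F (γ₁ t) - β| < ν := by
      rw [abs_lt]; constructor <;> linarith [h1 t, hγ t]
    have h9 := hνK _ h8 h7
    have h10 : ν ^ 2 / (4 * Λ) ≤ ‖G (γ₁ t)‖ ^ 2 / (4 * Λ) := by gcongr
    linarith [h1 t, hγ t]

end MountainPass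

/-! ### Superposition operators on L² -/

section Nemytskii
open Filter Topology
open scoped NNReal

variable {X : Type*} [MeasurableSpace X] {μ : Measure X}

theorem inner_L2_eq (f h : Lp ℝ 2 μ) : inner ℝ f h = ∫ x, f x * h x ∂μ := by
  rw [L2.inner_def]
  exact integral_congr_ae (Eventually.of_forall fun x => by simp [mul_comm])

theorem norm_L2_sq_eq (f : Lp ℝ 2 μ) : ‖f‖ ^ 2 = ∫ x, f x ^ 2 ∂μ := by
  rw [← real_inner_self_eq_norm_sq, inner_L2_eq]
  simp only [sq]

theorem integrable_mul_L2 (f h : Lp ℝ 2 μ) : Integrable (fun x => f x * h x) μ :=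
  (Lp.memLp f).integrable_mul (Lp.memLp h)

theorem integrable_sq_L2 (f : Lp ℝ 2 μ) : Integrable (fun x => f x ^ 2) μ := (Lp.memLp f).integrable_sq

variable [IsFiniteMeasure μ]

theorem integrable_L2 (f : Lp ℝ 2 μ) : Integrable f μ := (Lp.memLp f).integrable (by norm_num)

theorem memLp_lipschitz_comp {p : ℝ → ℝ} {K : ℝ≥0} (hp : LipschitzWith K p) (f : Lp ℝ 2 μ) :
    MemLp (fun x => p (f x)) 2 μ := by
  have h0 : LipschitzWith K fun s => p s - p 0 := by
    refine LipschitzWith.of_dist_le_mul fun s t => ?_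
    have := hp.dist_le_mul s t
    simpa [Real.dist_eq] using this
  have h1 : MemLp ((fun s => p s - p 0) ∘ f) 2 μ := h0.comp_memLp (by simp) (Lp.memLp f)
  refine (h1.add (memLp_const (p 0))).congr_norm ?_ ?_
  · exact hp.continuous.comp_aestronglyMeasurable (Lp.aestronglyMeasurable f)
  · exact Eventually.of_forall fun x => by simp

/-- The superposition operator `f ↦ p ∘ f` on `L²`. -/
def nemytskii {p : ℝ → ℝ} {K : ℝ≥0} (hp : LipschitzWith K p) (f : Lp ℝ 2 μ) : Lp ℝ 2 μ :=
  (memLp_lipschitz_comp hp f).toLp _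

theorem coeFn_nemytskii {p : ℝ → ℝ} {K : ℝ≥0} (hp : LipschitzWith K p) (f : Lp ℝ 2 μ) :
    nemytskii hp f =ᵐ[μ] fun x => p (f x) := MemLp.coeFn_toLp _

theorem norm_nemytskii_sub_le {p : ℝ → ℝ} {K : ℝ≥0} (hp : LipschitzWith K p) (f h : Lp ℝ 2 μ) :
    ‖nemytskii hp f - nemytskii hp h‖ ≤ K * ‖f - h‖ := by
  refine Lp.norm_le_mul_norm_of_ae_le_mul ?_
  filter_upwards [coeFn_nemytskii hp f, coeFn_nemytskii hp h,
    Lp.coeFn_sub (nemytskii hp f) (nemytskii hp h), Lp.coeFn_sub f h] with x h1 h2 h3 h4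
  rw [h3, h4, Pi.sub_apply, Pi.sub_apply, h1, h2]
  simpa [Real.dist_eq] using hp.dist_le_mul (f x) (h x)

theorem continuous_nemytskii {p : ℝ → ℝ} {K : ℝ≥0} (hp : LipschitzWith K p) :
    Continuous (nemytskii hp : Lp ℝ 2 μ → Lp ℝ 2 μ) :=
  LipschitzWith.continuous (K := K) (LipschitzWith.of_dist_le_mul fun f h => by
    rw [dist_eq_norm, dist_eq_norm]; exact norm_nemytskii_sub_le hp f h)

theorem abs_sub_sub_le_of_lipschitz_deriv {P p : ℝ → ℝ} {K : ℝ≥0} (hP : ∀ s, HasDerivAt P (p s) s)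
    (hp : LipschitzWith K p) (s t : ℝ) : |P (s + t) - P s - p s * t| ≤ K * t ^ 2 := by
  have h1 : ∀ τ ∈ uIcc (0 : ℝ) t, HasDerivWithinAt (fun τ => P (s + τ) - p s * τ)
      (p (s + τ) - p s) (uIcc 0 t) τ := fun τ _ => by
    have h2 : HasDerivAt (fun τ => P (s + τ)) (p (s + τ)) τ := (hP (s + τ)).comp_const_add s τ
    have h3 : HasDerivAt (fun τ => p s * τ) (p s) τ := by
      simpa using (hasDerivAt_id τ).const_mul (p s)
    exact (h2.sub h3).hasDerivWithinAt
  have h4 : ∀ τ ∈ uIcc (0 : ℝ) t, ‖p (s + τ) - p s‖ ≤ K * |t| := fun τ hτ => by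
    have := hp.dist_le_mul (s + τ) s
    rw [Real.dist_eq, Real.dist_eq, add_sub_cancel_left] at this
    refine this.trans (mul_le_mul_of_nonneg_left ?_ K.2)
    simpa using abs_sub_left_of_mem_uIcc hτ
  have h5 := (convex_uIcc (0 : ℝ) t).norm_image_sub_le_of_norm_hasDerivWithin_le h1 h4
    left_mem_uIcc right_mem_uIcc
  simp only [add_zero, mul_zero, sub_zero, Real.norm_eq_abs] at h5
  rw [mul_assoc, abs_mul_abs_self, ← sq] at h5
  refine le_trans (le_of_eq ?_) h5
  congr 1; ring

theorem integrable_potential {P p : ℝ → ℝ} {K : ℝ≥0} (hP : ∀ s, HasDerivAt P (p s) s)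
    (hp : LipschitzWith K p) (f : Lp ℝ 2 μ) : Integrable (fun x => P (f x)) μ := by
  have hPc : Continuous P := continuous_iff_continuousAt.2 fun s => (hP s).continuousAt
  have h1 : Integrable (fun x => |P 0| + (|p 0| * |f x| + K * f x ^ 2)) μ :=
    (integrable_const _).add (((integrable_L2 f).abs.const_mul _).add
      ((integrable_sq_L2 f).const_mul _))
  refine h1.mono' (hPc.comp_aestronglyMeasurable (Lp.aestronglyMeasurable f))
    (Eventually.of_forall fun x => ?_)
  have h2 := abs_sub_sub_le_of_lipschitz_deriv hP hp 0 (f x)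
  rw [zero_add] at h2
  have h3 : P (f x) = (P (f x) - P 0 - p 0 * f x) + (P 0 + p 0 * f x) := by ring
  rw [Real.norm_eq_abs, h3]
  have h4 := abs_add_le (P (f x) - P 0 - p 0 * f x) (P 0 + p 0 * f x)
  have h5 := abs_add_le (P 0) (p 0 * f x)
  rw [abs_mul] at h5
  linarith

/-- Integrating the pointwise Taylor estimate gives a global quadratic remainder. It yields
continuity and the Fréchet derivative, and also the one-sided inequality behind the gradient step of
the mountain pass. -/
theorem abs_potential_sub_sub_le {P p : ℝ → ℝ} {K : ℝ≥0} (hP : ∀ s, HasDerivAt P (p s) s)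
    (hp : LipschitzWith K p) (f h : Lp ℝ 2 μ) :
    |∫ x, P ((f + h : Lp ℝ 2 μ) x) ∂μ - ∫ x, P (f x) ∂μ - inner ℝ (nemytskii hp f) h| ≤
      K * ‖h‖ ^ 2 := by
  have i1 := integrable_potential hP hp (f + h)
  have i2 := integrable_potential hP hp f
  have i3 := integrable_mul_L2 (nemytskii hp f) h
  have i12 : Integrable (fun x => P ((f + h : Lp ℝ 2 μ) x) - P (f x)) μ := i1.sub i2
  rw [inner_L2_eq, ← integral_sub i1 i2, ← integral_sub i12 i3, norm_L2_sq_eq,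
    ← integral_const_mul]
  refine abs_integral_le_integral_abs.trans (integral_mono_ae (i12.sub i3).abs
    ((integrable_sq_L2 h).const_mul _) ?_)
  filter_upwards [coeFn_nemytskii hp f, Lp.coeFn_add f h] with x h1 h2
  rw [h1, h2, Pi.add_apply]
  exact abs_sub_sub_le_of_lipschitz_deriv hP hp (f x) (h x)

theorem continuous_potential {P p : ℝ → ℝ} {K : ℝ≥0} (hP : ∀ s, HasDerivAt P (p s) s)
    (hp : LipschitzWith K p) : Continuous fun f : Lp ℝ 2 μ => ∫ x, P (f x) ∂μ := by
  rw [continuous_iff_continuousAt]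
  intro f
  rw [ContinuousAt, tendsto_iff_dist_tendsto_zero]
  have h1 : Tendsto (fun h : Lp ℝ 2 μ => K * ‖h - f‖ ^ 2 + ‖nemytskii hp f‖ * ‖h - f‖) (𝓝 f)
      (𝓝 (K * ‖f - f‖ ^ 2 + ‖nemytskii hp f‖ * ‖f - f‖)) :=
    Continuous.tendsto (by fun_prop) f
  simp only [sub_self, norm_zero, ne_eq, OfNat.ofNat_ne_zero, not_false_eq_true, zero_pow,
    mul_zero, add_zero] at h1
  refine squeeze_zero (fun _ => dist_nonneg) (fun h => ?_) h1
  have h2 := abs_potential_sub_sub_le hP hp f (h - f)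
  rw [add_sub_cancel] at h2
  have h3 := abs_real_inner_le_norm (nemytskii hp f) (h - f)
  rw [Real.dist_eq]
  have h4 := abs_add_le (∫ x, P (h x) ∂μ - ∫ x, P (f x) ∂μ - inner ℝ (nemytskii hp f) (h - f))
    (inner ℝ (nemytskii hp f) (h - f))
  rw [sub_add_cancel] at h4
  linarith

/-- For bounded continuous `q`, the form `f ↦ ∫ q(f) h k` depends continuously on `f ∈ L²`. -/
theorem continuous_integral_comp_mul_mul {q : ℝ → ℝ} (hq : Continuous q) {K : ℝ}
    (hK : ∀ s, |q s| ≤ K) (h k : Lp ℝ 2 μ) :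
    Continuous fun f : Lp ℝ 2 μ => ∫ x, q (f x) * (h x * k x) ∂μ := by
  rw [continuous_iff_seqContinuous]
  intro f f₀ hf
  -- L² convergence gives a subsequence that converges almost everywhere; `K * |h x * k x|`
  -- dominates.
  refine tendsto_of_subseq_tendsto fun ns hns => ?_
  have h1 : TendstoInMeasure μ (fun i => (f (ns i) : X → ℝ)) atTop f₀ :=
    tendstoInMeasure_of_tendsto_Lp (hf.comp hns)
  obtain ⟨ms, -, hms⟩ := h1.exists_seq_tendsto_ae
  refine ⟨ms, tendsto_integral_of_dominated_convergence (fun x => K * |h x * k x|) (fun i => ?_)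
    ((integrable_mul_L2 h k).abs.const_mul _) (fun i => Eventually.of_forall fun x => ?_) ?_⟩
  · exact (hq.comp_aestronglyMeasurable (Lp.aestronglyMeasurable _)).mul
      (integrable_mul_L2 h k).aestronglyMeasurable
  · rw [Real.norm_eq_abs, abs_mul]
    exact mul_le_mul_of_nonneg_right (hK _) (abs_nonneg _)
  · filter_upwards [hms] with x hx
    exact ((hq.tendsto _).comp hx).mul_const _

/-- A superposition operator from L² to L² need not be Fréchet differentiable. Its derivative along
a line, tested against a fixed vector, exists by dominated convergence, and this weak second
derivative is all that the second variation and the descent planes use. -/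
theorem hasDerivAt_inner_nemytskii {p q : ℝ → ℝ} {K : ℝ≥0} (hp : LipschitzWith K p)
    (hpq : ∀ s, HasDerivAt p (q s) s) (hq : Continuous q) (f h k : Lp ℝ 2 μ) (s : ℝ) :
    HasDerivAt (fun s : ℝ => inner ℝ (nemytskii hp (f + s • h)) k)
      (∫ x, q ((f + s • h : Lp ℝ 2 μ) x) * (h x * k x) ∂μ) s := by
  have hco : ∀ s : ℝ, ((f + s • h : Lp ℝ 2 μ) : X → ℝ) =ᵐ[μ] fun x => f x + s * h x := fun s => by
    filter_upwards [Lp.coeFn_add f (s • h), Lp.coeFn_smul s h] with x h1 h2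
    rw [h1, Pi.add_apply, h2]; simp
  have e1 : (fun s : ℝ => inner ℝ (nemytskii hp (f + s • h)) k) =
      fun s : ℝ => ∫ x, p (f x + s * h x) * k x ∂μ := by
    funext s
    rw [inner_L2_eq]
    refine integral_congr_ae ?_
    filter_upwards [hco s, coeFn_nemytskii hp (f + s • h)] with x h1 h2
    rw [h2, h1]
  have e2 : ∫ x, q ((f + s • h : Lp ℝ 2 μ) x) * (h x * k x) ∂μ =
      ∫ x, q (f x + s * h x) * (h x * k x) ∂μ := by
    refine integral_congr_ae ?_
    filter_upwards [hco s] with x h1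
    rw [h1]
  have hqK : ∀ s, |q s| ≤ K := fun s => by
    have := (hpq s).le_of_lipschitz hp
    simpa using this
  have hm : ∀ s : ℝ, AEStronglyMeasurable (fun x => f x + s * h x) μ := fun s =>
    (Lp.aestronglyMeasurable f).add ((Lp.aestronglyMeasurable h).const_mul s)
  rw [e1, e2]
  refine (hasDerivAt_integral_of_dominated_loc_of_deriv_le (s := univ)
    (F := fun s x => p (f x + s * h x) * k x) (F' := fun s x => q (f x + s * h x) * (h x * k x))
    (bound := fun x => K * |h x * k x|) univ_mem (Eventually.of_forall fun s => ?_) ?_ ?_ ?_ ?_ ?_).2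
  · exact (hp.continuous.comp_aestronglyMeasurable (hm s)).mul (Lp.aestronglyMeasurable k)
  · refine (integrable_mul_L2 (nemytskii hp (f + s • h)) k).congr ?_
    filter_upwards [hco s, coeFn_nemytskii hp (f + s • h)] with x h1 h2
    rw [h2, h1]
  · exact (hq.comp_aestronglyMeasurable (hm s)).mul (integrable_mul_L2 h k).aestronglyMeasurable
  · refine Eventually.of_forall fun x s _ => ?_
    rw [Real.norm_eq_abs, abs_mul]
    exact mul_le_mul_of_nonneg_right (hqK _) (abs_nonneg _)
  · exact (integrable_mul_L2 h k).abs.const_mul _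
  · refine Eventually.of_forall fun x s _ => ?_
    have h1 : HasDerivAt (fun s => f x + s * h x) (h x) s := by
      simpa using ((hasDerivAt_id s).mul_const (h x)).const_add (f x)
    have h2 := ((hpq (f x + s * h x)).comp s h1).mul_const (k x)
    rw [mul_assoc] at h2
    exact h2

end Nemytskii

/-! ### The functional on an abstract Hilbert space with a map to L² -/

section Model
open Filter Topology
open scoped NNReal

variable {X : Type*} [MeasurableSpace X] {μ : Measure X}
  {H : Type*} [NormedAddCommGroup H] [InnerProductSpace ℝ H]

/-- The functional `u ↦ ε/2 (‖u‖² - ‖Tu‖²) + ε⁻¹ ∫ P(Tu) - ⟨G, Tu⟩`. -/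
def modelEnergy (T : H →L[ℝ] Lp ℝ 2 μ) (P : ℝ → ℝ) (G : Lp ℝ 2 μ) (ε : ℝ) (u : H) : ℝ :=
  ε / 2 * (‖u‖ ^ 2 - ‖T u‖ ^ 2) + ε⁻¹ * ∫ x, P (T u x) ∂μ - inner ℝ G (T u)

variable [IsFiniteMeasure μ] [CompleteSpace H]

/-- The gradient of `modelEnergy`. -/
def modelGrad (T : H →L[ℝ] Lp ℝ 2 μ) {p : ℝ → ℝ} {K : ℝ≥0} (hp : LipschitzWith K p)
    (G : Lp ℝ 2 μ) (ε : ℝ) (u : H) : H :=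
  ε • (u - T.adjoint (T u)) + T.adjoint (ε⁻¹ • nemytskii hp (T u) - G)

/-- The second derivative of `modelEnergy` at `u`, when `p' = q`. -/
def modelHess (T : H →L[ℝ] Lp ℝ 2 μ) (q : ℝ → ℝ) (ε : ℝ) (u v w : H) : ℝ :=
  ε * (inner ℝ v w - inner ℝ (T v) (T w)) + ε⁻¹ * ∫ x, q (T u x) * (T v x * T w x) ∂μ

variable {T : H →L[ℝ] Lp ℝ 2 μ} {P p q : ℝ → ℝ} {K : ℝ≥0} {G : Lp ℝ 2 μ} {ε : ℝ}

theorem inner_modelGrad (hp : LipschitzWith K p) (u v : H) :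
    inner ℝ (modelGrad T hp G ε u) v = ε * (inner ℝ u v - inner ℝ (T u) (T v)) +
      ε⁻¹ * inner ℝ (nemytskii hp (T u)) (T v) - inner ℝ G (T v) := by
  simp only [modelGrad, inner_add_left, inner_sub_left, inner_smul_left,
    ContinuousLinearMap.adjoint_inner_left, conj_trivial]
  ring

theorem continuous_modelGrad (hp : LipschitzWith K p) : Continuous (modelGrad T hp G ε) := by
  have := (continuous_nemytskii hp (μ := μ)).comp T.continuous
  simp only [Function.comp_def] at this
  unfold modelGrad
  fun_prop

theorem norm_modelGrad_sub_le (hp : LipschitzWith K p) (hT : ∀ u, ‖T u‖ ≤ ‖u‖) (hε : 0 < ε)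
    (u v : H) : ‖modelGrad T hp G ε u - modelGrad T hp G ε v‖ ≤ (2 * ε + ε⁻¹ * K) * ‖u - v‖ := by
  have hTa : ∀ f, ‖T.adjoint f‖ ≤ ‖f‖ := fun f => by
    refine (T.adjoint.le_opNorm f).trans (mul_le_of_le_one_left (norm_nonneg _) ?_)
    rw [LinearIsometryEquiv.norm_map]
    exact T.opNorm_le_bound zero_le_one fun u => by simpa using hT u
  have e : modelGrad T hp G ε u - modelGrad T hp G ε v = ε • ((u - v) - T.adjoint (T (u - v))) +
      ε⁻¹ • T.adjoint (nemytskii hp (T u) - nemytskii hp (T v)) := by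
    simp only [modelGrad, map_sub, map_smul]
    module
  rw [e]
  refine (norm_add_le _ _).trans ?_
  rw [norm_smul, norm_smul, Real.norm_eq_abs, Real.norm_eq_abs, abs_of_pos hε,
    abs_of_pos (inv_pos.2 hε), add_mul]
  refine add_le_add ?_ ?_
  · rw [mul_comm 2 ε, mul_assoc]
    refine mul_le_mul_of_nonneg_left ((norm_sub_le _ _).trans ?_) hε.le
    linarith [(hTa (T (u - v))).trans (hT (u - v))]
  · rw [mul_assoc]
    refine mul_le_mul_of_nonneg_left ((hTa _).trans ?_) (inv_pos.2 hε).le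
    refine (norm_nemytskii_sub_le hp _ _).trans (mul_le_mul_of_nonneg_left ?_ K.2)
    rw [← map_sub]; exact hT _

theorem abs_modelEnergy_sub_sub_le (hP : ∀ s, HasDerivAt P (p s) s) (hp : LipschitzWith K p)
    (hT : ∀ u, ‖T u‖ ≤ ‖u‖) (hε : 0 < ε) (u h : H) :
    |modelEnergy T P G ε (u + h) - modelEnergy T P G ε u - inner ℝ (modelGrad T hp G ε u) h| ≤
      (ε + ε⁻¹ * K) * ‖h‖ ^ 2 := by
  have h1 := abs_potential_sub_sub_le hP hp (T u) (T h)
  have h2 : ‖T h‖ ^ 2 ≤ ‖h‖ ^ 2 := pow_le_pow_left₀ (norm_nonneg _) (hT h) 2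
  have e : modelEnergy T P G ε (u + h) - modelEnergy T P G ε u - inner ℝ (modelGrad T hp G ε u) h =
      ε / 2 * (‖h‖ ^ 2 - ‖T h‖ ^ 2) + ε⁻¹ * (∫ x, P ((T u + T h : Lp ℝ 2 μ) x) ∂μ -
        ∫ x, P (T u x) ∂μ - inner ℝ (nemytskii hp (T u)) (T h)) := by
    rw [inner_modelGrad]
    simp only [modelEnergy, map_add, norm_add_sq_real, inner_add_right]
    ring
  rw [e]
  refine (abs_add_le _ _).trans ?_
  rw [add_mul, abs_mul, abs_mul, abs_of_pos (half_pos hε), abs_of_pos (inv_pos.2 hε),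
    abs_of_nonneg (sub_nonneg.2 h2), mul_assoc ε⁻¹]
  refine add_le_add ?_ (mul_le_mul_of_nonneg_left (h1.trans
    (mul_le_mul_of_nonneg_left h2 K.2)) (inv_pos.2 hε).le)
  nlinarith [sq_nonneg ‖T h‖, sq_nonneg ‖h‖]

theorem hasFDerivAt_of_abs_sub_sub_le {F : H → ℝ} {g u : H} {Λ : ℝ}
    (h : ∀ h, |F (u + h) - F u - inner ℝ g h| ≤ Λ * ‖h‖ ^ 2) :
    HasFDerivAt F (innerSL ℝ g) u := by
  rw [hasFDerivAt_iff_isLittleO_nhds_zero]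
  have h1 : (fun h : H => F (u + h) - F u - innerSL ℝ g h) =O[𝓝 0] fun h => ‖h‖ ^ 2 :=
    Asymptotics.IsBigO.of_bound Λ (Eventually.of_forall fun h' => by
      rw [Real.norm_eq_abs, norm_pow, norm_norm, innerSL_apply_apply]
      exact h h')
  refine h1.trans_isLittleO ?_
  have := Asymptotics.isLittleO_norm_pow_id (E' := H) one_lt_two
  simpa using this

theorem hasFDerivAt_modelEnergy (hP : ∀ s, HasDerivAt P (p s) s) (hp : LipschitzWith K p)
    (hT : ∀ u, ‖T u‖ ≤ ‖u‖) (hε : 0 < ε) (u : H) :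
    HasFDerivAt (modelEnergy T P G ε) (innerSL ℝ (modelGrad T hp G ε u)) u :=
  hasFDerivAt_of_abs_sub_sub_le (abs_modelEnergy_sub_sub_le hP hp hT hε u)

theorem hasFDerivAt_zero_iff_modelGrad_eq_zero (hP : ∀ s, HasDerivAt P (p s) s)
    (hp : LipschitzWith K p) (hT : ∀ u, ‖T u‖ ≤ ‖u‖) (hε : 0 < ε) (u : H) :
    HasFDerivAt (modelEnergy T P G ε) (0 : H →L[ℝ] ℝ) u ↔ modelGrad T hp G ε u = 0 := by
  have h := hasFDerivAt_modelEnergy (G := G) hP hp hT hε u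
  refine ⟨fun h0 => ?_, fun h0 => by rw [h0, map_zero] at h; exact h⟩
  have h1 := h.unique h0
  have h2 := DFunLike.congr_fun h1 (modelGrad T hp G ε u)
  simpa using h2

theorem hasDerivAt_inner_modelGrad (hp : LipschitzWith K p) (hpq : ∀ s, HasDerivAt p (q s) s)
    (hq : Continuous q) (u v w : H) (s : ℝ) :
    HasDerivAt (fun s : ℝ => inner ℝ (modelGrad T hp G ε (u + s • v)) w)
      (modelHess T q ε (u + s • v) v w) s := by
  have h1 := hasDerivAt_inner_nemytskii hp hpq hq (T u) (T v) (T w) s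
  simp only [inner_modelGrad, modelHess, map_add, map_smul, inner_add_left, inner_smul_left,
    conj_trivial] at h1 ⊢
  have h2 : HasDerivAt (fun s : ℝ => inner ℝ u w + s * inner ℝ v w -
      (inner ℝ (T u) (T w) + s * inner ℝ (T v) (T w)))
      (inner ℝ v w - inner ℝ (T v) (T w)) s := by
    have a1 := ((hasDerivAt_id s).mul_const (inner ℝ v w)).const_add (inner ℝ u w)
    have a2 := ((hasDerivAt_id s).mul_const (inner ℝ (T v) (T w))).const_add (inner ℝ (T u) (T w))
    simpa using a1.fun_sub a2
  exact ((h2.const_mul ε).add (h1.const_mul ε⁻¹)).sub_const _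

theorem hasDerivAt_modelEnergy_line (hP : ∀ s, HasDerivAt P (p s) s) (hp : LipschitzWith K p)
    (hT : ∀ u, ‖T u‖ ≤ ‖u‖) (hε : 0 < ε) (u v : H) (s : ℝ) :
    HasDerivAt (fun s : ℝ => modelEnergy T P G ε (u + s • v))
      (inner ℝ (modelGrad T hp G ε (u + s • v)) v) s := by
  have h1 := hasFDerivAt_modelEnergy (G := G) hP hp hT hε (u + s • v)
  have h2 : HasDerivAt (fun s : ℝ => u + s • v) v s := by
    simpa using ((hasDerivAt_id s).smul_const v).const_add u
  exact h1.comp_hasDerivAt s h2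

theorem iteratedDeriv_two_modelEnergy (hP : ∀ s, HasDerivAt P (p s) s) (hp : LipschitzWith K p)
    (hpq : ∀ s, HasDerivAt p (q s) s) (hq : Continuous q)
    (hT : ∀ u, ‖T u‖ ≤ ‖u‖) (hε : 0 < ε) (u v : H) :
    iteratedDeriv 2 (fun s : ℝ => modelEnergy T P G ε (u + s • v)) 0 = modelHess T q ε u v v := by
  rw [iteratedDeriv_succ, iteratedDeriv_one]
  have h1 : deriv (fun s : ℝ => modelEnergy T P G ε (u + s • v)) =
      fun s => inner ℝ (modelGrad T hp G ε (u + s • v)) v :=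
    funext fun s => (hasDerivAt_modelEnergy_line hP hp hT hε u v s).deriv
  rw [h1, (hasDerivAt_inner_modelGrad hp hpq hq u v v 0).deriv]
  simp

theorem continuous_modelHess (hq : Continuous q) {C : ℝ} (hC : ∀ s, |q s| ≤ C) (v w : H) :
    Continuous fun u => modelHess T q ε u v w :=
  continuous_const.add (continuous_const.mul
    ((continuous_integral_comp_mul_mul hq hC (T v) (T w)).comp T.continuous))

/-- On a fixed plane the second derivative is determined by three numbers, each continuous in `u`.
So negativity on the plane is stable under small changes of `u`, although the second derivative need
not be continuous in operator norm. -/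
theorem modelHess_add_smul (hq : Continuous q) {C : ℝ} (hC : ∀ s, |q s| ≤ C) (u e₁ e₂ : H)
    (x y : ℝ) : modelHess T q ε u (x • e₁ + y • e₂) (x • e₁ + y • e₂) =
      x ^ 2 * modelHess T q ε u e₁ e₁ + 2 * x * y * modelHess T q ε u e₁ e₂ +
        y ^ 2 * modelHess T q ε u e₂ e₂ := by
  have hi : ∀ f h : Lp ℝ 2 μ, Integrable (fun z => q (T u z) * (f z * h z)) μ := fun f h =>
    (integrable_mul_L2 f h).bdd_mul
      (hq.comp_aestronglyMeasurable (Lp.aestronglyMeasurable _)) (Eventually.of_forall fun z => hC _)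
  have e : ∫ z, q (T u z) * (T (x • e₁ + y • e₂) z * T (x • e₁ + y • e₂) z) ∂μ =
      x ^ 2 * ∫ z, q (T u z) * (T e₁ z * T e₁ z) ∂μ +
        2 * x * y * ∫ z, q (T u z) * (T e₁ z * T e₂ z) ∂μ +
        y ^ 2 * ∫ z, q (T u z) * (T e₂ z * T e₂ z) ∂μ := by
    have j1 := (hi (T e₁) (T e₁)).const_mul (x ^ 2)
    have j2 := (hi (T e₁) (T e₂)).const_mul (2 * x * y)
    have j3 := (hi (T e₂) (T e₂)).const_mul (y ^ 2)
    rw [← integral_const_mul, ← integral_const_mul, ← integral_const_mul,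
      ← integral_add j1 j2, ← integral_add (by exact j1.add j2) j3]
    refine integral_congr_ae ?_
    rw [map_add, map_smul, map_smul]
    filter_upwards [Lp.coeFn_add (x • T e₁) (y • T e₂), Lp.coeFn_smul x (T e₁),
      Lp.coeFn_smul y (T e₂)] with z h1 h2 h3
    rw [h1, Pi.add_apply, h2, h3]
    simp only [Pi.smul_apply, smul_eq_mul]
    ring
  simp only [modelHess]
  rw [e]
  simp only [map_add, map_smul, inner_add_left, inner_add_right, inner_smul_left,
    inner_smul_right, conj_trivial, real_inner_comm e₁ e₂, real_inner_comm (T e₁) (T e₂)]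
  ring

/-- If the second derivative at `u` is negative definite on a plane, that plane is a descent plane. -/
theorem exists_isDescentPlane_of_modelHess_neg (hP : ∀ s, HasDerivAt P (p s) s)
    (hp : LipschitzWith K p) (hpq : ∀ s, HasDerivAt p (q s) s) (hq : Continuous q)
    (hT : ∀ u, ‖T u‖ ≤ ‖u‖) (hε : 0 < ε) {u e₁ e₂ : H}
    (hneg : ∀ x y : ℝ, x ^ 2 + y ^ 2 = 1 →
      modelHess T q ε u (x • e₁ + y • e₂) (x • e₁ + y • e₂) < 0) :
    ∃ c r, IsDescentPlane (modelEnergy T P G ε) (modelGrad T hp G ε) u e₁ e₂ c r := by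
  have hqK : ∀ s, |q s| ≤ K := fun s => by simpa using (hpq s).le_of_lipschitz hp
  let h (w : H) (z : ℝ × ℝ) : ℝ := z.1 ^ 2 * modelHess T q ε w e₁ e₁ +
    2 * z.1 * z.2 * modelHess T q ε w e₁ e₂ + z.2 ^ 2 * modelHess T q ε w e₂ e₂
  have hh : ∀ w x y, modelHess T q ε w (x • e₁ + y • e₂) (x • e₁ + y • e₂) = h w (x, y) :=
    fun w x y => modelHess_add_smul hq hqK w e₁ e₂ x y
  have hS : IsCompact {z : ℝ × ℝ | z.1 ^ 2 + z.2 ^ 2 = 1} := by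
    refine Metric.isCompact_of_isClosed_isBounded (isClosed_eq (by fun_prop) continuous_const) ?_
    refine (Metric.isBounded_closedBall (x := (0 : ℝ × ℝ)) (r := 1)).subset fun z hz => ?_
    rw [mem_closedBall_zero_iff, Prod.norm_def, max_le_iff, Real.norm_eq_abs, Real.norm_eq_abs,
      ← sq_le_one_iff_abs_le_one, ← sq_le_one_iff_abs_le_one]
    simp only [mem_ofPred_eq] at hz
    constructor <;> nlinarith [sq_nonneg z.1, sq_nonneg z.2]
  -- The unit circle is compact, so the form is at most `-m < 0` on it. Near `u` each of the three
  -- coefficients changes by less than `m / 8`, which leaves `-(m / 2)`.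
  obtain ⟨z₀, hz₀, hmax⟩ := hS.exists_isMaxOn ⟨((1 : ℝ), (0 : ℝ)), by simp⟩
    (f := h u) (by fun_prop)
  have hm0 : h u z₀ < 0 := by rw [← hh u z₀.1 z₀.2]; exact hneg _ _ hz₀
  set m := -h u z₀ with hm
  have hmpos : 0 < m := neg_pos.2 hm0
  have hcont : ∀ v w : H, ∀ᶠ w' in 𝓝 u, |modelHess T q ε w' v w - modelHess T q ε u v w| < m / 8 :=
    fun v w => (continuous_modelHess hq hqK v w).continuousAt.eventually
      (Metric.ball_mem_nhds (modelHess T q ε u v w) (by positivity : 0 < m / 8))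
  obtain ⟨R, hR, hRm⟩ := Metric.eventually_nhds_iff.1
    ((hcont e₁ e₁).and ((hcont e₁ e₂).and (hcont e₂ e₂)))
  have hbound : ∀ w, dist w u < R → ∀ x y : ℝ, x ^ 2 + y ^ 2 = 1 →
      modelHess T q ε w (x • e₁ + y • e₂) (x • e₁ + y • e₂) ≤ -(m / 2) := by
    intro w hw x y hxy
    obtain ⟨d1, d2, d3⟩ := hRm hw
    have h5 : h u (x, y) ≤ -m := by rw [hm, neg_neg]; exact hmax (by simpa using hxy)
    rw [hh]
    rw [abs_lt] at d1 d2 d3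
    have hx : x ^ 2 ≤ 1 := by nlinarith [sq_nonneg y]
    have hxy2 : |2 * x * y| ≤ 1 := by
      rw [abs_le]; constructor <;> nlinarith [sq_nonneg (x + y), sq_nonneg (x - y)]
    have k1 : x ^ 2 * (modelHess T q ε w e₁ e₁ - modelHess T q ε u e₁ e₁) ≤ m / 8 := by
      nlinarith [sq_nonneg x]
    have k2 : 2 * x * y * (modelHess T q ε w e₁ e₂ - modelHess T q ε u e₁ e₂) ≤ m / 8 := by
      refine (le_abs_self _).trans ?_
      rw [abs_mul]
      exact (mul_le_of_le_one_left (abs_nonneg _) hxy2).trans (abs_lt.2 d2).le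
    have k3 : y ^ 2 * (modelHess T q ε w e₂ e₂ - modelHess T q ε u e₂ e₂) ≤ m / 8 := by
      nlinarith [sq_nonneg y, sq_nonneg x]
    simp only [h] at h5 ⊢
    linarith
  set M := ‖e₁‖ + ‖e₂‖ + 1 with hM
  have hM1 : 1 ≤ M := by rw [hM]; linarith [norm_nonneg e₁, norm_nonneg e₂]
  -- Integrating the bound `-(m / 2)` twice along the segment gives the constant `m / 4`. The radius
  -- keeps the whole segment within `R` of `u`, since its direction has norm at most `M` and `1 ≤
  -- M`.
  refine ⟨m / 4, R / (2 * M), by positivity, by positivity, fun w hw x y hxy s hs => ?_⟩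
  set v := x • e₁ + y • e₂ with hv
  have hvM : ‖v‖ ≤ M := by
    have hx1 : |x| ≤ 1 := by rw [← sq_le_one_iff_abs_le_one]; nlinarith [sq_nonneg y]
    have hy1 : |y| ≤ 1 := by rw [← sq_le_one_iff_abs_le_one]; nlinarith [sq_nonneg x]
    refine (norm_add_le _ _).trans ?_
    rw [norm_smul, norm_smul, Real.norm_eq_abs, Real.norm_eq_abs]
    nlinarith [norm_nonneg e₁, norm_nonneg e₂]
  have hdist : ∀ τ ∈ Icc 0 s, dist (w + τ • v) u < R := fun τ hτ => by
    have a1 : dist (w + τ • v) w ≤ R / (2 * M) * M := by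
      rw [dist_eq_norm, add_sub_cancel_left, norm_smul, Real.norm_eq_abs, abs_of_nonneg hτ.1]
      exact mul_le_mul (hτ.2.trans hs.2) hvM (norm_nonneg _) (by positivity)
    have a2 : R / (2 * M) * M = R / 2 := by field_simp
    have a3 : R / (2 * M) ≤ R / 2 := by gcongr; linarith
    rw [Metric.mem_ball] at hw
    linarith [dist_triangle (w + τ • v) w u]
  have D1 : ∀ τ, HasDerivAt (fun s : ℝ => inner ℝ (modelGrad T hp G ε (w + s • v)) v)
      (modelHess T q ε (w + τ • v) v v) τ := hasDerivAt_inner_modelGrad hp hpq hq w v v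
  have L1 : ∀ τ ∈ Icc 0 s, inner ℝ (modelGrad T hp G ε (w + τ • v)) v ≤
      inner ℝ (modelGrad T hp G ε w) v + -(m / 2) * τ := by
    intro τ hτ
    have := image_le_of_deriv_right_le_deriv_boundary (a := 0) (b := s)
      (f := fun s : ℝ => inner ℝ (modelGrad T hp G ε (w + s • v)) v)
      (f' := fun τ => modelHess T q ε (w + τ • v) v v)
      (B := fun τ => inner ℝ (modelGrad T hp G ε w) v + -(m / 2) * τ) (B' := fun _ => -(m / 2))
      (fun τ _ => (D1 τ).continuousAt.continuousWithinAt) (fun τ _ => (D1 τ).hasDerivWithinAt)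
      (by simp) (by fun_prop)
      (fun τ _ => by
        have b1 := ((hasDerivAt_id τ).const_mul (-(m / 2))).const_add
          (inner ℝ (modelGrad T hp G ε w) v)
        rw [mul_one] at b1
        exact b1.hasDerivWithinAt)
      (fun τ hτ => hbound _ (hdist τ ⟨hτ.1, hτ.2.le⟩) x y hxy)
    exact this hτ
  have D0 : ∀ τ, HasDerivAt (fun s : ℝ => modelEnergy T P G ε (w + s • v))
      (inner ℝ (modelGrad T hp G ε (w + τ • v)) v) τ := hasDerivAt_modelEnergy_line hP hp hT hε w v
  have := image_le_of_deriv_right_le_deriv_boundary (a := 0) (b := s)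
      (f := fun s : ℝ => modelEnergy T P G ε (w + s • v))
      (f' := fun τ => inner ℝ (modelGrad T hp G ε (w + τ • v)) v)
      (B := fun τ => modelEnergy T P G ε w + τ * inner ℝ (modelGrad T hp G ε w) v - m / 4 * τ ^ 2)
      (B' := fun τ => inner ℝ (modelGrad T hp G ε w) v + -(m / 2) * τ)
      (fun τ _ => (D0 τ).continuousAt.continuousWithinAt) (fun τ _ => (D0 τ).hasDerivWithinAt)
      (by simp) (by fun_prop)
      (fun τ _ => by
        have b1 := ((hasDerivAt_id τ).mul_const (inner ℝ (modelGrad T hp G ε w) v)).const_add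
          (modelEnergy T P G ε w)
        have b2 := (hasDerivAt_pow 2 τ).const_mul (m / 4)
        refine (b1.fun_sub b2).hasDerivWithinAt.congr_deriv ?_
        simp only [one_mul, Nat.cast_ofNat, Nat.add_one_sub_one, pow_one]
        ring)
      (fun τ hτ => L1 τ ⟨hτ.1, hτ.2.le⟩)
  exact this ⟨hs.1, le_rfl⟩

/-- Coercivity. -/
theorem le_modelEnergy {κ C : ℝ} (hP : ∀ s, HasDerivAt P (p s) s)
    (hp : LipschitzWith K p) (hT : ∀ u, ‖T u‖ ≤ ‖u‖) (hε : 0 < ε)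
    (hκ : ∀ s, κ * s ^ 2 - C ≤ P s) (u : H) :
    min (ε / 2) (ε⁻¹ * κ) * ‖u‖ ^ 2 - ‖G‖ * ‖u‖ - ε⁻¹ * C * μ.real univ ≤
      modelEnergy T P G ε u := by
  have h1 : κ * ‖T u‖ ^ 2 - C * μ.real univ ≤ ∫ x, P (T u x) ∂μ := by
    have e : κ * ‖T u‖ ^ 2 - C * μ.real univ = ∫ x, (κ * T u x ^ 2 - C) ∂μ := by
      rw [integral_sub ((integrable_sq_L2 _).const_mul _) (integrable_const _),
        integral_const_mul, norm_L2_sq_eq]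
      simp [mul_comm]
    rw [e]
    exact integral_mono (((integrable_sq_L2 _).const_mul _).sub (integrable_const _))
      (integrable_potential hP hp _) fun x => hκ _
  have h2 : ‖T u‖ ^ 2 ≤ ‖u‖ ^ 2 := pow_le_pow_left₀ (norm_nonneg _) (hT u) 2
  have h3 : inner ℝ G (T u) ≤ ‖G‖ * ‖u‖ := (real_inner_le_norm _ _).trans
    (mul_le_mul_of_nonneg_left (hT u) (norm_nonneg _))
  have h4 := mul_le_mul_of_nonneg_left h1 (inv_pos.2 hε).le
  have h5 : min (ε / 2) (ε⁻¹ * κ) * (‖u‖ ^ 2 - ‖T u‖ ^ 2) ≤ ε / 2 * (‖u‖ ^ 2 - ‖T u‖ ^ 2) :=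
    mul_le_mul_of_nonneg_right (min_le_left _ _) (by linarith)
  have h6 : min (ε / 2) (ε⁻¹ * κ) * ‖T u‖ ^ 2 ≤ ε⁻¹ * κ * ‖T u‖ ^ 2 :=
    mul_le_mul_of_nonneg_right (min_le_right _ _) (sq_nonneg _)
  simp only [modelEnergy]
  linarith

/-- The Palais--Smale condition. -/
theorem exists_tendsto_of_palaisSmale {κ C β : ℝ} (hP : ∀ s, HasDerivAt P (p s) s)
    (hp : LipschitzWith K p) (hT : ∀ u, ‖T u‖ ≤ ‖u‖) (hTc : IsCompactOperator T) (hε : 0 < ε)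
    (hκ0 : 0 < κ) (hκ : ∀ s, κ * s ^ 2 - C ≤ P s) (u : ℕ → H)
    (h1 : Tendsto (fun k => modelEnergy T P G ε (u k)) atTop (𝓝 β))
    (h2 : Tendsto (fun k => modelGrad T hp G ε (u k)) atTop (𝓝 0)) :
    ∃ (v : H) (φ : ℕ → ℕ), StrictMono φ ∧ Tendsto (u ∘ φ) atTop (𝓝 v) := by
  obtain ⟨M, hM⟩ := h1.bddAbove_range
  set m := min (ε / 2) (ε⁻¹ * κ) with hm
  have hm0 : 0 < m := lt_min (half_pos hε) (by positivity)
  set A := |M + ε⁻¹ * C * μ.real univ| with hA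
  -- Coercivity turns the energy bound into a quadratic inequality for `‖u k‖`.
  have hb : ∀ k, ‖u k‖ ≤ (‖G‖ + A) / m + 1 := by
    intro k
    by_contra! hk
    have h3 := le_modelEnergy (G := G) hP hp hT hε hκ (u k)
    have h4 : modelEnergy T P G ε (u k) ≤ M := hM ⟨k, rfl⟩
    have h5 : ‖G‖ + A + m < m * ‖u k‖ := by
      have e : m * ((‖G‖ + A) / m + 1) = ‖G‖ + A + m := by field_simp
      rw [← e]; exact mul_lt_mul_of_pos_left hk hm0
    have h6 : (1 : ℝ) ≤ ‖u k‖ := by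
      have : 0 ≤ (‖G‖ + A) / m := by positivity
      linarith
    have h7 : (‖G‖ + A + m) * ‖u k‖ ≤ m * ‖u k‖ * ‖u k‖ :=
      mul_le_mul_of_nonneg_right h5.le (by linarith)
    have h8 : M + ε⁻¹ * C * μ.real univ ≤ A := le_abs_self _
    have h9 : A ≤ A * ‖u k‖ := le_mul_of_one_le_right (abs_nonneg _) h6
    nlinarith
  have hcomp := hTc.isCompact_closure_image_closedBall ((‖G‖ + A) / m + 1)
  obtain ⟨f, -, φ, hφ, hf⟩ := hcomp.tendsto_subseq (x := fun k => T (u k)) fun k =>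
    subset_closure ⟨u k, by simpa using hb k, rfl⟩
  -- Solving the formula of the gradient for `u` expresses `u` through its gradient and `T u`. The
  -- gradients tend to 0 and, since `T` is compact, `T (u k)` converges along a subsequence; hence
  -- so does `u k`, to the vector given here.
  refine ⟨ε⁻¹ • ((0 : H) - T.adjoint (ε⁻¹ • nemytskii hp f - G)) + T.adjoint f, φ, hφ, ?_⟩
  have e : u ∘ φ = fun k => ε⁻¹ • (modelGrad T hp G ε (u (φ k)) -
      T.adjoint (ε⁻¹ • nemytskii hp (T (u (φ k))) - G)) + T.adjoint (T (u (φ k))) := by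
    funext k
    simp only [modelGrad, Function.comp, add_sub_cancel_right, smul_smul, inv_mul_cancel₀ hε.ne',
      one_smul, sub_add_cancel]
  rw [e]
  have hn : Tendsto (fun k => nemytskii hp (T (u (φ k)))) atTop (𝓝 (nemytskii hp f)) :=
    ((continuous_nemytskii hp).tendsto f).comp hf
  have ha : Tendsto (fun k => T.adjoint (T (u (φ k)))) atTop (𝓝 (T.adjoint f)) :=
    (T.adjoint.continuous.tendsto f).comp hf
  have hb : Tendsto (fun k => T.adjoint (ε⁻¹ • nemytskii hp (T (u (φ k))) - G)) atTop
      (𝓝 (T.adjoint (ε⁻¹ • nemytskii hp f - G))) :=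
    (T.adjoint.continuous.tendsto _).comp ((hn.const_smul _).sub_const _)
  exact (((h2.comp hφ.tendsto_atTop).sub hb).const_smul _).add ha

end Model

/-! ### Strongly convex functionals: critical points and truncation -/

section StronglyConvex
open Filter Topology
open scoped NNReal

variable {X : Type*} [MeasurableSpace X] {μ : Measure X} [IsFiniteMeasure μ]
  {H : Type*} [NormedAddCommGroup H] [InnerProductSpace ℝ H] [CompleteSpace H]
  {T : H →L[ℝ] Lp ℝ 2 μ} {P p : ℝ → ℝ} {K : ℝ≥0} {G : Lp ℝ 2 μ} {ε k : ℝ}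

theorem mul_norm_sub_sq_le_inner_nemytskii (hp : LipschitzWith K p)
    (hk : ∀ s t, k * (s - t) ^ 2 ≤ (p s - p t) * (s - t)) (f h : Lp ℝ 2 μ) :
    k * ‖f - h‖ ^ 2 ≤ inner ℝ (nemytskii hp f - nemytskii hp h) (f - h) := by
  rw [norm_L2_sq_eq, inner_L2_eq, ← integral_const_mul]
  refine integral_mono_ae ((integrable_sq_L2 _).const_mul _) (integrable_mul_L2 _ _) ?_
  filter_upwards [Lp.coeFn_sub f h, Lp.coeFn_sub (nemytskii hp f) (nemytskii hp h),
    coeFn_nemytskii hp f, coeFn_nemytskii hp h] with x h1 h2 h3 h4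
  rw [h1, h2, Pi.sub_apply, Pi.sub_apply, h3, h4]
  exact hk _ _

/-- The squared norm is the sum of the Dirichlet part and the L² part; the first is controlled with
constant `ε`, the second with `ε⁻¹ * k`. -/
theorem mul_norm_sub_sq_le_inner_modelGrad (hp : LipschitzWith K p) (hT : ∀ u, ‖T u‖ ≤ ‖u‖)
    (hε : 0 < ε) (hk : ∀ s t, k * (s - t) ^ 2 ≤ (p s - p t) * (s - t)) (u v : H) :
    min ε (ε⁻¹ * k) * ‖u - v‖ ^ 2 ≤
      inner ℝ (modelGrad T hp G ε u - modelGrad T hp G ε v) (u - v) := by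
  have h1 := mul_norm_sub_sq_le_inner_nemytskii hp hk (T u) (T v)
  have h2 : ‖T u - T v‖ ^ 2 ≤ ‖u - v‖ ^ 2 := by
    rw [← map_sub]; exact pow_le_pow_left₀ (norm_nonneg _) (hT _) 2
  have e : inner ℝ (modelGrad T hp G ε u - modelGrad T hp G ε v) (u - v) =
      ε * (‖u - v‖ ^ 2 - ‖T u - T v‖ ^ 2) +
        ε⁻¹ * inner ℝ (nemytskii hp (T u) - nemytskii hp (T v)) (T u - T v) := by
    rw [inner_sub_left, inner_modelGrad, inner_modelGrad, ← real_inner_self_eq_norm_sq,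
      ← real_inner_self_eq_norm_sq]
    simp only [map_sub, inner_sub_left, inner_sub_right]
    ring
  rw [e]
  have h3 := mul_le_mul_of_nonneg_left h1 (inv_pos.2 hε).le
  have h4 : min ε (ε⁻¹ * k) * (‖u - v‖ ^ 2 - ‖T u - T v‖ ^ 2) ≤
      ε * (‖u - v‖ ^ 2 - ‖T u - T v‖ ^ 2) :=
    mul_le_mul_of_nonneg_right (min_le_left _ _) (by linarith)
  have h5 : min ε (ε⁻¹ * k) * ‖T u - T v‖ ^ 2 ≤ ε⁻¹ * k * ‖T u - T v‖ ^ 2 :=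
    mul_le_mul_of_nonneg_right (min_le_right _ _) (sq_nonneg _)
  linarith

/-- The gradient is `m`-strongly monotone and `Λ`-Lipschitz, so `u ↦ u - τ • modelGrad u` is a
contraction for suitable `τ`; its fixed point is the zero. No weak compactness is needed. -/
theorem exists_modelGrad_eq_zero (hp : LipschitzWith K p) (hT : ∀ u, ‖T u‖ ≤ ‖u‖)
    (hε : 0 < ε) (hk0 : 0 < k) (hk : ∀ s t, k * (s - t) ^ 2 ≤ (p s - p t) * (s - t)) :
    ∃ a, modelGrad T hp G ε a = 0 := by
  set m := min ε (ε⁻¹ * k) with hm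
  have hm0 : 0 < m := lt_min hε (by positivity)
  set Λ := 2 * ε + ε⁻¹ * K with hΛ
  have hΛm : m ≤ Λ := (min_le_left _ _).trans (by
    have : 0 ≤ ε⁻¹ * (K : ℝ) := by positivity
    linarith)
  have hΛ0 : 0 < Λ := hm0.trans_le hΛm
  -- This minimizes the squared contraction factor `1 - 2 τ m + τ² Λ²`; the minimum is `1 - m ^ 2 /
  -- Λ ^ 2`.
  set τ := m / Λ ^ 2 with hτ
  have hq : 1 - m ^ 2 / Λ ^ 2 < 1 := by
    have : 0 < m ^ 2 / Λ ^ 2 := by positivity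
    linarith
  have hq0 : 0 ≤ 1 - m ^ 2 / Λ ^ 2 := by
    rw [sub_nonneg, div_le_one (by positivity)]
    exact pow_le_pow_left₀ hm0.le hΛm 2
  have hc : ContractingWith (Real.toNNReal √(1 - m ^ 2 / Λ ^ 2))
      fun u : H => u - τ • modelGrad T hp G ε u := by
    refine ⟨?_, LipschitzWith.of_dist_le_mul fun u v => ?_⟩
    · rw [Real.toNNReal_lt_one]
      exact (Real.sqrt_lt_sqrt hq0 hq).trans_eq Real.sqrt_one
    · rw [Real.coe_toNNReal _ (Real.sqrt_nonneg _), dist_eq_norm, dist_eq_norm]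
      refine le_of_sq_le_sq ?_ (by positivity)
      rw [mul_pow, Real.sq_sqrt hq0]
      have e : u - τ • modelGrad T hp G ε u - (v - τ • modelGrad T hp G ε v) =
          (u - v) - τ • (modelGrad T hp G ε u - modelGrad T hp G ε v) := by module
      rw [e, norm_sub_sq_real, inner_smul_right, norm_smul, mul_pow, Real.norm_eq_abs, sq_abs,
        real_inner_comm]
      have h1 := mul_norm_sub_sq_le_inner_modelGrad (G := G) hp hT hε hk u v
      have h2 := pow_le_pow_left₀ (norm_nonneg _) (norm_modelGrad_sub_le (G := G) hp hT hε u v) 2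
      rw [← hΛ, mul_pow] at h2
      rw [← hm] at h1
      have hτ0 : 0 ≤ τ := by positivity
      have h3 := mul_le_mul_of_nonneg_left h1 hτ0
      have h4 := mul_le_mul_of_nonneg_left h2 (sq_nonneg τ)
      have e1 : τ * (m * ‖u - v‖ ^ 2) = m ^ 2 / Λ ^ 2 * ‖u - v‖ ^ 2 := by
        rw [hτ]; ring
      have e2 : τ ^ 2 * (Λ ^ 2 * ‖u - v‖ ^ 2) = m ^ 2 / Λ ^ 2 * ‖u - v‖ ^ 2 := by
        rw [hτ]; field_simp
      rw [e1] at h3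
      rw [e2] at h4
      linarith
  have hfix := hc.fixedPoint_isFixedPt
  refine ⟨ContractingWith.fixedPoint _ hc, ?_⟩
  have h1 : τ • modelGrad T hp G ε (ContractingWith.fixedPoint _ hc) = 0 := by
    simpa [Function.IsFixedPt] using hfix
  exact (smul_eq_zero.1 h1).resolve_left (by positivity)

/-- Strong monotonicity, integrated along the segment from `a` to `v`. The excess of energy controls
the distance to the minimizer, so minimizing sequences converge in norm. -/
theorem mul_norm_sub_sq_le_modelEnergy_sub (hP : ∀ s, HasDerivAt P (p s) s)
    (hp : LipschitzWith K p) (hT : ∀ u, ‖T u‖ ≤ ‖u‖)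
    (hε : 0 < ε) (hk : ∀ s t, k * (s - t) ^ 2 ≤ (p s - p t) * (s - t)) {a : H}
    (ha : modelGrad T hp G ε a = 0) (v : H) :
    min ε (ε⁻¹ * k) / 2 * ‖v - a‖ ^ 2 ≤ modelEnergy T P G ε v - modelEnergy T P G ε a := by
  set m := min ε (ε⁻¹ * k) with hm
  set h := v - a with hh
  have L1 : ∀ s ∈ Ico (0 : ℝ) 1, m * ‖h‖ ^ 2 * s ≤ inner ℝ (modelGrad T hp G ε (a + s • h)) h := by
    intro s hs
    have h1 := mul_norm_sub_sq_le_inner_modelGrad (G := G) hp hT hε hk (a + s • h) a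
    rw [ha, sub_zero, add_sub_cancel_left, norm_smul, inner_smul_right, mul_pow, Real.norm_eq_abs,
      sq_abs, ← hm] at h1
    rcases hs.1.eq_or_lt with h0 | h0
    · rw [← h0]; simp [ha]
    · have : s * (m * ‖h‖ ^ 2 * s) ≤ s * inner ℝ (modelGrad T hp G ε (a + s • h)) h := by linarith
      exact le_of_mul_le_mul_left this h0
  have D0 : ∀ τ, HasDerivAt (fun s : ℝ => modelEnergy T P G ε (a + s • h))
      (inner ℝ (modelGrad T hp G ε (a + τ • h)) h) τ := hasDerivAt_modelEnergy_line hP hp hT hε a h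
  have D1 : ∀ τ, HasDerivAt (fun s : ℝ => modelEnergy T P G ε a + m / 2 * ‖h‖ ^ 2 * s ^ 2)
      (m * ‖h‖ ^ 2 * τ) τ := fun τ => by
    have b2 := ((hasDerivAt_pow 2 τ).const_mul (m / 2 * ‖h‖ ^ 2)).const_add (modelEnergy T P G ε a)
    refine b2.congr_deriv ?_
    simp only [Nat.cast_ofNat, Nat.add_one_sub_one, pow_one]
    ring
  have := image_le_of_deriv_right_le_deriv_boundary (a := 0) (b := 1)
    (f := fun s : ℝ => modelEnergy T P G ε a + m / 2 * ‖h‖ ^ 2 * s ^ 2)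
    (B := fun s : ℝ => modelEnergy T P G ε (a + s • h))
    (fun τ _ => (D1 τ).continuousAt.continuousWithinAt) (fun τ _ => (D1 τ).hasDerivWithinAt)
    (by simp) (fun τ _ => (D0 τ).continuousAt.continuousWithinAt)
    (fun τ _ => (D0 τ).hasDerivWithinAt) L1 (right_mem_Icc.2 zero_le_one)
  simp only [one_pow, mul_one, one_smul, hh, add_sub_cancel] at this ⊢
  linarith

/-- The minimizer of a strongly convex functional is fixed by every truncation `ψ` which does not
increase the energy. -/
theorem nemytskii_eq_of_modelGrad_eq_zero {ψ : ℝ → ℝ} {Kψ : ℝ≥0} (hψ : LipschitzWith Kψ ψ)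
    (hP : ∀ s, HasDerivAt P (p s) s) (hp : LipschitzWith K p) (hT : ∀ u, ‖T u‖ ≤ ‖u‖)
    (hε : 0 < ε) (hk0 : 0 < k) (hk : ∀ s t, k * (s - t) ^ 2 ≤ (p s - p t) * (s - t)) {D : Set H}
    (hD : Dense D) (hM : ∀ u ∈ D, ∃ v, T v = nemytskii hψ (T u) ∧
      ‖v‖ ^ 2 - ‖T v‖ ^ 2 ≤ ‖u‖ ^ 2 - ‖T u‖ ^ 2)
    (hred : ∀ f : Lp ℝ 2 μ, ε⁻¹ * ∫ x, P (nemytskii hψ f x) ∂μ - inner ℝ G (nemytskii hψ f) ≤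
      ε⁻¹ * ∫ x, P (f x) ∂μ - inner ℝ G f) {a : H} (ha : modelGrad T hp G ε a = 0) :
    nemytskii hψ (T a) = T a := by
  have hcont : Continuous (modelEnergy T P G ε) := continuous_iff_continuousAt.2 fun u =>
    (hasFDerivAt_modelEnergy hP hp hT hε u).continuousAt
  -- The truncation is available on the dense set `D` only. Approximate `a` by `u n` in `D`: the
  -- truncated `v n` have no more energy, hence are also minimizing and converge to `a`. Applying
  -- `T` to both limits gives the claim.
  obtain ⟨u, huD, hu⟩ := mem_closure_iff_seq_limit.1 (hD a)
  choose v hv1 hv2 using fun n => hM (u n) (huD n)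
  have hle : ∀ n, modelEnergy T P G ε (v n) ≤ modelEnergy T P G ε (u n) := fun n => by
    have h1 := hred (T (u n))
    have h2 := mul_le_mul_of_nonneg_left (hv2 n) (half_pos hε).le
    rw [← hv1] at h1
    simp only [modelEnergy]
    linarith
  have hm0 : 0 < min ε (ε⁻¹ * k) / 2 := half_pos (lt_min hε (by positivity))
  have hJ : Tendsto (fun n => (min ε (ε⁻¹ * k) / 2)⁻¹ *
      (modelEnergy T P G ε (u n) - modelEnergy T P G ε a)) atTop (𝓝 0) := by
    have := (((hcont.tendsto a).comp hu).sub_const (modelEnergy T P G ε a)).const_mul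
      (min ε (ε⁻¹ * k) / 2)⁻¹
    simpa using this
  have hva : Tendsto (fun n => ‖v n - a‖ ^ 2) atTop (𝓝 0) := by
    refine squeeze_zero (fun _ => sq_nonneg _) (fun n => ?_) hJ
    rw [← div_eq_inv_mul, le_div_iff₀ hm0, mul_comm]
    exact (mul_norm_sub_sq_le_modelEnergy_sub hP hp hT hε hk ha (v n)).trans
      (sub_le_sub_right (hle n) _)
  have hva' : Tendsto v atTop (𝓝 a) := by
    rw [tendsto_iff_norm_sub_tendsto_zero]
    have := (Real.continuous_sqrt.tendsto 0).comp hva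
    simpa [Function.comp_def, Real.sqrt_sq (norm_nonneg _)] using this
  have l1 : Tendsto (fun n => T (v n)) atTop (𝓝 (T a)) := (T.continuous.tendsto a).comp hva'
  have l2 : Tendsto (fun n => T (v n)) atTop (𝓝 (nemytskii hψ (T a))) := by
    simp only [hv1]
    exact (((continuous_nemytskii hψ).comp T.continuous).tendsto a).comp hu
  exact tendsto_nhds_unique l2 l1

end StronglyConvex

/-! ### The double well potential and smooth truncations -/

section DoubleWell
open Filter Topology
open scoped NNReal

theorem IsDoubleWell.hasDerivAt {W : ℝ → ℝ} (hW : IsDoubleWell W) (s : ℝ) :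
    HasDerivAt W (deriv W s) s :=
  (hW.contDiff.differentiable (by norm_num) s).hasDerivAt

theorem IsDoubleWell.hasDerivAt_deriv {W : ℝ → ℝ} (hW : IsDoubleWell W) (s : ℝ) :
    HasDerivAt (deriv W) (iteratedDeriv 2 W s) s := by
  have h := (hW.contDiff.differentiable_deriv_two s).hasDerivAt
  rwa [iteratedDeriv_succ, iteratedDeriv_one]

theorem IsDoubleWell.continuous_iteratedDeriv {W : ℝ → ℝ} (hW : IsDoubleWell W) :
    Continuous (iteratedDeriv 2 W) := hW.contDiff.continuous_iteratedDeriv 2 (by norm_num)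

theorem IsDoubleWell.exists_lipschitzWith_deriv {W : ℝ → ℝ} (hW : IsDoubleWell W) :
    ∃ K : ℝ≥0, LipschitzWith K (deriv W) := by
  obtain ⟨C, hC⟩ := hW.upper_growth
  obtain ⟨M, hM⟩ := (isCompact_Icc (a := (-2 : ℝ)) (b := 2)).exists_bound_of_continuousOn
    hW.continuous_iteratedDeriv.continuousOn
  refine ⟨Real.toNNReal (max C M), lipschitzWith_of_nnnorm_deriv_le
    (fun s => (hW.hasDerivAt_deriv s).differentiableAt) fun s => ?_⟩
  rw [(hW.hasDerivAt_deriv s).deriv, ← NNReal.coe_le_coe, coe_nnnorm]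
  refine le_trans ?_ (Real.le_coe_toNNReal _)
  rcases le_total 2 |s| with h | h
  · exact (hC s h).trans (le_max_left _ _)
  · exact (hM s (abs_le.1 h)).trans (le_max_right _ _)

theorem IsDoubleWell.deriv_eq_zero {W : ℝ → ℝ} (hW : IsDoubleWell W) {z : ℝ} (hz : W z = 0) :
    deriv W z = 0 :=
  IsLocalMin.deriv_eq_zero (Eventually.of_forall fun s => by rw [hz]; exact hW.nonneg s)

theorem IsDoubleWell.exists_quadratic_le {W : ℝ → ℝ} (hW : IsDoubleWell W) :
    ∃ κ > 0, ∃ C, ∀ s, κ * s ^ 2 - C ≤ W s := by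
  obtain ⟨κ, hκ, h⟩ := hW.lower_growth
  refine ⟨κ, hκ, 4 * κ, fun s => ?_⟩
  rcases le_total 2 |s| with h2 | h2
  · linarith [h s h2]
  · have := hW.nonneg s
    have h3 : s ^ 2 ≤ 4 := by rw [← sq_abs]; nlinarith [abs_nonneg s]
    nlinarith

/-- Near a nondegenerate zero of a `C²` function with vanishing derivative, the derivative is strongly monotone. -/
theorem exists_strongly_monotone_deriv {W : ℝ → ℝ}
    (hW1 : ∀ s, HasDerivAt (deriv W) (iteratedDeriv 2 W s) s)
    (hc : Continuous (iteratedDeriv 2 W)) {z : ℝ} {m : ℝ} (hz : m < iteratedDeriv 2 W z) :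
    ∃ r > 0, (∀ s ∈ Icc (z - r) (z + r), m ≤ iteratedDeriv 2 W s) ∧
      ∀ s ∈ Icc (z - r) (z + r), ∀ t ∈ Icc (z - r) (z + r), t ≤ s →
        m * (s - t) ≤ deriv W s - deriv W t := by
  obtain ⟨r, hr, h⟩ := Metric.eventually_nhds_iff.1
    (hc.continuousAt.eventually (lt_mem_nhds hz))
  have h1 : ∀ s ∈ Icc (z - r / 2) (z + r / 2), m ≤ iteratedDeriv 2 W s := fun s hs => by
    refine (h ?_).le
    rw [Real.dist_eq, abs_lt]
    constructor <;> linarith [hs.1, hs.2]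
  refine ⟨r / 2, half_pos hr, h1, fun s hs t ht hts => ?_⟩
  refine (convex_Icc (z - r / 2) (z + r / 2)).mul_sub_le_image_sub_of_le_deriv
    (fun x _ => (hW1 x).continuousAt.continuousWithinAt)
    (fun x _ => (hW1 x).differentiableAt.differentiableWithinAt) (fun x hx => ?_) t ht s hs hts
  rw [(hW1 x).deriv]
  exact h1 x (interior_subset hx)

/-- Strong monotonicity of `W'` with `W' z = 0` fixes the sign of the derivative of `W s - m / 2 *
(s - z) ^ 2` on either side of `z`. -/
theorem IsDoubleWell.exists_quadratic_le_near {W : ℝ → ℝ} (hW : IsDoubleWell W) {z : ℝ}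
    (hz : W z = 0) (hz2 : 0 < iteratedDeriv 2 W z) :
    ∃ r > 0, ∃ k > 0, ∀ s, |s - z| ≤ r → k * (s - z) ^ 2 ≤ W s := by
  obtain ⟨r, hr, -, h⟩ := exists_strongly_monotone_deriv hW.hasDerivAt_deriv
    hW.continuous_iteratedDeriv (half_lt_self hz2)
  set m := iteratedDeriv 2 W z / 2 with hm
  have hm0 : 0 < m := half_pos hz2
  have hd0 := hW.deriv_eq_zero hz
  have hzI : z ∈ Icc (z - r) (z + r) := ⟨by linarith, by linarith⟩
  let f : ℝ → ℝ := fun s => W s - m / 2 * (s - z) ^ 2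
  have hf : ∀ s, HasDerivAt f (deriv W s - m * (s - z)) s := fun s => by
    have h1 := (((hasDerivAt_id s).sub_const z).pow 2).const_mul (m / 2)
    refine ((hW.hasDerivAt s).fun_sub h1).congr_deriv ?_
    simp; ring
  have hfc : ∀ S, ContinuousOn f S := fun S s _ => (hf s).continuousAt.continuousWithinAt
  have hfz : f z = 0 := by simp [f, hz]
  refine ⟨r, hr, m / 2, half_pos hm0, fun s hs => ?_⟩
  rw [abs_le] at hs
  suffices 0 ≤ f s by simp only [f] at this; linarith
  rw [← hfz]
  rcases le_total z s with hzs | hzs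
  · refine monotoneOn_of_deriv_nonneg (convex_Icc z (z + r)) (hfc _)
      (fun x _ => (hf x).differentiableAt.differentiableWithinAt) (fun x hx => ?_)
      ⟨le_rfl, by linarith⟩ ⟨hzs, by linarith⟩ hzs
    have hx' := interior_subset hx
    rw [(hf x).deriv]
    have := h x ⟨by linarith [hx'.1], hx'.2⟩ z hzI hx'.1
    linarith
  · refine antitoneOn_of_deriv_nonpos (convex_Icc (z - r) z) (hfc _)
      (fun x _ => (hf x).differentiableAt.differentiableWithinAt) (fun x hx => ?_)
      ⟨by linarith, hzs⟩ ⟨by linarith, le_rfl⟩ hzs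
    have hx' := interior_subset hx
    rw [(hf x).deriv]
    have := h z hzI x ⟨hx'.1, by linarith [hx'.2]⟩ hx'.2
    linarith

/-- `W` controls the squared distance to the wells. -/
theorem IsDoubleWell.exists_mul_sq_le {W : ℝ → ℝ} (hW : IsDoubleWell W) :
    ∃ k > 0, ∀ s, k * (|s| - 1) ^ 2 ≤ W s := by
  obtain ⟨r₁, hr₁, k₁, hk₁, h₁⟩ := hW.exists_quadratic_le_near
    ((hW.zero_iff 1).2 (Or.inr rfl)) hW.second_deriv_one
  obtain ⟨r₂, hr₂, k₂, hk₂, h₂⟩ := hW.exists_quadratic_le_near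
    ((hW.zero_iff (-1)).2 (Or.inl rfl)) hW.second_deriv_neg_one
  obtain ⟨κ, hκ, h₃⟩ := hW.lower_growth
  have hc : Continuous W := hW.contDiff.continuous
  have hcomp : IsCompact (Icc (-2 : ℝ) 2 \ (Metric.ball 1 r₁ ∪ Metric.ball (-1) r₂)) :=
    isCompact_Icc.diff (Metric.isOpen_ball.union Metric.isOpen_ball)
  obtain ⟨w, hw, hwle⟩ : ∃ w > 0, ∀ s ∈ Icc (-2 : ℝ) 2 \ (Metric.ball 1 r₁ ∪ Metric.ball (-1) r₂),
      w ≤ W s := by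
    rcases (Icc (-2 : ℝ) 2 \ (Metric.ball 1 r₁ ∪ Metric.ball (-1) r₂)).eq_empty_or_nonempty with h | h
    · exact ⟨1, one_pos, by simp [h]⟩
    · obtain ⟨x, hx, hmin⟩ := hcomp.exists_isMinOn h hc.continuousOn
      refine ⟨W x, lt_of_le_of_ne (hW.nonneg x) fun h0 => hx.2 ?_, fun s hs => hmin hs⟩
      rcases (hW.zero_iff x).1 h0.symm with rfl | rfl
      · exact Or.inr (Metric.mem_ball_self hr₂)
      · exact Or.inl (Metric.mem_ball_self hr₁)
  -- One constant for each region: near 1, near -1, `2 ≤ |s|`, and the compact rest, where `W` has a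
  -- positive minimum.
  refine ⟨min (min k₁ k₂) (min κ w), lt_min (lt_min hk₁ hk₂) (lt_min hκ hw), fun s => ?_⟩
  set k := min (min k₁ k₂) (min κ w) with hk
  have e1 : k ≤ k₁ := (min_le_left _ _).trans (min_le_left _ _)
  have e2 : k ≤ k₂ := (min_le_left _ _).trans (min_le_right _ _)
  have e3 : k ≤ κ := (min_le_right _ _).trans (min_le_left _ _)
  have e4 : k ≤ w := (min_le_right _ _).trans (min_le_right _ _)
  have hk0 : 0 ≤ k := (lt_min (lt_min hk₁ hk₂) (lt_min hκ hw)).le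
  have d1 : (|s| - 1) ^ 2 ≤ (s - 1) ^ 2 := by
    have := le_abs_self s
    nlinarith [sq_abs s]
  have d2 : (|s| - 1) ^ 2 ≤ (s - -1) ^ 2 := by
    have := neg_abs_le s
    nlinarith [sq_abs s]
  by_cases c1 : |s - 1| ≤ r₁
  · exact (mul_le_mul e1 d1 (sq_nonneg _) hk₁.le).trans (h₁ s c1)
  by_cases c2 : |s - -1| ≤ r₂
  · exact (mul_le_mul e2 d2 (sq_nonneg _) hk₂.le).trans (h₂ s c2)
  rcases le_total 2 |s| with c3 | c3
  · refine le_trans (mul_le_mul e3 ?_ (sq_nonneg _) hκ.le) (h₃ s c3)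
    rw [← sq_abs s]; nlinarith
  · have h4 := hwle s ⟨abs_le.1 c3, by
      rintro (h | h)
      · exact c1 (by rw [Metric.mem_ball, Real.dist_eq] at h; exact h.le)
      · exact c2 (by rw [Metric.mem_ball, Real.dist_eq] at h; exact h.le)⟩
    have d3 : (|s| - 1) ^ 2 ≤ 1 := by nlinarith [abs_nonneg s]
    calc k * (|s| - 1) ^ 2 ≤ k * 1 := mul_le_mul_of_nonneg_left d3 hk0
      _ ≤ W s := by linarith

/-- A smooth approximation of the truncation `s ↦ max k₁ (min s k₂)`. -/
theorem exists_smooth_truncation {k₀ k₁ k₂ k₃ : ℝ} (h01 : k₀ < k₁) (h12 : k₁ < k₂) (h23 : k₂ < k₃) :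
    ∃ ψ : ℝ → ℝ, ContDiff ℝ ∞ ψ ∧ (∀ s, deriv ψ s ∈ Icc 0 1) ∧ (∀ s, ψ s ∈ Icc k₀ k₃) ∧
      (∀ s ∈ Icc k₁ k₂, ψ s = s) ∧ (∀ s ≤ k₁, ψ s ∈ Icc s k₁) ∧ ∀ s, k₂ ≤ s → ψ s ∈ Icc k₂ s := by
  let δ := min (k₁ - k₀) (k₃ - k₂)
  have hδ : 0 < δ := lt_min (by linarith) (by linarith)
  have hδ1 : δ ≤ k₁ - k₀ := min_le_left _ _
  have hδ2 : δ ≤ k₃ - k₂ := min_le_right _ _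
  -- The derivative of the truncation: 1 on `[k₁, k₂]` and 0 outside `[k₀, k₃]`. Smoothness matters
  -- because smooth functions have to be mapped to smooth functions.
  let χ : ContDiffBump ((k₁ + k₂) / 2) := ⟨(k₂ - k₁) / 2, (k₂ - k₁) / 2 + δ, by linarith, by linarith⟩
  have hχc : Continuous χ := χ.continuous
  have hi : ∀ a b, IntervalIntegrable χ volume a b := fun a b => hχc.intervalIntegrable a b
  let ψ : ℝ → ℝ := fun s => k₁ + ∫ t in k₁..s, χ t
  have hd : ∀ s, HasDerivAt ψ (χ s) s := fun s =>
    ((hχc.integral_hasStrictDerivAt k₁ s).hasDerivAt).const_add k₁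
  have hdd : deriv ψ = χ := funext fun s => (hd s).deriv
  have h1 : ∀ s ∈ Icc k₁ k₂, χ s = 1 := fun s hs => χ.one_of_mem_closedBall (by
    rw [Metric.mem_closedBall, Real.dist_eq, abs_le]
    change -((k₂ - k₁) / 2) ≤ _ ∧ _ ≤ (k₂ - k₁) / 2
    constructor <;> linarith [hs.1, hs.2])
  have h0 : ∀ s, s ≤ k₀ ∨ k₃ ≤ s → χ s = 0 := fun s hs => χ.zero_of_le_dist (by
    rw [Real.dist_eq, le_abs]
    change (k₂ - k₁) / 2 + δ ≤ _ ∨ (k₂ - k₁) / 2 + δ ≤ _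
    rcases hs with hs | hs
    · right; linarith
    · left; linarith)
  have hup : ∀ a b, a ≤ b → ∫ t in a..b, χ t ≤ b - a := fun a b hab => by
    have := intervalIntegral.integral_mono_on hab (hi a b) (intervalIntegrable_const (c := (1 : ℝ)))
      fun t _ => χ.le_one
    simpa using this
  have hlo : ∀ a b, a ≤ b → 0 ≤ ∫ t in a..b, χ t := fun a b hab =>
    intervalIntegral.integral_nonneg hab fun t _ => χ.nonneg
  have hid : ∀ s ∈ Icc k₁ k₂, ψ s = s := fun s hs => by
    have : ∫ t in k₁..s, χ t = ∫ t in k₁..s, (1 : ℝ) :=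
      intervalIntegral.integral_congr fun t ht => by
        rw [uIcc_of_le hs.1] at ht
        exact h1 t ⟨ht.1, ht.2.trans hs.2⟩
    simp only [ψ, this]; simp
  have hz : ∀ a b, (∀ t ∈ uIcc a b, χ t = 0) → ∫ t in a..b, χ t = 0 := fun a b h => by
    rw [intervalIntegral.integral_congr (g := fun _ => (0 : ℝ)) fun t ht => h t ht]; simp
  have hadd : ∀ a b, ψ b = ψ a + ∫ t in a..b, χ t := fun a b => by
    simp only [ψ]
    rw [add_assoc, intervalIntegral.integral_add_adjacent_intervals (hi _ _) (hi _ _)]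
  have hk1 := hid k₁ ⟨le_rfl, h12.le⟩
  have hk2 := hid k₂ ⟨h12.le, le_rfl⟩
  have hleft : ∀ s ≤ k₁, ψ s ∈ Icc s k₁ := fun s hs => by
    have h := hadd s k₁
    have := hup s k₁ hs
    have := hlo s k₁ hs
    constructor <;> linarith
  have hright : ∀ s, k₂ ≤ s → ψ s ∈ Icc k₂ s := fun s hs => by
    have h := hadd k₂ s
    have := hup k₂ s hs
    have := hlo k₂ s hs
    constructor <;> linarith
  refine ⟨ψ, contDiff_infty_iff_deriv.2 ⟨fun s => (hd s).differentiableAt, by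
    rw [hdd]; exact χ.contDiff⟩, fun s => by rw [hdd]; exact ⟨χ.nonneg, χ.le_one⟩, fun s => ?_, hid,
    hleft, hright⟩
  have hmono : Monotone ψ := fun a b hab => by rw [hadd a b]; linarith [hlo a b hab]
  constructor
  · rcases le_total s k₀ with hs | hs
    · have h := hadd s k₀
      rw [hz s k₀ (fun t ht => h0 t (Or.inl (by rw [uIcc_of_le hs] at ht; exact ht.2))), add_zero] at h
      rw [← h]; exact (hleft k₀ h01.le).1
    · exact (hleft k₀ h01.le).1.trans (hmono hs)
  · rcases le_total k₃ s with hs | hs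
    · have h := hadd k₃ s
      rw [hz k₃ s (fun t ht => h0 t (Or.inr (by rw [uIcc_of_le hs] at ht; exact ht.1))), add_zero] at h
      rw [h]; exact (hright k₃ h23.le).2
    · exact (hmono hs).trans (hright k₃ h23.le).2

end DoubleWell

/-! ### Chain and product rules for the gradient -/

section Gradient
variable {d : ℕ} {N : Type*} [TopologicalSpace N] [ChartedSpace (EuclideanSpace ℝ (Fin d)) N]

/-- A smooth real function, as an element of `SmoothFn`. -/
def SmoothFn.mk (f : N → ℝ) (hf : ContMDiff (𝓡 d) 𝓘(ℝ, ℝ) ∞ f) : SmoothFn d N :=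
  (⟨f, hf⟩ : ContMDiffMap (𝓡 d) 𝓘(ℝ, ℝ) N ℝ ∞)

@[simp] theorem SmoothFn.toFun_mk (f : N → ℝ) (hf : ContMDiff (𝓡 d) 𝓘(ℝ, ℝ) ∞ f) :
    (SmoothFn.mk f hf).toFun = f := rfl

theorem SmoothFn.mdifferentiableAt (u : SmoothFn d N) (x : N) :
    MDifferentiableAt (𝓡 d) 𝓘(ℝ, ℝ) u.toFun x := u.contMDiff.mdifferentiable (by simp) x

/-- The composition `ψ ∘ u`. -/
def SmoothFn.comp (ψ : ℝ → ℝ) (hψ : ContDiff ℝ ∞ ψ) (u : SmoothFn d N) : SmoothFn d N :=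
  SmoothFn.mk (fun x => ψ (u.toFun x)) (hψ.contMDiff.comp u.contMDiff)

variable [RiemannianBundle (fun x : N => TangentSpace (𝓡 d) x)]

theorem differential_comp {ψ : ℝ → ℝ} (hψ : Differentiable ℝ ψ) {u : N → ℝ} {x : N}
    (hu : MDifferentiableAt (𝓡 d) 𝓘(ℝ, ℝ) u x) :
    differential (d := d) (fun x => ψ (u x)) x = deriv ψ (u x) • differential (d := d) u x := by
  have h := mfderiv_comp (I' := 𝓘(ℝ, ℝ)) (I'' := 𝓘(ℝ, ℝ)) x (hψ (u x)).mdifferentiableAt hu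
  unfold differential
  rw [show (fun x => ψ (u x)) = ψ ∘ u from rfl, h, mfderiv_eq_fderiv]
  ext v
  exact (fderiv_eq_smul_deriv (𝕜 := ℝ) (f := ψ) (x := u x) (show ℝ from
    mfderiv (𝓡 d) 𝓘(ℝ, ℝ) u x v)).trans (mul_comm _ _)

theorem grad_comp {ψ : ℝ → ℝ} (hψ : Differentiable ℝ ψ) {u : N → ℝ} {x : N}
    (hu : MDifferentiableAt (𝓡 d) 𝓘(ℝ, ℝ) u x) :
    grad (d := d) (fun x => ψ (u x)) x = deriv ψ (u x) • grad (d := d) u x := by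
  unfold grad
  rw [differential_comp hψ hu, (InnerProductSpace.toDual ℝ _).symm.map_smulₛₗ, conj_trivial]

theorem grad_const (c : ℝ) (x : N) : grad (d := d) (fun _ : N => c) x = 0 := by
  have : differential (d := d) (fun _ : N => c) x = 0 := mfderiv_const
  rw [grad, this, map_zero]

theorem grad_mul {u v : N → ℝ} {x : N} (hu : MDifferentiableAt (𝓡 d) 𝓘(ℝ, ℝ) u x)
    (hv : MDifferentiableAt (𝓡 d) 𝓘(ℝ, ℝ) v x) :
    grad (d := d) (fun x => u x * v x) x = u x • grad (d := d) v x + v x • grad (d := d) u x := by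
  have h : differential (d := d) (fun x => u x * v x) x =
      u x • differential (d := d) v x + v x • differential (d := d) u x :=
    (hu.hasMFDerivAt.mul hv.hasMFDerivAt).mfderiv
  unfold grad
  rw [h, map_add, (InnerProductSpace.toDual ℝ _).symm.map_smulₛₗ,
    (InnerProductSpace.toDual ℝ _).symm.map_smulₛₗ, conj_trivial, conj_trivial]

end Gradient

/-! ### Elementary facts about W^{1,2} -/

section SobolevBasics
open Filter Topology
open scoped NNReal

variable {d : ℕ} {N : Type*} [TopologicalSpace N] [ChartedSpace (EuclideanSpace ℝ (Fin d)) N]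
  [RiemannianBundle (fun x : N => TangentSpace (𝓡 d) x)]
  [MeasurableSpace N] [BorelSpace N] [T2Space N] [CompactSpace N] [IsManifold (𝓡 d) ∞ N]
  [IsContMDiffRiemannianBundle (𝓡 d) ∞ (EuclideanSpace ℝ (Fin d))
    (fun x : N => TangentSpace (𝓡 d) x)]

theorem continuous_norm_grad (u : SmoothFn d N) :
    Continuous fun x => ‖grad (d := d) u.toFun x‖ := by
  have h := Real.continuous_sqrt.comp (continuous_inner_grad u.contMDiff u.contMDiff)
  refine h.congr fun x => ?_
  simp

theorem integrable_norm_grad_sq (u : SmoothFn d N) :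
    Integrable (fun x => ‖grad (d := d) u.toFun x‖ ^ 2) (vol d N) :=
  integrable_vol ((continuous_norm_grad u).pow 2)

theorem denseRange_coe_W12 : DenseRange ((↑) : SmoothFn d N → W12 d N) :=
  UniformSpace.Completion.denseRange_coe

theorem norm_toL2_le (u : W12 d N) : ‖toL2 d N u‖ ≤ ‖u‖ := by
  refine UniformSpace.Completion.induction_on u (isClosed_le (by fun_prop) (by fun_prop)) fun u => ?_
  rw [toL2_coe, UniformSpace.Completion.norm_coe]
  simpa using u.norm_toLp_le

theorem dirichlet_nonneg (u : W12 d N) : 0 ≤ dirichlet u :=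
  sub_nonneg.2 (pow_le_pow_left₀ (norm_nonneg _) (norm_toL2_le u) 2)

theorem coeFn_toL2_coe (u : SmoothFn d N) : toL2 d N u =ᵐ[vol d N] u.toFun := by
  rw [toL2_coe]; exact u.memLp.coeFn_toLp

theorem toL2_comp {ψ : ℝ → ℝ} (hψ : ContDiff ℝ ∞ ψ) {K : ℝ≥0} (hK : LipschitzWith K ψ)
    (u : SmoothFn d N) :
    toL2 d N (u.comp ψ hψ : SmoothFn d N) = nemytskii hK (toL2 d N u) := by
  refine Lp.ext ?_
  filter_upwards [coeFn_toL2_coe (u.comp ψ hψ), coeFn_nemytskii hK (toL2 d N u),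
    coeFn_toL2_coe u] with x h1 h2 h3
  rw [h1, h2, h3]; rfl

theorem dirichlet_comp_le {ψ : ℝ → ℝ} (hψ : ContDiff ℝ ∞ ψ) (h1 : ∀ s, |deriv ψ s| ≤ 1)
    (u : SmoothFn d N) :
    dirichlet ((u.comp ψ hψ : SmoothFn d N) : W12 d N) ≤ dirichlet (u : W12 d N) := by
  rw [dirichlet_coe, dirichlet_coe]
  refine integral_mono (integrable_norm_grad_sq _) (integrable_norm_grad_sq _) fun x => ?_
  have e : grad (d := d) (u.comp ψ hψ).toFun x = deriv ψ (u.toFun x) • grad (d := d) u.toFun x :=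
    grad_comp (hψ.differentiable (by simp)) (u.mdifferentiableAt x)
  simp only [e, norm_smul, Real.norm_eq_abs]
  exact pow_le_pow_left₀ (by positivity) (mul_le_of_le_one_left (norm_nonneg _) (h1 _)) 2

variable (d N) in
/-- The constant functions. -/
def constFn (c : ℝ) : SmoothFn d N := SmoothFn.mk (fun _ => c) contMDiff_const

theorem dirichlet_constFn (c : ℝ) : dirichlet (constFn d N c : W12 d N) = 0 := by
  rw [dirichlet_coe]
  have : ∀ x, ‖grad (d := d) (constFn d N c).toFun x‖ ^ 2 = 0 := fun x => by
    rw [constFn, SmoothFn.toFun_mk, grad_const]; simp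
  simp [this]

end SobolevBasics

/-! ### Strongly monotone extension of a function from an interval -/

section ConvexExtension
open Filter Topology
open scoped NNReal

theorem add_mul_le_of_monotone_deriv {P p : ℝ → ℝ} (hP : ∀ s, HasDerivAt P (p s) s)
    (hp : Monotone p) (s t : ℝ) : P s + p s * (t - s) ≤ P t := by
  have hc : ∀ S, ContinuousOn P S := fun S s _ => (hP s).continuousAt.continuousWithinAt
  have hd : ∀ S, DifferentiableOn ℝ P S :=
    fun S s _ => (hP s).differentiableAt.differentiableWithinAt
  rcases le_total s t with h | h
  · have := (convex_Icc s t).mul_sub_le_image_sub_of_le_deriv (hc _) (hd _) (C := p s)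
      (fun x hx => by rw [(hP x).deriv]; exact hp (interior_subset hx).1)
      s ⟨le_rfl, h⟩ t ⟨h, le_rfl⟩ h
    linarith
  · have := (convex_Icc t s).image_sub_le_mul_sub_of_deriv_le (hc _) (hd _) (C := p s)
      (fun x hx => by rw [(hP x).deriv]; exact hp (interior_subset hx).2)
      t ⟨le_rfl, h⟩ s ⟨h, le_rfl⟩ h
    linarith

/-- A function which is strongly monotone on an interval agrees there with a Lipschitz function
which is strongly monotone on the line. -/
theorem exists_strongly_monotone_extension {p : ℝ → ℝ} {K : ℝ≥0} (hp : LipschitzWith K p)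
    {α β m : ℝ} (hαβ : α ≤ β) (hm : 0 < m)
    (h : ∀ s ∈ Icc α β, ∀ t ∈ Icc α β, t ≤ s → m * (s - t) ≤ p s - p t) :
    ∃ p' : ℝ → ℝ, ∃ K' : ℝ≥0, LipschitzWith K' p' ∧ (∀ s ∈ Icc α β, p' s = p s) ∧
      ∃ k > 0, ∀ s t, k * (s - t) ^ 2 ≤ (p' s - p' t) * (s - t) := by
  -- Projecting to the interval and adding the excess `s - cl s` continues `p` with slope 1 on both
  -- sides.
  let cl : ℝ → ℝ := fun s => max α (min β s)
  have hcl : LipschitzWith 1 cl := (LipschitzWith.id.const_min β).const_max α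
  have hclm : ∀ s, cl s ∈ Icc α β := fun s => ⟨le_max_left _ _, max_le hαβ (min_le_left _ _)⟩
  have hmono : Monotone cl := fun s t hst => max_le_max le_rfl (min_le_min le_rfl hst)
  have hclid : ∀ s ∈ Icc α β, cl s = s := fun s hs => by
    simp only [cl]; rw [min_eq_right hs.2, max_eq_right hs.1]
  refine ⟨fun s => p (cl s) + (s - cl s), _, (hp.comp hcl).add (LipschitzWith.id.sub hcl),
    fun s hs => by simp only [hclid s hs]; ring, min m 1, lt_min hm one_pos, ?_⟩
  have key : ∀ s t, t ≤ s → min m 1 * (s - t) ≤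
      p (cl s) + (s - cl s) - (p (cl t) + (t - cl t)) := fun s t hts => by
    have h1 := h _ (hclm s) _ (hclm t) (hmono hts)
    have h2 := hcl.dist_le_mul s t
    rw [Real.dist_eq, Real.dist_eq, abs_of_nonneg (sub_nonneg.2 hts),
      abs_of_nonneg (sub_nonneg.2 (hmono hts)), NNReal.coe_one, one_mul] at h2
    have h3 := sub_nonneg.2 (hmono hts)
    nlinarith [min_le_left m 1, min_le_right m 1]
  intro s t
  rcases le_total t s with hts | hts
  · have := mul_le_mul_of_nonneg_right (key s t hts) (sub_nonneg.2 hts)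
    rw [sq, ← mul_assoc]; exact this
  · have := mul_le_mul_of_nonneg_right (key t s hts) (sub_nonneg.2 hts)
    nlinarith

theorem monotone_of_strongly_monotone {p : ℝ → ℝ} {k : ℝ} (hk0 : 0 < k)
    (hk : ∀ s t, k * (s - t) ^ 2 ≤ (p s - p t) * (s - t)) : Monotone p := by
  intro t s hts
  rcases hts.eq_or_lt with rfl | h
  · rfl
  · have h1 := hk s t
    have h2 : 0 < s - t := sub_pos.2 h
    have h3 : 0 ≤ p s - p t := by
      by_contra! hneg
      nlinarith [mul_pos hk0 (pow_pos h2 2)]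
    linarith

end ConvexExtension

/-! ### The stable critical points near the wells -/

section Valley
open Filter Topology
open scoped NNReal

variable {d : ℕ} {N : Type*} [TopologicalSpace N] [ChartedSpace (EuclideanSpace ℝ (Fin d)) N]
  [RiemannianBundle (fun x : N => TangentSpace (𝓡 d) x)]
  [MeasurableSpace N] [BorelSpace N] [T2Space N] [CompactSpace N] [IsManifold (𝓡 d) ∞ N]
  [IsContMDiffRiemannianBundle (𝓡 d) ∞ (EuclideanSpace ℝ (Fin d))
    (fun x : N => TangentSpace (𝓡 d) x)]

theorem memLp_two_of_continuous {g : N → ℝ} (hg : Continuous g) : MemLp g 2 (vol d N) :=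
  hg.memLp_of_hasCompactSupport (HasCompactSupport.of_compactSpace _)

variable (d) in
/-- A continuous function as an element of `L²`. -/
def continuousL2 (g : N → ℝ) (hg : Continuous g) : Lp ℝ 2 (vol d N) :=
  (memLp_two_of_continuous hg).toLp g

theorem coeFn_continuousL2 {g : N → ℝ} (hg : Continuous g) :
    continuousL2 d g hg =ᵐ[vol d N] g := MemLp.coeFn_toLp _

theorem inner_continuousL2 {g : N → ℝ} (hg : Continuous g) (f : Lp ℝ 2 (vol d N)) :
    inner ℝ (continuousL2 d g hg) f = ∫ x, g x * f x ∂(vol d N) := by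
  rw [inner_L2_eq]
  refine integral_congr_ae ?_
  filter_upwards [coeFn_continuousL2 hg] with x hx
  rw [hx]

theorem integrable_mul_continuous {g : N → ℝ} (hg : Continuous g) (f : Lp ℝ 2 (vol d N)) :
    Integrable (fun x => g x * f x) (vol d N) :=
  (memLp_two_of_continuous hg).integrable_mul (Lp.memLp f)

theorem energyF_eq_modelEnergy (W : ℝ → ℝ) {g : N → ℝ} (hg : Continuous g) (ε : ℝ) :
    energyF W g ε = modelEnergy (toL2 d N) W (continuousL2 d g hg) ε := by
  funext u
  rw [energyF, energyE, modelEnergy, inner_continuousL2, dirichlet]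

theorem isCriticalPoint_iff {W p : ℝ → ℝ} {K : ℝ≥0} (hP : ∀ s, HasDerivAt W (p s) s)
    (hp : LipschitzWith K p) {g : N → ℝ} (hg : Continuous g) {ε : ℝ} (hε : 0 < ε) (u : W12 d N) :
    IsCriticalPoint W g ε u ↔ modelGrad (toL2 d N) hp (continuousL2 d g hg) ε u = 0 := by
  rw [IsCriticalPoint, energyF_eq_modelEnergy W hg]
  exact hasFDerivAt_zero_iff_modelGrad_eq_zero hP hp norm_toL2_le hε u

theorem secondVariation_eq_modelHess {W p q : ℝ → ℝ} {K : ℝ≥0} (hP : ∀ s, HasDerivAt W (p s) s)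
    (hp : LipschitzWith K p) (hpq : ∀ s, HasDerivAt p (q s) s) (hq : Continuous q)
    {g : N → ℝ} (hg : Continuous g) {ε : ℝ} (hε : 0 < ε) (u φ : W12 d N) :
    secondVariation W g ε u φ = modelHess (toL2 d N) q ε u φ φ := by
  rw [secondVariation, energyF_eq_modelEnergy W hg]
  exact iteratedDeriv_two_modelEnergy hP hp hpq hq norm_toL2_le hε u φ

theorem nemytskii_congr {X : Type*} [MeasurableSpace X] {μ : Measure X} [IsFiniteMeasure μ]
    {p p' : ℝ → ℝ} {K K' : ℝ≥0} (hp : LipschitzWith K p) (hp' : LipschitzWith K' p')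
    {f : Lp ℝ 2 μ} (h : ∀ᵐ x ∂μ, p (f x) = p' (f x)) : nemytskii hp f = nemytskii hp' f := by
  refine Lp.ext ?_
  filter_upwards [h, coeFn_nemytskii hp f, coeFn_nemytskii hp' f] with x h1 h2 h3
  rw [h2, h3, h1]

theorem abs_deriv_le_one_lipschitz {ψ : ℝ → ℝ} (hψ : Differentiable ℝ ψ)
    (h : ∀ s, |deriv ψ s| ≤ 1) : LipschitzWith 1 ψ :=
  lipschitzWith_of_nnnorm_deriv_le hψ fun s => by
    rw [← NNReal.coe_le_coe, coe_nnnorm]; exact h s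

/-- Existence of a stable critical point between `z` and `z + c ε`, where `z` is a nondegenerate
zero of the potential. -/
theorem IsDoubleWell.exists_valley {W : ℝ → ℝ} (hW : IsDoubleWell W) [Nonempty N] {g : N → ℝ}
    (hg : Continuous g) (hg0 : ∀ x, 0 < g x) {z c : ℝ} (hz : W z = 0)
    (hz2 : 0 < iteratedDeriv 2 W z) (hc : ∀ x, g x < c * iteratedDeriv 2 W z) :
    ∃ ε₀ > 0, ∀ ε, 0 < ε → ε < ε₀ → ∃ a : W12 d N, IsCriticalPoint W g ε a ∧ IsStable W g ε a ∧
      ∀ᵐ x ∂(vol d N), z < toL2 d N a x ∧ toL2 d N a x < z + c * ε := by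
  obtain ⟨K, hK⟩ := hW.exists_lipschitzWith_deriv
  obtain ⟨x₁, hx₁⟩ := hg.exists_forall_ge' (x₀ := Classical.arbitrary N) (by simp)
  obtain ⟨x₀, hx₀⟩ := hg.exists_forall_le' (x₀ := Classical.arbitrary N) (by simp)
  have hc0 : 0 < c := by
    have := (hg0 x₁).trans (hc x₁)
    exact pos_of_mul_pos_left this hz2.le
  have hGm : g x₁ / c < iteratedDeriv 2 W z := by
    rw [div_lt_iff₀ hc0, mul_comm]; exact hc x₁
  -- The strict inequality `g < c W''(z)` leaves room for `m` with `max g / c < m < W''(z)`: then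
  -- `W'' ≥ m` near `z`, and `max g / m` is still below `c`.
  obtain ⟨m, hm1, hm2⟩ := exists_between hGm
  have hm0 : 0 < m := (div_pos (hg0 x₁) hc0).trans hm1
  obtain ⟨r, hr, hrq, hrp⟩ := exists_strongly_monotone_deriv hW.hasDerivAt_deriv
    hW.continuous_iteratedDeriv hm2
  obtain ⟨p, K', hp, hpW, k, hk0, hk⟩ := exists_strongly_monotone_extension hK
    (by linarith : z - r ≤ z + r) hm0 hrp
  have hpm := monotone_of_strongly_monotone hk0 hk
  have hdz := hW.deriv_eq_zero hz
  have hzI : z ∈ Icc (z - r) (z + r) := ⟨by linarith, by linarith⟩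
  refine ⟨r / c, by positivity, fun ε hε hεr => ?_⟩
  have hcε : c * ε < r := by rw [lt_div_iff₀ hc0] at hεr; linarith
  -- The constant `z + t₂` is a supersolution: `W'(z + t₂) ≥ m * t₂ = ε max g`.
  set t₂ := g x₁ / m * ε with ht₂
  have ht₂0 : 0 < t₂ := mul_pos (div_pos (hg0 x₁) hm0) hε
  have ht₂c : t₂ < c * ε := by
    refine mul_lt_mul_of_pos_right ?_ hε
    rw [div_lt_iff₀ hm0]; rw [div_lt_iff₀ hc0] at hm1; linarith
  -- The constant `z + t₁` is a subsolution: `W'(z + t₁) ≤ K * t₁ ≤ ε min g`.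
  set t₁ := min (t₂ / 2) (g x₀ * ε / (K + 1)) with ht₁
  have ht₁0 : 0 < t₁ := lt_min (by positivity) (div_pos (mul_pos (hg0 x₀) hε) (by positivity))
  have ht₁₂ : t₁ < t₂ := (min_le_left _ _).trans_lt (by linarith)
  -- The truncation is the identity between the two barriers, and its range is compactly contained
  -- in `(z, z + c ε)`. So the strict bounds follow without a strong maximum principle.
  obtain ⟨ψ, hψ, hψd, hψr, hψid, hψl, hψu⟩ := exists_smooth_truncation
    (k₀ := z + t₁ / 2) (k₁ := z + t₁) (k₂ := z + t₂) (k₃ := z + (t₂ + c * ε) / 2)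
    (by linarith) (by linarith) (by linarith)
  have hψ1 : ∀ s, |deriv ψ s| ≤ 1 := fun s => by
    rw [abs_of_nonneg (hψd s).1]; exact (hψd s).2
  have hψL := abs_deriv_le_one_lipschitz (hψ.differentiable (by simp)) hψ1
  have hp₁ : ∀ x, p (z + t₁) ≤ ε * g x := fun x => by
    have hI : z + t₁ ∈ Icc (z - r) (z + r) := ⟨by linarith, by linarith⟩
    rw [hpW _ hI]
    have h1 := hK.dist_le_mul (z + t₁) z
    rw [Real.dist_eq, Real.dist_eq, hdz, sub_zero, add_sub_cancel_left, abs_of_pos ht₁0] at h1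
    have h2 : t₁ * (K + 1) ≤ g x₀ * ε := by
      rw [← le_div_iff₀ (by positivity)]; exact min_le_right _ _
    have h3 : g x₀ * ε ≤ g x * ε := mul_le_mul_of_nonneg_right (hx₀ x) hε.le
    linarith [le_abs_self (deriv W (z + t₁))]
  have hp₂ : ∀ x, ε * g x ≤ p (z + t₂) := fun x => by
    have hI : z + t₂ ∈ Icc (z - r) (z + r) := ⟨by linarith, by linarith⟩
    rw [hpW _ hI]
    have h1 := hrp _ hI z hzI (by linarith)
    rw [hdz, sub_zero, add_sub_cancel_left] at h1
    have h2 : m * t₂ = g x₁ * ε := by rw [ht₂]; field_simp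
    have h3 : g x * ε ≤ g x₁ * ε := mul_le_mul_of_nonneg_right (hx₁ x) hε.le
    linarith
  -- The convex potential that replaces `W`; its derivative agrees with `W'` on `[z - r, z + r]`.
  let P : ℝ → ℝ := fun s => ∫ t in z..s, p t
  have hP : ∀ s, HasDerivAt P (p s) s := fun s =>
    (hp.continuous.integral_hasStrictDerivAt z s).hasDerivAt
  obtain ⟨a, ha⟩ := exists_modelGrad_eq_zero (T := toL2 d N) (G := continuousL2 d g hg) hp
    norm_toL2_le hε hk0 hk
  have hfix : nemytskii hψL (toL2 d N a) = toL2 d N a := by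
    refine nemytskii_eq_of_modelGrad_eq_zero hψL hP hp norm_toL2_le hε hk0 hk
      (denseRange_coe_W12 (d := d) (N := N)) ?_ (fun f => ?_) ha
    · rintro _ ⟨u, rfl⟩
      exact ⟨(u.comp ψ hψ : SmoothFn d N), toL2_comp hψ hψL u, dirichlet_comp_le hψ hψ1 u⟩
    · rw [inner_continuousL2, inner_continuousL2, ← integral_const_mul, ← integral_const_mul,
        ← integral_sub ((integrable_potential hP hp _).const_mul _) (integrable_mul_continuous hg _),
        ← integral_sub ((integrable_potential hP hp _).const_mul _) (integrable_mul_continuous hg _)]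
      refine integral_mono_ae
        (((integrable_potential hP hp _).const_mul _).sub (integrable_mul_continuous hg _))
        (((integrable_potential hP hp _).const_mul _).sub (integrable_mul_continuous hg _)) ?_
      filter_upwards [coeFn_nemytskii hψL f] with x hx
      simp only [hx]
      have hconv := add_mul_le_of_monotone_deriv hP hpm (ψ (f x)) (f x)
      -- Pointwise comparison: below the subsolution and above the supersolution, convexity of `P`
      -- and the sign of `p - ε g` at the barrier show that `P - ε g s` does not increase under `ψ`.
      have hmain : P (ψ (f x)) + ε * g x * (f x - ψ (f x)) ≤ P (f x) := by
        rcases le_total (f x) (z + t₁) with h1 | h1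
        · have h2 := hψl _ h1
          nlinarith [hp₁ x, hpm h2.2, h2.1]
        · rcases le_total (z + t₂) (f x) with h3 | h3
          · have h2 := hψu _ h3
            nlinarith [hp₂ x, hpm h2.1, h2.2]
          · rw [hψid _ ⟨h1, h3⟩]; simp
      have h4 := mul_le_mul_of_nonneg_left hmain (inv_pos.2 hε).le
      have h5 : ε⁻¹ * (P (ψ (f x)) + ε * g x * (f x - ψ (f x))) =
          ε⁻¹ * P (ψ (f x)) + g x * (f x - ψ (f x)) := by field_simp
      rw [h5] at h4
      linarith
  have hrange : ∀ᵐ x ∂(vol d N), toL2 d N a x ∈ Icc (z + t₁ / 2) (z + (t₂ + c * ε) / 2) := by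
    have h1 := coeFn_nemytskii hψL (toL2 d N a)
    rw [hfix] at h1
    filter_upwards [h1] with x hx
    rw [hx]; exact hψr _
  -- On the range of `a` the extension agrees with `W'`, so `a` is critical for the original
  -- functional; there `W'' ≥ m > 0`, which gives stability.
  refine ⟨a, ?_, fun φ => ?_, ?_⟩
  · rw [isCriticalPoint_iff hW.hasDerivAt hK hg hε, ← ha]
    unfold modelGrad
    rw [nemytskii_congr hK hp]
    filter_upwards [hrange] with x hx
    rw [hpW _ ⟨by linarith [hx.1], by linarith [hx.2]⟩]
  · rw [secondVariation_eq_modelHess hW.hasDerivAt hK hW.hasDerivAt_deriv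
      hW.continuous_iteratedDeriv hg hε, modelHess, real_inner_self_eq_norm_sq,
      real_inner_self_eq_norm_sq]
    refine add_nonneg (mul_nonneg hε.le (dirichlet_nonneg φ))
      (mul_nonneg (inv_pos.2 hε).le (integral_nonneg_of_ae ?_))
    filter_upwards [hrange] with x hx
    exact mul_nonneg (hm0.le.trans (hrq _ ⟨by linarith [hx.1], by linarith [hx.2]⟩))
      (mul_self_nonneg _)
  · filter_upwards [hrange] with x hx
    constructor <;> linarith [hx.1, hx.2]

end Valley

/-! ### Change of charts for the Gram determinant -/

section ChartVolume
open Filter Topology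
open scoped ENNReal

variable {d : ℕ} {N : Type*} [TopologicalSpace N] [ChartedSpace (EuclideanSpace ℝ (Fin d)) N]
  [RiemannianBundle (fun x : N => TangentSpace (𝓡 d) x)]

/-- The metric at `x` as a function on the model space. -/
def metricForm (x : N) (v w : EuclideanSpace ℝ (Fin d)) : ℝ :=
  @inner ℝ (TangentSpace (𝓡 d) x) _ v w

/-- The derivative of the inverse chart. -/
def chartSymmDeriv (x₀ : N) (y : EuclideanSpace ℝ (Fin d)) :
    EuclideanSpace ℝ (Fin d) →L[ℝ] EuclideanSpace ℝ (Fin d) :=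
  mfderiv (𝓡 d) (𝓡 d) (chartAt (EuclideanSpace ℝ (Fin d)) x₀).symm y

/-- Written on the model space, the metric can be moved between base points that are equal but not
definitionally equal, as happens for the two descriptions of a point in overlapping charts. -/
theorem gram_apply_eq_metricForm (x₀ : N) (y : EuclideanSpace ℝ (Fin d)) (i j : Fin d) :
    gram x₀ y i j = metricForm ((chartAt (EuclideanSpace ℝ (Fin d)) x₀).symm y)
      (chartSymmDeriv x₀ y (EuclideanSpace.single i 1))
      (chartSymmDeriv x₀ y (EuclideanSpace.single j 1)) := rfl

theorem metricForm_sum_sum (x : N) (v : Fin d → EuclideanSpace ℝ (Fin d)) (a b : Fin d → ℝ) :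
    metricForm x (∑ k, a k • v k) (∑ l, b l • v l) =
      ∑ k, ∑ l, a k * b l * metricForm x (v k) (v l) := by
  let v' : Fin d → TangentSpace (𝓡 d) x := v
  change inner ℝ (∑ k, a k • v' k) (∑ l, b l • v' l) = _
  rw [sum_inner]
  refine Finset.sum_congr rfl fun k _ => ?_
  rw [inner_sum]
  refine Finset.sum_congr rfl fun l _ => ?_
  rw [inner_smul_left, inner_smul_right, conj_trivial, ← mul_assoc]
  rfl

variable [IsManifold (𝓡 d) ∞ N]

/-- The transition map between the charts at `x₀` and `x₁`. -/
def transition (x₀ x₁ : N) : EuclideanSpace ℝ (Fin d) → EuclideanSpace ℝ (Fin d) :=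
  chartAt (EuclideanSpace ℝ (Fin d)) x₁ ∘ (chartAt (EuclideanSpace ℝ (Fin d)) x₀).symm

theorem differentiableAt_transition {x₀ x₁ : N} {y : EuclideanSpace ℝ (Fin d)}
    (hy : y ∈ (chartAt (EuclideanSpace ℝ (Fin d)) x₀).target)
    (hy₁ : (chartAt (EuclideanSpace ℝ (Fin d)) x₀).symm y ∈
      (chartAt (EuclideanSpace ℝ (Fin d)) x₁).source) :
    DifferentiableAt ℝ (transition x₀ x₁) y := by
  have h0 : (chartAt (EuclideanSpace ℝ (Fin d)) x₀).MDifferentiable (𝓡 d) (𝓡 d) :=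
    mdifferentiable_chart x₀
  have h1 : (chartAt (EuclideanSpace ℝ (Fin d)) x₁).MDifferentiable (𝓡 d) (𝓡 d) :=
    mdifferentiable_chart x₁
  exact mdifferentiableAt_iff_differentiableAt.1
    ((h1.mdifferentiableAt hy₁).comp y (h0.symm.mdifferentiableAt hy))

theorem chartSymmDeriv_eq_comp {x₀ x₁ : N} {y : EuclideanSpace ℝ (Fin d)}
    (hy : y ∈ (chartAt (EuclideanSpace ℝ (Fin d)) x₀).target)
    (hy₁ : (chartAt (EuclideanSpace ℝ (Fin d)) x₀).symm y ∈
      (chartAt (EuclideanSpace ℝ (Fin d)) x₁).source) (v : EuclideanSpace ℝ (Fin d)) :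
    chartSymmDeriv x₀ y v =
      chartSymmDeriv x₁ (transition x₀ x₁ y) (fderiv ℝ (transition x₀ x₁) y v) := by
  set e₀ := chartAt (EuclideanSpace ℝ (Fin d)) x₀ with he₀
  set e₁ := chartAt (EuclideanSpace ℝ (Fin d)) x₁ with he₁
  have h1 : e₁.MDifferentiable (𝓡 d) (𝓡 d) := mdifferentiable_chart x₁
  have hopen : IsOpen (e₀.target ∩ e₀.symm ⁻¹' e₁.source) :=
    e₀.continuousOn_symm.isOpen_inter_preimage e₀.open_target e₁.open_source
  have heq : e₀.symm =ᶠ[𝓝 y] e₁.symm ∘ transition x₀ x₁ := by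
    filter_upwards [hopen.mem_nhds ⟨hy, hy₁⟩] with z hz
    simp only [transition, Function.comp]
    exact (e₁.left_inv hz.2).symm
  have hτ := differentiableAt_transition (d := d) hy hy₁
  have hty : transition x₀ x₁ y ∈ e₁.target := e₁.mapsTo hy₁
  have h2 : mfderiv (𝓡 d) (𝓡 d) (e₁.symm ∘ transition x₀ x₁) y =
      (mfderiv (𝓡 d) (𝓡 d) e₁.symm (transition x₀ x₁ y)).comp
        (mfderiv (𝓡 d) (𝓡 d) (transition x₀ x₁) y) :=
    mfderiv_comp y (h1.symm.mdifferentiableAt hty) hτ.mdifferentiableAt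
  have h3 : (chartSymmDeriv x₀ y : EuclideanSpace ℝ (Fin d) →L[ℝ] EuclideanSpace ℝ (Fin d)) =
      (chartSymmDeriv x₁ (transition x₀ x₁ y)).comp (fderiv ℝ (transition x₀ x₁) y) := by
    have h4 := heq.mfderiv_eq (I := 𝓡 d) (I' := 𝓡 d)
    have h5 : mfderiv (𝓡 d) (𝓡 d) (transition x₀ x₁) y = fderiv ℝ (transition x₀ x₁) y :=
      mfderiv_eq_fderiv
    rw [h5] at h2
    exact h4.trans h2
  rw [h3]; rfl

/-- The matrix of the derivative of the transition map. -/
def transitionMatrix (x₀ x₁ : N) (y : EuclideanSpace ℝ (Fin d)) : Matrix (Fin d) (Fin d) ℝ :=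
  LinearMap.toMatrix (EuclideanSpace.basisFun (Fin d) ℝ).toBasis
    (EuclideanSpace.basisFun (Fin d) ℝ).toBasis (fderiv ℝ (transition x₀ x₁) y).toLinearMap

/-- The inverse chart at `x₀` is the one at `x₁` composed with the transition map, so the coordinate
fields are related by its Jacobian matrix. Taking determinants, `√det` acquires exactly the factor
of the change of variables formula. -/
theorem gram_eq_transpose_mul_mul {x₀ x₁ : N} {y : EuclideanSpace ℝ (Fin d)}
    (hy : y ∈ (chartAt (EuclideanSpace ℝ (Fin d)) x₀).target)
    (hy₁ : (chartAt (EuclideanSpace ℝ (Fin d)) x₀).symm y ∈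
      (chartAt (EuclideanSpace ℝ (Fin d)) x₁).source) :
    gram x₀ y = (transitionMatrix x₀ x₁ y).transpose * gram x₁ (transition x₀ x₁ y) *
      transitionMatrix x₀ x₁ y := by
  set J := transitionMatrix x₀ x₁ y with hJ
  have hpt : (chartAt (EuclideanSpace ℝ (Fin d)) x₁).symm (transition x₀ x₁ y) =
      (chartAt (EuclideanSpace ℝ (Fin d)) x₀).symm y :=
    (chartAt (EuclideanSpace ℝ (Fin d)) x₁).left_inv hy₁
  have hcol : ∀ i, chartSymmDeriv x₀ y (EuclideanSpace.single i 1) =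
      ∑ k, J k i • chartSymmDeriv x₁ (transition x₀ x₁ y) (EuclideanSpace.single k 1) := by
    intro i
    rw [chartSymmDeriv_eq_comp hy hy₁]
    have h1 : fderiv ℝ (transition x₀ x₁) y (EuclideanSpace.single i 1) =
        ∑ k, J k i • (EuclideanSpace.single k (1 : ℝ) : EuclideanSpace ℝ (Fin d)) := by
      have := (EuclideanSpace.basisFun (Fin d) ℝ).toBasis.sum_repr
        (fderiv ℝ (transition x₀ x₁) y (EuclideanSpace.single i 1))
      rw [← this]
      refine Finset.sum_congr rfl fun k _ => ?_
      simp [hJ, transitionMatrix, LinearMap.toMatrix_apply]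
    rw [h1, map_sum]
    simp only [map_smul]
  ext i j
  rw [gram_apply_eq_metricForm, hcol, hcol, metricForm_sum_sum, ← hpt]
  simp only [Matrix.mul_apply, Matrix.transpose_apply, gram_apply_eq_metricForm, Finset.sum_mul]
  rw [Finset.sum_comm]
  refine Finset.sum_congr rfl fun k _ => Finset.sum_congr rfl fun l _ => ?_
  ring

theorem sqrt_det_gram_eq {x₀ x₁ : N} {y : EuclideanSpace ℝ (Fin d)}
    (hy : y ∈ (chartAt (EuclideanSpace ℝ (Fin d)) x₀).target)
    (hy₁ : (chartAt (EuclideanSpace ℝ (Fin d)) x₀).symm y ∈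
      (chartAt (EuclideanSpace ℝ (Fin d)) x₁).source) :
    √(gram x₀ y).det = |(fderiv ℝ (transition x₀ x₁) y).det| *
      √(gram x₁ (transition x₀ x₁ y)).det := by
  have hdet : (transitionMatrix x₀ x₁ y).det = (fderiv ℝ (transition x₀ x₁) y).det :=
    LinearMap.det_toMatrix _ _
  rw [gram_eq_transpose_mul_mul hy hy₁, Matrix.det_mul, Matrix.det_mul, Matrix.det_transpose, hdet,
    mul_right_comm, ← sq, Real.sqrt_mul (sq_nonneg _), Real.sqrt_sq_eq_abs]

end ChartVolume

/-! ### The Riemannian volume in a chart -/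

section ChartVolumeMeasure
open Filter Topology
open scoped ENNReal

variable {d : ℕ} {N : Type*} [TopologicalSpace N] [ChartedSpace (EuclideanSpace ℝ (Fin d)) N]
  [RiemannianBundle (fun x : N => TangentSpace (𝓡 d) x)]
  [MeasurableSpace N] [BorelSpace N] [IsManifold (𝓡 d) ∞ N]
  [IsContMDiffRiemannianBundle (𝓡 d) ∞ (EuclideanSpace ℝ (Fin d))
    (fun x : N => TangentSpace (𝓡 d) x)]

theorem continuousOn_sqrt_det_gram (x₀ : N) : ContinuousOn (fun y => √(gram x₀ y).det)
    (chartAt (EuclideanSpace ℝ (Fin d)) x₀).target :=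
  (Real.continuous_sqrt.comp (Continuous.matrix_det continuous_id)).comp_continuousOn
    (continuousOn_gram x₀)

theorem sqrt_det_gram_pos (x₀ : N) {y : EuclideanSpace ℝ (Fin d)}
    (hy : y ∈ (chartAt (EuclideanSpace ℝ (Fin d)) x₀).target) : 0 < √(gram x₀ y).det := by
  have h : (gram x₀ y).PosDef :=
    Matrix.posDef_gram_of_linearIndependent (𝕜 := ℝ) (linearIndependent_coordField x₀ hy)
  exact Real.sqrt_pos.2 h.det_pos

theorem aemeasurable_density (x₀ : N) : AEMeasurable (fun y => ENNReal.ofReal √(gram x₀ y).det)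
    (volume.restrict (chartAt (EuclideanSpace ℝ (Fin d)) x₀).target) :=
  ((continuousOn_sqrt_det_gram x₀).aemeasurable
    (chartAt (EuclideanSpace ℝ (Fin d)) x₀).open_target.measurableSet).ennreal_ofReal

theorem lintegral_chartVolume (x₀ : N) {h : N → ℝ≥0∞} (hh : Measurable h) :
    ∫⁻ x, h x ∂(chartVolume (d := d) x₀) =
      ∫⁻ y in (chartAt (EuclideanSpace ℝ (Fin d)) x₀).target,
        ENNReal.ofReal √(gram x₀ y).det * h ((chartAt (EuclideanSpace ℝ (Fin d)) x₀).symm y) := by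
  set e := chartAt (EuclideanSpace ℝ (Fin d)) x₀ with he
  have hmt : MeasurableSet e.target := e.open_target.measurableSet
  have hsm : AEMeasurable e.symm (volume.restrict e.target) := e.continuousOn_symm.aemeasurable hmt
  unfold chartVolume
  rw [lintegral_map' hh.aemeasurable (hsm.mono_ac (withDensity_absolutelyContinuous _ _)),
    lintegral_withDensity_eq_lintegral_mul₀ (f := fun y => ENNReal.ofReal √(gram x₀ y).det)
      (aemeasurable_density x₀) (g := fun y => h (e.symm y)) (hh.comp_aemeasurable hsm)]
  rfl

theorem measurableSet_chart_image (x₀ : N) {A : Set N} (hA : MeasurableSet A)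
    (hAs : A ⊆ (chartAt (EuclideanSpace ℝ (Fin d)) x₀).source) :
    MeasurableSet (chartAt (EuclideanSpace ℝ (Fin d)) x₀ '' A) := by
  set e := chartAt (EuclideanSpace ℝ (Fin d)) x₀ with he
  have h1 : Measurable (e.target.domRestrict e.symm) :=
    (continuousOn_iff_continuous_domRestrict.1 e.continuousOn_symm).measurable
  have h2 := e.open_target.measurableSet.subtype_image (h1 hA)
  rw [e.image_eq_target_inter_inv_preimage hAs]
  convert h2 using 1
  ext y
  constructor
  · rintro ⟨hy, hyA⟩
    exact ⟨⟨y, hy⟩, hyA, rfl⟩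
  · rintro ⟨⟨z, hz⟩, hzA, rfl⟩
    exact ⟨hz, hzA⟩

theorem chartVolume_apply (x₀ : N) {A : Set N} (hA : MeasurableSet A)
    (hAs : A ⊆ (chartAt (EuclideanSpace ℝ (Fin d)) x₀).source) :
    chartVolume (d := d) x₀ A = ∫⁻ y in chartAt (EuclideanSpace ℝ (Fin d)) x₀ '' A,
      ENNReal.ofReal √(gram x₀ y).det := by
  set e := chartAt (EuclideanSpace ℝ (Fin d)) x₀ with he
  have himg : e '' A = e.target ∩ e.symm ⁻¹' A := e.image_eq_target_inter_inv_preimage hAs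
  have hmt : MeasurableSet e.target := e.open_target.measurableSet
  have hmA : MeasurableSet (e.target ∩ e.symm ⁻¹' A) := by
    rw [← himg]; exact measurableSet_chart_image x₀ hA hAs
  rw [← lintegral_indicator_one hA, lintegral_chartVolume x₀ (measurable_one.indicator hA), himg,
    ← Measure.restrict_restrict_of_subset inter_subset_left, ← lintegral_indicator hmA,
    ← he]
  refine setLIntegral_congr_fun hmt fun y hy => ?_
  by_cases h : e.symm y ∈ A
  · rw [indicator_of_mem h, indicator_of_mem (s := e.target ∩ e.symm ⁻¹' A) (And.intro hy h)]; simp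
  · rw [indicator_of_notMem h, indicator_of_notMem fun h' => h h'.2]; simp

/-- The chart volumes agree on overlaps. -/
theorem chartVolume_eq_chartVolume (x₀ x₁ : N) {A : Set N} (hA : MeasurableSet A)
    (h₀ : A ⊆ (chartAt (EuclideanSpace ℝ (Fin d)) x₀).source)
    (h₁ : A ⊆ (chartAt (EuclideanSpace ℝ (Fin d)) x₁).source) :
    chartVolume (d := d) x₀ A = chartVolume (d := d) x₁ A := by
  rw [chartVolume_apply x₀ hA h₀, chartVolume_apply x₁ hA h₁]
  set e₀ := chartAt (EuclideanSpace ℝ (Fin d)) x₀ with he₀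
  set e₁ := chartAt (EuclideanSpace ℝ (Fin d)) x₁ with he₁
  have himg : e₁ '' A = transition x₀ x₁ '' (e₀ '' A) := by
    rw [image_image]
    refine image_congr fun x hx => ?_
    simp only [transition, Function.comp]
    rw [e₀.left_inv (h₀ hx)]
  have hm := measurableSet_chart_image x₀ hA h₀
  have hpt : ∀ y ∈ e₀ '' A, y ∈ e₀.target ∧ e₀.symm y ∈ e₁.source := by
    rintro _ ⟨x, hx, rfl⟩
    exact ⟨e₀.mapsTo (h₀ hx), by rw [e₀.left_inv (h₀ hx)]; exact h₁ hx⟩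
  have hinj : InjOn (transition x₀ x₁) (e₀ '' A) := by
    rintro _ ⟨x, hx, rfl⟩ _ ⟨x', hx', rfl⟩ h
    simp only [transition, Function.comp] at h
    rw [e₀.left_inv (h₀ hx), e₀.left_inv (h₀ hx')] at h
    rw [e₁.injOn (h₁ hx) (h₁ hx') h]
  rw [himg, lintegral_image_eq_lintegral_abs_det_fderiv_mul volume hm
    (fun y hy => (differentiableAt_transition (hpt y hy).1
      (hpt y hy).2).hasFDerivAt.hasFDerivWithinAt) hinj]
  refine setLIntegral_congr_fun hm fun y hy => ?_
  rw [sqrt_det_gram_eq (hpt y hy).1 (hpt y hy).2, ENNReal.ofReal_mul (abs_nonneg _)]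

variable [T2Space N] [CompactSpace N]

theorem tsupport_chartPartition_subset (x₀ : N) : tsupport (chartPartition d N x₀) ⊆
    (chartAt (EuclideanSpace ℝ (Fin d)) x₀).source :=
  Classical.choose_spec (SmoothPartitionOfUnity.exists_isSubordinate_chartAt_source (𝓡 d) N) x₀

variable (d N) in
theorem finite_support_chartPartition :
    {x₀ : N | (Function.support (chartPartition d N x₀)).Nonempty}.Finite :=
  (chartPartition d N).locallyFinite.finite_nonempty_of_compact

variable (d N) in
/-- The finite set of indices of the partition of unity. -/
def partitionIndex : Finset N := (finite_support_chartPartition d N).toFinset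

theorem chartPartition_eq_zero {x₀ : N} (h : x₀ ∉ partitionIndex d N) (x : N) :
    chartPartition d N x₀ x = 0 := by
  simp only [partitionIndex, Set.Finite.mem_toFinset, Set.mem_ofPred_eq,
    Set.not_nonempty_iff_eq_empty, Function.support_eq_empty_iff] at h
  rw [h]; rfl

theorem sum_chartPartition (x : N) : ∑ i ∈ partitionIndex d N, chartPartition d N i x = 1 := by
  rw [← (chartPartition d N).sum_eq_one (mem_univ x)]
  exact (finsum_eq_sum_of_support_subset _ fun i hi => by
    by_contra h
    exact hi (chartPartition_eq_zero h x)).symm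

theorem measurable_chartPartition (i : N) :
    Measurable fun x => ENNReal.ofReal (chartPartition d N i x) :=
  (chartPartition d N i).contMDiff.continuous.measurable.ennreal_ofReal

theorem vol_apply {A : Set N} (hA : MeasurableSet A) : vol d N A =
    ∑ i ∈ partitionIndex d N, ∫⁻ x in A, ENNReal.ofReal (chartPartition d N i x)
      ∂(chartVolume (d := d) i) := by
  rw [vol, Measure.sum_apply _ hA, tsum_eq_sum (s := partitionIndex d N)]
  · exact Finset.sum_congr rfl fun i _ => withDensity_apply _ hA
  · intro i hi
    rw [withDensity_apply _ hA]
    simp [chartPartition_eq_zero hi]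

/-- In the domain of a chart, the volume is given by the Gram determinant of the metric. -/
theorem vol_eq_chartVolume (x₀ : N) {A : Set N} (hA : MeasurableSet A)
    (hAs : A ⊆ (chartAt (EuclideanSpace ℝ (Fin d)) x₀).source) :
    vol d N A = chartVolume (d := d) x₀ A := by
  have hres : ∀ i, (chartVolume (d := d) i).restrict
      (A ∩ (chartAt (EuclideanSpace ℝ (Fin d)) i).source) = (chartVolume (d := d) x₀).restrict
      (A ∩ (chartAt (EuclideanSpace ℝ (Fin d)) i).source) := fun i => by
    have hmi : MeasurableSet (A ∩ (chartAt (EuclideanSpace ℝ (Fin d)) i).source) :=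
      hA.inter (chartAt (EuclideanSpace ℝ (Fin d)) i).open_source.measurableSet
    refine Measure.ext fun B hB => ?_
    rw [Measure.restrict_apply hB, Measure.restrict_apply hB]
    exact chartVolume_eq_chartVolume i x₀ (hB.inter hmi) (fun x hx => hx.2.2)
      fun x hx => hAs hx.2.1
  -- The `i`-th partition function vanishes outside the `i`-th chart, where the volumes of the
  -- charts at `i` and at `x₀` can be exchanged; afterwards the partition functions sum to 1.
  have hrest : ∀ (μ : Measure N) i, ∫⁻ x in A, ENNReal.ofReal (chartPartition d N i x) ∂μ =
      ∫⁻ x in A ∩ (chartAt (EuclideanSpace ℝ (Fin d)) i).source,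
        ENNReal.ofReal (chartPartition d N i x) ∂μ := fun μ i => by
    have hms := (chartAt (EuclideanSpace ℝ (Fin d)) i).open_source.measurableSet
    rw [inter_comm, ← Measure.restrict_restrict hms, ← lintegral_indicator hms]
    refine lintegral_congr fun x => ?_
    by_cases hx : x ∈ (chartAt (EuclideanSpace ℝ (Fin d)) i).source
    · rw [indicator_of_mem hx]
    · rw [indicator_of_notMem hx, image_eq_zero_of_notMem_tsupport
        fun h => hx (tsupport_chartPartition_subset i h), ENNReal.ofReal_zero]
  rw [vol_apply hA]
  calc ∑ i ∈ partitionIndex d N, ∫⁻ x in A, ENNReal.ofReal (chartPartition d N i x)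
        ∂(chartVolume (d := d) i)
      = ∑ i ∈ partitionIndex d N, ∫⁻ x in A, ENNReal.ofReal (chartPartition d N i x)
        ∂(chartVolume (d := d) x₀) :=
        Finset.sum_congr rfl fun i _ => by rw [hrest, hres, ← hrest]
    _ = ∫⁻ x in A, ∑ i ∈ partitionIndex d N, ENNReal.ofReal (chartPartition d N i x)
        ∂(chartVolume (d := d) x₀) :=
        (lintegral_finsetSum _ fun i _ => measurable_chartPartition i).symm
    _ = ∫⁻ _ in A, 1 ∂(chartVolume (d := d) x₀) := by
        refine lintegral_congr fun x => ?_
        rw [← ENNReal.ofReal_sum_of_nonneg fun i _ => (chartPartition d N).nonneg i x,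
          sum_chartPartition, ENNReal.ofReal_one]
    _ = chartVolume (d := d) x₀ A := by simp

theorem setLIntegral_vol (x₀ : N) {A : Set N} (hA : MeasurableSet A)
    (hAs : A ⊆ (chartAt (EuclideanSpace ℝ (Fin d)) x₀).source) {h : N → ℝ≥0∞} (hh : Measurable h) :
    ∫⁻ x in A, h x ∂(vol d N) = ∫⁻ y in chartAt (EuclideanSpace ℝ (Fin d)) x₀ '' A,
      ENNReal.ofReal √(gram x₀ y).det * h ((chartAt (EuclideanSpace ℝ (Fin d)) x₀).symm y) := by
  have hres : (vol d N).restrict A = (chartVolume (d := d) x₀).restrict A := by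
    refine Measure.ext fun B hB => ?_
    rw [Measure.restrict_apply hB, Measure.restrict_apply hB]
    exact vol_eq_chartVolume x₀ (hB.inter hA) (inter_subset_right.trans hAs)
  set e := chartAt (EuclideanSpace ℝ (Fin d)) x₀ with he
  have himg : e '' A = e.target ∩ e.symm ⁻¹' A := e.image_eq_target_inter_inv_preimage hAs
  have hmt : MeasurableSet e.target := e.open_target.measurableSet
  have hmA : MeasurableSet (e.target ∩ e.symm ⁻¹' A) := by
    rw [← himg]; exact measurableSet_chart_image x₀ hA hAs
  rw [hres, ← lintegral_indicator hA, lintegral_chartVolume x₀ (hh.indicator hA), himg,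
    ← Measure.restrict_restrict_of_subset inter_subset_left, ← lintegral_indicator hmA, ← he]
  refine setLIntegral_congr_fun hmt fun y hy => ?_
  by_cases h' : e.symm y ∈ A
  · rw [indicator_of_mem h', indicator_of_mem (s := e.target ∩ e.symm ⁻¹' A) (And.intro hy h')]
  · rw [indicator_of_notMem h', indicator_of_notMem fun h'' => h' h''.2]; simp

/-- On compact subsets of a chart domain, the volume is comparable to Lebesgue measure. -/
theorem exists_setLIntegral_vol_le (x₀ : N) {A : Set N} (hA : IsCompact A)
    (hAs : A ⊆ (chartAt (EuclideanSpace ℝ (Fin d)) x₀).source) :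
    ∃ C : ℝ, 0 < C ∧ ∀ h : N → ℝ≥0∞, Measurable h →
      (∫⁻ x in A, h x ∂(vol d N) ≤ ENNReal.ofReal C *
        ∫⁻ y in chartAt (EuclideanSpace ℝ (Fin d)) x₀ '' A,
          h ((chartAt (EuclideanSpace ℝ (Fin d)) x₀).symm y)) ∧
      ∫⁻ y in chartAt (EuclideanSpace ℝ (Fin d)) x₀ '' A,
          h ((chartAt (EuclideanSpace ℝ (Fin d)) x₀).symm y) ≤
        ENNReal.ofReal C * ∫⁻ x in A, h x ∂(vol d N) := by
  set e := chartAt (EuclideanSpace ℝ (Fin d)) x₀ with he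
  have hc : IsCompact (e '' A) := hA.image_of_continuousOn (e.continuousOn.mono hAs)
  have hct : e '' A ⊆ e.target := (e.mapsTo.mono_left hAs).image_subset
  have hcont := (continuousOn_sqrt_det_gram (d := d) x₀).mono hct
  obtain ⟨C₁, hC₁⟩ := hc.exists_bound_of_continuousOn hcont
  obtain ⟨C₂, hC₂⟩ := hc.exists_bound_of_continuousOn
    (hcont.inv₀ fun y hy => (sqrt_det_gram_pos x₀ (hct hy)).ne')
  refine ⟨max 1 (max C₁ C₂), lt_max_of_lt_left one_pos, fun h hh => ?_⟩
  rw [setLIntegral_vol x₀ hA.measurableSet hAs hh, ← he]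
  have hm := hc.measurableSet
  constructor
  · rw [← lintegral_const_mul' _ _ ENNReal.ofReal_ne_top]
    refine setLIntegral_mono' hm fun y hy => mul_le_mul_left (ENNReal.ofReal_le_ofReal ?_) _
    exact (le_abs_self _).trans ((hC₁ y hy).trans ((le_max_left _ _).trans (le_max_right _ _)))
  · rw [← lintegral_const_mul' _ _ ENNReal.ofReal_ne_top]
    refine setLIntegral_mono' hm fun y hy => ?_
    have hpos := sqrt_det_gram_pos x₀ (hct hy)
    rw [← mul_assoc, ← ENNReal.ofReal_mul (by positivity)]
    refine le_mul_of_one_le_left' ?_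
    rw [ENNReal.one_le_ofReal]
    have h1 := hC₂ y hy
    rw [Pi.inv_apply, norm_inv, Real.norm_eq_abs, abs_of_pos hpos] at h1
    have h2 : (√(gram x₀ y).det)⁻¹ ≤ max 1 (max C₁ C₂) :=
      h1.trans ((le_max_right _ _).trans (le_max_right _ _))
    rwa [inv_le_iff_one_le_mul₀ hpos] at h2

variable (d N) in
theorem vol_univ_pos [Nonempty N] : 0 < (vol d N).real univ := by
  obtain ⟨x₀⟩ := ‹Nonempty N›
  set e := chartAt (EuclideanSpace ℝ (Fin d)) x₀ with he
  refine ENNReal.toReal_pos ?_ (measure_ne_top _ _)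
  have h1 : 0 < vol d N e.source := by
    rw [vol_eq_chartVolume x₀ e.open_source.measurableSet subset_rfl,
      chartVolume_apply x₀ e.open_source.measurableSet subset_rfl, ← he, e.image_source_eq_target,
      pos_iff_ne_zero, Ne, lintegral_eq_zero_iff' (aemeasurable_density x₀)]
    intro h0
    have h2 : ∀ᵐ y ∂(volume.restrict e.target), False := by
      filter_upwards [h0, ae_restrict_mem e.open_target.measurableSet] with y hy hyt
      have := sqrt_det_gram_pos x₀ hyt
      simp only [Pi.zero_apply, ENNReal.ofReal_eq_zero] at hy
      linarith
    rw [ae_iff] at h2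
    simp only [not_false_eq_true, ofPred_true, Measure.restrict_apply_univ] at h2
    exact (e.open_target.measure_pos volume ⟨e x₀, e.mapsTo (mem_chart_source _ x₀)⟩).ne' h2
  exact (h1.trans_le (measure_mono (subset_univ _))).ne'

end ChartVolumeMeasure

/-! ### Localization in charts and the Sobolev inequality with exponent 1 -/

section Localization
open Filter Topology
open scoped ENNReal

theorem norm_le_sum_norm_apply_single {d : ℕ} {F : Type*} [NormedAddCommGroup F] [NormedSpace ℝ F]
    (L : EuclideanSpace ℝ (Fin d) →L[ℝ] F) : ‖L‖ ≤ ∑ i, ‖L (EuclideanSpace.single i 1)‖ := by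
  refine L.opNorm_le_bound (Finset.sum_nonneg fun _ _ => norm_nonneg _) fun y => ?_
  have hy : y = ∑ i, y i • (EuclideanSpace.single i (1 : ℝ) : EuclideanSpace ℝ (Fin d)) := by
    have := (EuclideanSpace.basisFun (Fin d) ℝ).toBasis.sum_repr y
    simpa using this.symm
  conv_lhs => rw [hy]
  rw [map_sum, Finset.sum_mul]
  refine (norm_sum_le _ _).trans (Finset.sum_le_sum fun i _ => ?_)
  rw [map_smul, norm_smul, mul_comm]
  exact mul_le_mul_of_nonneg_left (PiLp.norm_apply_le y i) (norm_nonneg _)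

variable {d : ℕ} {N : Type*} [TopologicalSpace N] [ChartedSpace (EuclideanSpace ℝ (Fin d)) N]

/-- The expression of a function in the chart at `x₀`, extended by zero. -/
def chartExpr (x₀ : N) (v : N → ℝ) : EuclideanSpace ℝ (Fin d) → ℝ :=
  (chartAt (EuclideanSpace ℝ (Fin d)) x₀).target.indicator
    fun y => v ((chartAt (EuclideanSpace ℝ (Fin d)) x₀).symm y)

variable [RiemannianBundle (fun x : N => TangentSpace (𝓡 d) x)]
  [MeasurableSpace N] [BorelSpace N] [IsManifold (𝓡 d) ∞ N]
  [IsContMDiffRiemannianBundle (𝓡 d) ∞ (EuclideanSpace ℝ (Fin d))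
    (fun x : N => TangentSpace (𝓡 d) x)]

theorem chartExpr_of_mem {x₀ : N} {v : N → ℝ} {y : EuclideanSpace ℝ (Fin d)}
    (hy : y ∈ (chartAt (EuclideanSpace ℝ (Fin d)) x₀).target) :
    chartExpr x₀ v y = v ((chartAt (EuclideanSpace ℝ (Fin d)) x₀).symm y) := indicator_of_mem hy _

theorem chartExpr_eq_zero {x₀ : N} {v : N → ℝ} {A : Set N} (hv : ∀ x ∉ A, v x = 0)
    {y : EuclideanSpace ℝ (Fin d)} (hy : y ∉ chartAt (EuclideanSpace ℝ (Fin d)) x₀ '' A) :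
    chartExpr x₀ v y = 0 := by
  by_cases h : y ∈ (chartAt (EuclideanSpace ℝ (Fin d)) x₀).target
  · rw [chartExpr_of_mem h]
    refine hv _ fun h' => hy ⟨_, h', OpenPartialHomeomorph.right_inv _ h⟩
  · exact indicator_of_notMem h _

theorem contDiffAt_comp_chart_symm (v : SmoothFn d N) {x₀ : N} {y : EuclideanSpace ℝ (Fin d)}
    (hy : y ∈ (chartAt (EuclideanSpace ℝ (Fin d)) x₀).target) :
    ContDiffAt ℝ ∞ (fun y => v.toFun ((chartAt (EuclideanSpace ℝ (Fin d)) x₀).symm y)) y := by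
  have h1 : ContMDiffOn (𝓡 d) (𝓡 d) ∞ (chartAt (EuclideanSpace ℝ (Fin d)) x₀).symm
    (chartAt (EuclideanSpace ℝ (Fin d)) x₀).target := contMDiffOn_chart_symm
  have h2 : ContDiffOn ℝ ∞ (v.toFun ∘ (chartAt (EuclideanSpace ℝ (Fin d)) x₀).symm)
      (chartAt (EuclideanSpace ℝ (Fin d)) x₀).target :=
    contMDiffOn_iff_contDiffOn.1 (v.contMDiff.comp_contMDiffOn h1)
  exact h2.contDiffAt ((chartAt (EuclideanSpace ℝ (Fin d)) x₀).open_target.mem_nhds hy)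

theorem chartExpr_eventuallyEq (v : N → ℝ) {x₀ : N} {y : EuclideanSpace ℝ (Fin d)}
    (hy : y ∈ (chartAt (EuclideanSpace ℝ (Fin d)) x₀).target) :
    chartExpr x₀ v =ᶠ[𝓝 y] fun y => v ((chartAt (EuclideanSpace ℝ (Fin d)) x₀).symm y) := by
  filter_upwards [(chartAt (EuclideanSpace ℝ (Fin d)) x₀).open_target.mem_nhds hy] with z hz
  exact chartExpr_of_mem hz

variable {x₀ : N} {A : Set N}

theorem isCompact_chart_image (hA : IsCompact A)
    (hAs : A ⊆ (chartAt (EuclideanSpace ℝ (Fin d)) x₀).source) :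
    IsCompact (chartAt (EuclideanSpace ℝ (Fin d)) x₀ '' A) :=
  hA.image_of_continuousOn ((chartAt (EuclideanSpace ℝ (Fin d)) x₀).continuousOn.mono hAs)

theorem chartExpr_eventuallyEq_zero (hA : IsCompact A)
    (hAs : A ⊆ (chartAt (EuclideanSpace ℝ (Fin d)) x₀).source) {v : N → ℝ} (hv : ∀ x ∉ A, v x = 0)
    {y : EuclideanSpace ℝ (Fin d)} (hy : y ∉ chartAt (EuclideanSpace ℝ (Fin d)) x₀ '' A) :
    chartExpr x₀ v =ᶠ[𝓝 y] fun _ => 0 := by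
  filter_upwards [(isCompact_chart_image hA hAs).isClosed.isOpen_compl.mem_nhds hy] with z hz
  exact chartExpr_eq_zero hv hz

theorem hasCompactSupport_chartExpr (hA : IsCompact A)
    (hAs : A ⊆ (chartAt (EuclideanSpace ℝ (Fin d)) x₀).source) {v : N → ℝ} (hv : ∀ x ∉ A, v x = 0) :
    HasCompactSupport (chartExpr (d := d) x₀ v) :=
  HasCompactSupport.intro (isCompact_chart_image hA hAs) fun _ hy => chartExpr_eq_zero hv hy

theorem contDiff_chartExpr (hA : IsCompact A)
    (hAs : A ⊆ (chartAt (EuclideanSpace ℝ (Fin d)) x₀).source) {v : SmoothFn d N}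
    (hv : ∀ x ∉ A, v.toFun x = 0) : ContDiff ℝ ∞ (chartExpr (d := d) x₀ v.toFun) := by
  rw [contDiff_iff_contDiffAt]
  intro y
  by_cases hy : y ∈ chartAt (EuclideanSpace ℝ (Fin d)) x₀ '' A
  · have hyt := (OpenPartialHomeomorph.mapsTo _).mono_left hAs |>.image_subset hy
    exact (contDiffAt_comp_chart_symm v hyt).congr_of_eventuallyEq
      (chartExpr_eventuallyEq _ hyt)
  · exact contDiffAt_const.congr_of_eventuallyEq (chartExpr_eventuallyEq_zero hA hAs hv hy)

theorem fderiv_comp_chart_symm_apply (v : SmoothFn d N) {y : EuclideanSpace ℝ (Fin d)}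
    (hy : y ∈ (chartAt (EuclideanSpace ℝ (Fin d)) x₀).target) (i : Fin d) :
    fderiv ℝ (fun y => v.toFun ((chartAt (EuclideanSpace ℝ (Fin d)) x₀).symm y)) y
      (EuclideanSpace.single i 1) =
      inner ℝ (grad (d := d) v.toFun ((chartAt (EuclideanSpace ℝ (Fin d)) x₀).symm y))
        (coordField x₀ i y) := by
  have hc : (chartAt (EuclideanSpace ℝ (Fin d)) x₀).MDifferentiable (𝓡 d) (𝓡 d) :=
    mdifferentiable_chart x₀
  have h4 : fderiv ℝ (v.toFun ∘ (chartAt (EuclideanSpace ℝ (Fin d)) x₀).symm) y =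
      (mfderiv (𝓡 d) 𝓘(ℝ, ℝ) v.toFun ((chartAt (EuclideanSpace ℝ (Fin d)) x₀).symm y)).comp
        (mfderiv (𝓡 d) (𝓡 d) (chartAt (EuclideanSpace ℝ (Fin d)) x₀).symm y) := by
    rw [← mfderiv_comp y (v.mdifferentiableAt _) (hc.symm.mdifferentiableAt hy), mfderiv_eq_fderiv]
  refine Eq.trans ?_ (inner_grad_coordField v.toFun x₀ i y).symm
  change fderiv ℝ (v.toFun ∘ (chartAt (EuclideanSpace ℝ (Fin d)) x₀).symm) y _ = _
  rw [h4]
  rfl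

/-- The partial derivatives are the inner products of the gradient with the coordinate fields, whose
lengths `√(gram x₀ y i i)` are bounded on compact sets. -/
theorem exists_norm_fderiv_chartExpr_le (hA : IsCompact A)
    (hAs : A ⊆ (chartAt (EuclideanSpace ℝ (Fin d)) x₀).source) :
    ∃ C : ℝ, 0 < C ∧ ∀ v : SmoothFn d N, ∀ y ∈ chartAt (EuclideanSpace ℝ (Fin d)) x₀ '' A,
      ‖fderiv ℝ (chartExpr (d := d) x₀ v.toFun) y‖ ≤
        C * ‖grad (d := d) v.toFun ((chartAt (EuclideanSpace ℝ (Fin d)) x₀).symm y)‖ := by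
  have hct := ((OpenPartialHomeomorph.mapsTo (chartAt (EuclideanSpace ℝ (Fin d)) x₀)).mono_left
    hAs).image_subset
  have hcont : ContinuousOn (fun y => ∑ i, √(gram x₀ y i i))
      (chartAt (EuclideanSpace ℝ (Fin d)) x₀ '' A) := by
    refine continuousOn_finsetSum _ fun i _ => Real.continuous_sqrt.comp_continuousOn ?_
    exact continuousOn_pi.1 (continuousOn_pi.1 ((continuousOn_gram x₀).mono hct) i) i
  obtain ⟨C, hC⟩ := (isCompact_chart_image hA hAs).exists_bound_of_continuousOn hcont
  refine ⟨max C 1, lt_max_of_lt_right one_pos, fun v y hy => ?_⟩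
  have hyt := hct hy
  rw [(chartExpr_eventuallyEq v.toFun hyt).fderiv_eq]
  refine (norm_le_sum_norm_apply_single _).trans ?_
  have h1 : ∀ i, ‖fderiv ℝ (fun y => v.toFun ((chartAt (EuclideanSpace ℝ (Fin d)) x₀).symm y)) y
      (EuclideanSpace.single i 1)‖ ≤
      ‖grad (d := d) v.toFun ((chartAt (EuclideanSpace ℝ (Fin d)) x₀).symm y)‖ *
        √(gram x₀ y i i) := fun i => by
    rw [fderiv_comp_chart_symm_apply v hyt]
    refine (norm_inner_le_norm _ _).trans (mul_le_mul_of_nonneg_left (le_of_eq ?_) (norm_nonneg _))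
    rw [norm_eq_sqrt_real_inner]; rfl
  refine (Finset.sum_le_sum fun i _ => h1 i).trans ?_
  rw [← Finset.mul_sum, mul_comm]
  refine mul_le_mul_of_nonneg_right ?_ (norm_nonneg _)
  exact (le_abs_self _).trans ((hC y hy).trans (le_max_left _ _))

theorem fderiv_chartExpr_eq_zero (hA : IsCompact A)
    (hAs : A ⊆ (chartAt (EuclideanSpace ℝ (Fin d)) x₀).source) {v : N → ℝ} (hv : ∀ x ∉ A, v x = 0)
    {y : EuclideanSpace ℝ (Fin d)} (hy : y ∉ chartAt (EuclideanSpace ℝ (Fin d)) x₀ '' A) :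
    fderiv ℝ (chartExpr (d := d) x₀ v) y = 0 := by
  rw [(chartExpr_eventuallyEq_zero hA hAs hv hy).fderiv_eq]; simp

variable [T2Space N] [CompactSpace N]

/-- The dictionary between `N` and Euclidean space for functions supported in a compact part of a
chart. The constant does not depend on the exponent `q`; the values 1, 2 and `d / (d - 1)` are used.
-/
theorem exists_lintegral_chartExpr_le (hA : IsCompact A)
    (hAs : A ⊆ (chartAt (EuclideanSpace ℝ (Fin d)) x₀).source) :
    ∃ C : ℝ, 0 < C ∧ ∀ v : SmoothFn d N, (∀ x ∉ A, v.toFun x = 0) → ∀ q : ℝ, 0 < q →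
      (∫⁻ x, ‖v.toFun x‖ₑ ^ q ∂(vol d N) ≤
        ENNReal.ofReal C * ∫⁻ y, ‖chartExpr (d := d) x₀ v.toFun y‖ₑ ^ q) ∧
      (∫⁻ y, ‖chartExpr (d := d) x₀ v.toFun y‖ₑ ^ q ≤
        ENNReal.ofReal C * ∫⁻ x, ‖v.toFun x‖ₑ ^ q ∂(vol d N)) ∧
      ∫⁻ y, ‖fderiv ℝ (chartExpr (d := d) x₀ v.toFun) y‖ₑ ^ q ≤
        ENNReal.ofReal C * ∫⁻ x, (ENNReal.ofReal (C * ‖grad (d := d) v.toFun x‖)) ^ q ∂(vol d N) := by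
  obtain ⟨C₁, hC₁, h₁⟩ := exists_setLIntegral_vol_le x₀ hA hAs
  obtain ⟨C₂, hC₂, h₂⟩ := exists_norm_fderiv_chartExpr_le hA hAs
  have hm := (isCompact_chart_image hA hAs).measurableSet
  have hct := ((OpenPartialHomeomorph.mapsTo (chartAt (EuclideanSpace ℝ (Fin d)) x₀)).mono_left
    hAs).image_subset
  have hext : ∀ (ν : Measure (EuclideanSpace ℝ (Fin d))) (h : EuclideanSpace ℝ (Fin d) → ℝ≥0∞),
      (∀ y ∉ chartAt (EuclideanSpace ℝ (Fin d)) x₀ '' A, h y = 0) →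
      ∫⁻ y, h y ∂ν = ∫⁻ y in chartAt (EuclideanSpace ℝ (Fin d)) x₀ '' A, h y ∂ν := fun ν h hh => by
    refine (setLIntegral_eq_of_support_subset fun y hy => ?_).symm
    by_contra hcon
    exact hy (hh y hcon)
  have hC1 : ENNReal.ofReal C₁ ≤ ENNReal.ofReal (max C₁ C₂) :=
    ENNReal.ofReal_le_ofReal (le_max_left _ _)
  refine ⟨max C₁ C₂, lt_max_of_lt_left hC₁, fun v hv q hq => ⟨?_, ?_, ?_⟩⟩
  · have h3 := (h₁ (fun x => ‖v.toFun x‖ₑ ^ q)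
      (v.contMDiff.continuous.enorm.measurable.pow_const q)).1
    have e1 : ∫⁻ x, ‖v.toFun x‖ₑ ^ q ∂(vol d N) = ∫⁻ x in A, ‖v.toFun x‖ₑ ^ q ∂(vol d N) := by
      refine (setLIntegral_eq_of_support_subset fun x hx => ?_).symm
      by_contra hcon
      exact hx (by simp [hv x hcon, hq])
    rw [e1]
    refine h3.trans (mul_le_mul' hC1 ?_)
    rw [hext volume _ fun y hy => by rw [chartExpr_eq_zero hv hy]; simp [hq]]
    exact (setLIntegral_congr_fun hm fun y hy => by
      simp only [chartExpr_of_mem (hct hy)]).le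
  · have h3 := (h₁ (fun x => ‖v.toFun x‖ₑ ^ q)
      (v.contMDiff.continuous.enorm.measurable.pow_const q)).2
    rw [hext volume _ fun y hy => by rw [chartExpr_eq_zero hv hy]; simp [hq]]
    refine le_trans (le_of_eq ?_) (h3.trans (mul_le_mul' hC1 (setLIntegral_le_lintegral _ _)))
    exact setLIntegral_congr_fun hm fun y hy => by simp only [chartExpr_of_mem (hct hy)]
  · have h3 := (h₁ (fun x => (ENNReal.ofReal (max C₁ C₂ * ‖grad (d := d) v.toFun x‖)) ^ q)
      (((continuous_norm_grad v).const_mul _).measurable.ennreal_ofReal.pow_const q)).2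
    rw [hext volume _ fun y hy => by
      rw [fderiv_chartExpr_eq_zero hA hAs hv hy, ← ofReal_norm,
        norm_zero, ENNReal.ofReal_zero, ENNReal.zero_rpow_of_pos hq]]
    refine le_trans (setLIntegral_mono' hm fun y hy => ?_)
      (h3.trans (mul_le_mul' hC1 (setLIntegral_le_lintegral _ _)))
    refine ENNReal.rpow_le_rpow ?_ hq.le
    rw [← ofReal_norm]
    refine ENNReal.ofReal_le_ofReal ((h₂ v y hy).trans ?_)
    exact mul_le_mul_of_nonneg_right (le_max_right _ _) (norm_nonneg _)

/-- The members of the partition of unity as smooth functions. -/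
def partitionFn (i : N) : SmoothFn d N :=
  SmoothFn.mk (chartPartition d N i) (chartPartition d N i).contMDiff

/-- The product of a smooth function and a member of the partition of unity. -/
def localize (i : N) (u : SmoothFn d N) : SmoothFn d N :=
  SmoothFn.mk (fun x => chartPartition d N i x * u.toFun x)
    ((chartPartition d N i).contMDiff.mul u.contMDiff)

theorem localize_apply (i : N) (u : SmoothFn d N) (x : N) :
    (localize i u).toFun x = chartPartition d N i x * u.toFun x := rfl

theorem localize_eq_zero (i : N) (u : SmoothFn d N) {x : N}
    (hx : x ∉ tsupport (chartPartition d N i)) : (localize i u).toFun x = 0 := by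
  rw [localize_apply, image_eq_zero_of_notMem_tsupport hx, zero_mul]

theorem sum_localize_apply (u : SmoothFn d N) (x : N) :
    ∑ i ∈ partitionIndex d N, (localize i u).toFun x = u.toFun x := by
  simp only [localize_apply, ← Finset.sum_mul, sum_chartPartition, one_mul]

theorem exists_norm_grad_localize_le (i : N) : ∃ C : ℝ, 0 < C ∧ ∀ (u : SmoothFn d N) (x : N),
    ‖grad (d := d) (localize i u).toFun x‖ ≤ C * (‖grad (d := d) u.toFun x‖ + |u.toFun x|) := by
  obtain ⟨C, hC⟩ := (isCompact_univ (X := N)).exists_bound_of_continuousOn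
    (continuous_norm_grad (partitionFn (d := d) i)).continuousOn
  refine ⟨max C 1, lt_max_of_lt_right one_pos, fun u x => ?_⟩
  have e : grad (d := d) (localize i u).toFun x = (partitionFn (d := d) i).toFun x •
      grad (d := d) u.toFun x + u.toFun x • grad (d := d) (partitionFn (d := d) i).toFun x :=
    grad_mul ((partitionFn (d := d) i).mdifferentiableAt x) (u.mdifferentiableAt x)
  rw [e]
  refine (norm_add_le _ _).trans ?_
  rw [norm_smul, norm_smul, mul_add, Real.norm_eq_abs, Real.norm_eq_abs, mul_comm |u.toFun x|]
  have h1 : |(partitionFn (d := d) i).toFun x| ≤ 1 := by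
    change |chartPartition d N i x| ≤ 1
    rw [abs_of_nonneg ((chartPartition d N).nonneg i x)]
    exact (chartPartition d N).le_one i x
  have h2 := hC x (mem_univ x)
  rw [norm_norm] at h2
  exact add_le_add (mul_le_mul_of_nonneg_right (h1.trans (le_max_right _ _)) (norm_nonneg _))
    (mul_le_mul_of_nonneg_right (h2.trans (le_max_left _ _)) (abs_nonneg _))

/-- The Sobolev inequality for the exponent `1`. -/
theorem exists_eLpNorm_le_lintegral_grad (hd : 2 ≤ d) :
    ∃ C : ℝ, 0 < C ∧ ∀ u : SmoothFn d N,
      eLpNorm u.toFun (ENNReal.ofReal (d / (d - 1))) (vol d N) ≤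
        ENNReal.ofReal C * ∫⁻ x, ENNReal.ofReal (‖grad (d := d) u.toFun x‖ + |u.toFun x|)
          ∂(vol d N) := by
  have hd1 : (1 : ℝ) < d := by exact_mod_cast hd
  set p : ℝ := d / (d - 1) with hp
  have hp1 : 1 < p := by rw [hp, one_lt_div (by linarith)]; linarith
  have hp0 : 0 < p := by linarith
  -- The exponent `d / (d - 1)` is conjugate to the dimension, as in the Gagliardo-Nirenberg-Sobolev
  -- inequality.
  have hconj : Real.HolderConjugate (Module.finrank ℝ (EuclideanSpace ℝ (Fin d))) p := by
    rw [finrank_euclideanSpace_fin]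
    exact Real.HolderConjugate.conjExponent hd1
  have hpt : ENNReal.ofReal p ≠ ⊤ := ENNReal.ofReal_ne_top
  have hp0' : ENNReal.ofReal p ≠ 0 := by simpa using hp0
  have hloc : ∀ i : N, ∃ C : ℝ, 0 < C ∧ ∀ u : SmoothFn d N,
      eLpNorm (localize i u).toFun (ENNReal.ofReal p) (vol d N) ≤ ENNReal.ofReal C *
        ∫⁻ x, ENNReal.ofReal (‖grad (d := d) u.toFun x‖ + |u.toFun x|) ∂(vol d N) := by
    intro i
    have hA : IsCompact (tsupport (chartPartition d N i)) := (isClosed_tsupport _).isCompact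
    have hAs := tsupport_chartPartition_subset (d := d) i
    obtain ⟨C₁, hC₁, h₁⟩ := exists_lintegral_chartExpr_le hA hAs
    obtain ⟨C₂, hC₂, h₂⟩ := exists_norm_grad_localize_le (d := d) i
    set S := lintegralPowLePowLIntegralFDerivConst
      (volume : Measure (EuclideanSpace ℝ (Fin d))) p with hS
    refine ⟨C₁ ^ p⁻¹ * (S : ℝ) ^ p⁻¹ * C₁ * (C₁ * C₂) + 1, by positivity, fun u => ?_⟩
    obtain ⟨k1, -, -⟩ := h₁ (localize i u) (fun x hx => localize_eq_zero i u hx) p hp0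
    obtain ⟨-, -, k3⟩ := h₁ (localize i u) (fun x hx => localize_eq_zero i u hx) 1 one_pos
    have k2 := lintegral_pow_le_pow_lintegral_fderiv volume
      ((contDiff_chartExpr hA hAs (v := localize i u)
        fun x hx => localize_eq_zero i u hx).of_le (by simp))
      (hasCompactSupport_chartExpr hA hAs fun x hx => localize_eq_zero i u hx) hconj
    simp only [ENNReal.rpow_one] at k3
    have k4 : ∫⁻ x, ENNReal.ofReal (C₁ * ‖grad (d := d) (localize i u).toFun x‖) ∂(vol d N) ≤
        ENNReal.ofReal (C₁ * C₂) *
          ∫⁻ x, ENNReal.ofReal (‖grad (d := d) u.toFun x‖ + |u.toFun x|) ∂(vol d N) := by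
      rw [← lintegral_const_mul' _ _ ENNReal.ofReal_ne_top]
      refine lintegral_mono fun x => ?_
      rw [← ENNReal.ofReal_mul (by positivity), mul_assoc]
      exact ENNReal.ofReal_le_ofReal (mul_le_mul_of_nonneg_left (h₂ u x) hC₁.le)
    rw [eLpNorm_eq_lintegral_rpow_enorm_toReal hp0' hpt, ENNReal.toReal_ofReal hp0.le, one_div]
    set I := ∫⁻ x, ENNReal.ofReal (‖grad (d := d) u.toFun x‖ + |u.toFun x|) ∂(vol d N) with hI
    calc (∫⁻ x, ‖(localize i u).toFun x‖ₑ ^ p ∂(vol d N)) ^ p⁻¹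
        ≤ (ENNReal.ofReal C₁ * (S * (ENNReal.ofReal C₁ * (ENNReal.ofReal (C₁ * C₂) * I)) ^ p)) ^ p⁻¹ := by
          refine ENNReal.rpow_le_rpow (k1.trans (mul_le_mul_right (k2.trans
            (mul_le_mul_right (ENNReal.rpow_le_rpow (k3.trans (mul_le_mul_right k4 _))
              hp0.le) _)) _)) (inv_pos.2 hp0).le
      _ = ENNReal.ofReal (C₁ ^ p⁻¹ * (S : ℝ) ^ p⁻¹ * C₁ * (C₁ * C₂)) * I := by
          have hc : ENNReal.ofReal (C₁ ^ p⁻¹ * (S : ℝ) ^ p⁻¹ * C₁ * (C₁ * C₂)) =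
              ENNReal.ofReal C₁ ^ p⁻¹ * (S : ℝ≥0∞) ^ p⁻¹ * ENNReal.ofReal C₁ *
                ENNReal.ofReal (C₁ * C₂) := by
            rw [ENNReal.ofReal_mul (p := C₁ ^ p⁻¹ * (S : ℝ) ^ p⁻¹ * C₁) (by positivity),
              ENNReal.ofReal_mul (p := C₁ ^ p⁻¹ * (S : ℝ) ^ p⁻¹) (by positivity),
              ENNReal.ofReal_mul (p := C₁ ^ p⁻¹) (by positivity), ENNReal.ofReal_rpow_of_pos hC₁,
              ← ENNReal.ofReal_rpow_of_nonneg (NNReal.coe_nonneg S) (inv_pos.2 hp0).le,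
              ENNReal.ofReal_coe_nnreal]
          rw [hc, ENNReal.mul_rpow_of_nonneg _ _ (inv_pos.2 hp0).le,
            ENNReal.mul_rpow_of_nonneg _ _ (inv_pos.2 hp0).le, ENNReal.rpow_rpow_inv hp0.ne']
          ring
      _ ≤ _ := mul_le_mul_left (ENNReal.ofReal_le_ofReal (by linarith)) _
  choose C hC hCu using hloc
  refine ⟨∑ i ∈ partitionIndex d N, C i + 1, by
    have := Finset.sum_nonneg fun i (_ : i ∈ partitionIndex d N) => (hC i).le
    linarith, fun u => ?_⟩
  -- Sum the local inequalities. The term `|u|` on the right comes from differentiating the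
  -- partition of unity.
  have e : u.toFun = ∑ i ∈ partitionIndex d N, (localize i u).toFun := by
    funext x; rw [Finset.sum_apply, sum_localize_apply]
  conv_lhs => rw [e]
  refine (eLpNorm_sum_le (fun i _ => (localize i u).contMDiff.continuous.aestronglyMeasurable)
    (by rw [← ENNReal.ofReal_one]; exact ENNReal.ofReal_le_ofReal hp1.le)).trans ?_
  refine (Finset.sum_le_sum fun i _ => hCu i u).trans ?_
  rw [← Finset.sum_mul, ← ENNReal.ofReal_sum_of_nonneg fun i _ => (hC i).le]
  exact mul_le_mul_left (ENNReal.ofReal_le_ofReal (by linarith)) _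

end Localization

/-! ### A Poincaré type inequality in Euclidean space -/

section EuclideanPoincare
open Filter Topology
open scoped ENNReal

theorem sq_integral_le_integral_sq {f : ℝ → ℝ} (hf : Continuous f) :
    (∫ t in (0 : ℝ)..1, f t) ^ 2 ≤ ∫ t in (0 : ℝ)..1, f t ^ 2 := by
  set m := ∫ t in (0 : ℝ)..1, f t with hm
  have h0 : 0 ≤ ∫ t in (0 : ℝ)..1, (f t - m) ^ 2 :=
    intervalIntegral.integral_nonneg zero_le_one fun _ _ => sq_nonneg _
  have h1 : ∫ t in (0 : ℝ)..1, (f t - m) ^ 2 =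
      (∫ t in (0 : ℝ)..1, f t ^ 2) - 2 * m * (∫ t in (0 : ℝ)..1, f t) + m ^ 2 := by
    have e : ∀ t, (f t - m) ^ 2 = (f t ^ 2 - 2 * m * f t) + m ^ 2 := fun t => by ring
    simp only [e]
    rw [intervalIntegral.integral_add, intervalIntegral.integral_sub,
      intervalIntegral.integral_const_mul]
    · simp
    all_goals exact Continuous.intervalIntegrable (by fun_prop) _ _
  rw [h1, ← hm] at h0
  nlinarith

variable {E : Type*} [NormedAddCommGroup E] [NormedSpace ℝ E]

theorem enorm_sub_sq_le_lintegral {w : E → ℝ} (hw : ContDiff ℝ 1 w) (x ζ : E) :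
    ‖w (x + ζ) - w x‖ₑ ^ (2 : ℝ) ≤
      ‖ζ‖ₑ ^ (2 : ℝ) * ∫⁻ t in Ioc (0 : ℝ) 1, ‖fderiv ℝ w (x + t • ζ)‖ₑ ^ (2 : ℝ) := by
  have hc : Continuous fun t : ℝ => fderiv ℝ w (x + t • ζ) :=
    (hw.continuous_fderiv one_ne_zero).comp (by fun_prop)
  have hd : ∀ t : ℝ, HasDerivAt (fun t : ℝ => w (x + t • ζ)) (fderiv ℝ w (x + t • ζ) ζ) t := by
    intro t
    have h1 : HasDerivAt (fun t : ℝ => x + t • ζ) ζ t := by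
      simpa using ((hasDerivAt_id t).smul_const ζ).const_add x
    exact ((hw.differentiable one_ne_zero) _).hasFDerivAt.comp_hasDerivAt t h1
  have h1 := intervalIntegral.integral_eq_sub_of_hasDerivAt (a := 0) (b := 1)
    (fun t _ => hd t) ((hc.clm_apply continuous_const).intervalIntegrable _ _)
  simp only [one_smul, zero_smul, add_zero] at h1
  have h2 : (w (x + ζ) - w x) ^ 2 ≤ ‖ζ‖ ^ 2 * ∫ t in (0 : ℝ)..1, ‖fderiv ℝ w (x + t • ζ)‖ ^ 2 := by
    rw [← h1]
    refine (sq_integral_le_integral_sq (hc.clm_apply continuous_const)).trans ?_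
    rw [← intervalIntegral.integral_const_mul]
    refine intervalIntegral.integral_mono_on zero_le_one
      (((hc.clm_apply continuous_const).pow 2).intervalIntegrable _ _)
      ((continuous_const.mul (hc.norm.pow 2)).intervalIntegrable _ _) fun t _ => ?_
    rw [← mul_pow, ← sq_abs, mul_comm]
    exact pow_le_pow_left₀ (abs_nonneg _) ((fderiv ℝ w (x + t • ζ)).le_opNorm ζ) 2
  rw [intervalIntegral.integral_of_le zero_le_one] at h2
  have h3 : ENNReal.ofReal (∫ t in Ioc (0 : ℝ) 1, ‖fderiv ℝ w (x + t • ζ)‖ ^ 2) =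
      ∫⁻ t in Ioc (0 : ℝ) 1, ‖fderiv ℝ w (x + t • ζ)‖ₑ ^ (2 : ℝ) := by
    rw [ofReal_integral_eq_lintegral_ofReal]
    · refine lintegral_congr fun t => ?_
      rw [ENNReal.ofReal_pow (norm_nonneg _), ofReal_norm, ENNReal.rpow_two]
    · exact ((hc.norm.pow 2).integrableOn_Icc).mono_set Ioc_subset_Icc_self
    · exact Eventually.of_forall fun t => sq_nonneg _
  have h4 := ENNReal.ofReal_le_ofReal h2
  rw [ENNReal.ofReal_mul (sq_nonneg _), h3, ENNReal.ofReal_pow (norm_nonneg _), ofReal_norm,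
    ← sq_abs, ENNReal.ofReal_pow (abs_nonneg _), ← Real.norm_eq_abs, ofReal_norm] at h4
  simpa only [ENNReal.rpow_two] using h4

variable [MeasurableSpace E] [BorelSpace E] [FiniteDimensional ℝ E] (μ : Measure E)
  [μ.IsAddHaarMeasure]

/-- Integrate the estimate along segments in `x`; after Tonelli, each slice `x + t • ζ` contributes
the same integral by translation invariance. -/
theorem lintegral_enorm_sub_sq_le {w : E → ℝ} (hw : ContDiff ℝ 1 w) (ζ : E) :
    ∫⁻ x, ‖w (x + ζ) - w x‖ₑ ^ (2 : ℝ) ∂μ ≤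
      ‖ζ‖ₑ ^ (2 : ℝ) * ∫⁻ x, ‖fderiv ℝ w x‖ₑ ^ (2 : ℝ) ∂μ := by
  have hc := hw.continuous_fderiv one_ne_zero
  refine (lintegral_mono fun x => enorm_sub_sq_le_lintegral hw x ζ).trans ?_
  rw [lintegral_const_mul']
  swap
  · exact ENNReal.rpow_ne_top_of_nonneg (by norm_num) (by simp)
  refine mul_le_mul_right ?_ _
  rw [lintegral_lintegral_swap]
  · have : ∀ t : ℝ, ∫⁻ x, ‖fderiv ℝ w (x + t • ζ)‖ₑ ^ (2 : ℝ) ∂μ =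
        ∫⁻ x, ‖fderiv ℝ w x‖ₑ ^ (2 : ℝ) ∂μ := fun t =>
      lintegral_add_right_eq_self (fun x => ‖fderiv ℝ w x‖ₑ ^ (2 : ℝ)) (t • ζ)
    rw [lintegral_congr this]; simp
  · refine Measurable.aemeasurable ?_
    have : Continuous fun p : E × ℝ => ‖fderiv ℝ w (p.1 + p.2 • ζ)‖ₑ :=
      (hc.comp (by fun_prop)).enorm
    exact this.measurable.pow_const 2

/-- The value `w x` is the average over the ball minus the average of `w y - w x`. With `y = x + ζ`,
the displacement `ζ` is in the ball of radius `2 * δ` around 0, a domain independent of `x` and `c`,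
so that the order of integration can be exchanged later. -/
theorem enorm_sq_le_of_mem_ball {w : E → ℝ} (hw : Continuous w) {δ : ℝ} (hδ : 0 < δ) {c x : E}
    (hx : x ∈ Metric.ball c δ) :
    ‖w x‖ₑ ^ (2 : ℝ) ≤ 2 * (μ (Metric.ball 0 δ))⁻¹ ^ (2 : ℝ) *
        ‖∫ y in Metric.ball c δ, w y ∂μ‖ₑ ^ (2 : ℝ) +
      2 * (μ (Metric.ball 0 δ))⁻¹ *
        ∫⁻ ζ in Metric.ball 0 (2 * δ), ‖w (x + ζ) - w x‖ₑ ^ (2 : ℝ) ∂μ := by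
  set B := Metric.ball c δ with hB
  have hμB : μ (Metric.ball 0 δ) = μ B := (Measure.addHaar_ball_center μ c δ).symm
  have hBt : μ B ≠ ⊤ := measure_ball_lt_top.ne
  have hB0 : μ B ≠ 0 := (Metric.measure_ball_pos μ c hδ).ne'
  rw [hμB]
  have hint : IntegrableOn w B μ := (hw.continuousOn.integrableOn_compact
    (isCompact_closedBall c δ)).mono_set Metric.ball_subset_closedBall
  have e1 : μ.real B * w x = (∫ y in B, w y ∂μ) - ∫ y in B, (w y - w x) ∂μ := by
    rw [integral_sub hint (integrableOn_const hBt)]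
    simp [mul_comm]
  have k1 : ‖∫ y in B, (w y - w x) ∂μ‖ₑ ^ (2 : ℝ) ≤
      μ B * ∫⁻ y in B, ‖w y - w x‖ₑ ^ (2 : ℝ) ∂μ := by
    have h := ENNReal.lintegral_mul_le_Lp_mul_Lq (μ.restrict B) Real.HolderConjugate.two_two
      (f := fun y => ‖w y - w x‖ₑ) (g := fun _ => 1)
      (hw.sub continuous_const).enorm.measurable.aemeasurable aemeasurable_const
    have h2 : ‖∫ y in B, (w y - w x) ∂μ‖ₑ ≤ _ := (enorm_integral_le_lintegral_enorm _).trans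
      ((lintegral_congr fun y => by simp).trans_le h)
    refine (ENNReal.rpow_le_rpow h2 zero_le_two).trans (le_of_eq ?_)
    rw [ENNReal.mul_rpow_of_nonneg _ _ zero_le_two, ← ENNReal.rpow_mul, ← ENNReal.rpow_mul]
    norm_num [mul_comm]
  have k2 : ∫⁻ y in B, ‖w y - w x‖ₑ ^ (2 : ℝ) ∂μ ≤
      ∫⁻ ζ in Metric.ball 0 (2 * δ), ‖w (x + ζ) - w x‖ₑ ^ (2 : ℝ) ∂μ := by
    rw [← lintegral_indicator Metric.isOpen_ball.measurableSet,
      ← lintegral_indicator Metric.isOpen_ball.measurableSet,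
      ← lintegral_add_left_eq_self _ x]
    refine lintegral_mono fun ζ => ?_
    by_cases h : x + ζ ∈ B
    · have h' : ζ ∈ Metric.ball (0 : E) (2 * δ) := by
        rw [hB, Metric.mem_ball] at h hx
        rw [mem_ball_zero_iff]
        have : ζ = (x + ζ - c) - (x - c) := by abel
        rw [this]
        rw [dist_eq_norm] at h hx
        linarith [norm_sub_le (x + ζ - c) (x - c)]
      rw [indicator_of_mem h, indicator_of_mem h']
    · rw [indicator_of_notMem h]; exact zero_le
  have k3 : (μ B) ^ (2 : ℝ) * ‖w x‖ₑ ^ (2 : ℝ) ≤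
      2 * ‖∫ y in B, w y ∂μ‖ₑ ^ (2 : ℝ) + 2 * (μ B * ∫⁻ ζ in Metric.ball 0 (2 * δ),
        ‖w (x + ζ) - w x‖ₑ ^ (2 : ℝ) ∂μ) := by
    have : μ B = ‖μ.real B‖ₑ := by
      rw [Real.enorm_eq_ofReal measureReal_nonneg, Measure.real, ENNReal.ofReal_toReal hBt]
    rw [← ENNReal.mul_rpow_of_nonneg _ _ zero_le_two, this, ← enorm_mul, e1, ← this, ← mul_add]
    refine (ENNReal.rpow_le_rpow (enorm_sub_le) zero_le_two).trans ?_
    refine (ENNReal.rpow_add_le_mul_rpow_add_rpow _ _ one_le_two).trans ?_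
    norm_num
    gcongr
    exact_mod_cast k1.trans (mul_le_mul_right k2 _)
  have k4 : ‖w x‖ₑ ^ (2 : ℝ) = (μ B)⁻¹ ^ (2 : ℝ) * ((μ B) ^ (2 : ℝ) * ‖w x‖ₑ ^ (2 : ℝ)) := by
    rw [← mul_assoc, ← ENNReal.mul_rpow_of_nonneg _ _ zero_le_two, ENNReal.inv_mul_cancel hB0 hBt]
    simp
  rw [k4]
  refine (mul_le_mul_right k3 _).trans (le_of_eq ?_)
  have k5 : (μ B)⁻¹ ^ (2 : ℝ) * μ B = (μ B)⁻¹ := by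
    rw [ENNReal.rpow_two, sq, mul_assoc, ENNReal.inv_mul_cancel hB0 hBt, mul_one]
  calc _ = 2 * (μ B)⁻¹ ^ (2 : ℝ) * ‖∫ y in B, w y ∂μ‖ₑ ^ (2 : ℝ) +
        2 * ((μ B)⁻¹ ^ (2 : ℝ) * μ B) * ∫⁻ ζ in Metric.ball 0 (2 * δ),
        ‖w (x + ζ) - w x‖ₑ ^ (2 : ℝ) ∂μ := by ring
    _ = _ := by rw [k5]

/-- A Poincaré type inequality: up to a small multiple of the Dirichlet integral, finitely many
averages control the `L²` norm of the functions supported in a compact set. -/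
theorem exists_lintegral_sq_le {K : Set E} (hK : IsCompact K) {η : ℝ} (hη : 0 < η) :
    ∃ δ > 0, ∃ t : Finset E, ∃ C : ℝ, 0 < C ∧ ∀ w : E → ℝ, ContDiff ℝ 1 w → (∀ x ∉ K, w x = 0) →
      ∫⁻ x, ‖w x‖ₑ ^ (2 : ℝ) ∂μ ≤
        ENNReal.ofReal η * ∫⁻ x, ‖fderiv ℝ w x‖ₑ ^ (2 : ℝ) ∂μ +
        ENNReal.ofReal C * ∑ c ∈ t, ‖∫ y in Metric.ball c δ, w y ∂μ‖ₑ ^ (2 : ℝ) := by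
  set k := Module.finrank ℝ E with hk
  -- The factor `2 ^ k` is the volume ratio of balls of radii `2 * δ` and `δ`, and `(2 * δ) ^ 2`
  -- bounds the squared displacement; `δ` is chosen so that the product is at most `η`.
  obtain ⟨δ, hδ, hδη⟩ : ∃ δ : ℝ, 0 < δ ∧ 2 * 2 ^ k * (2 * δ) ^ 2 ≤ η := by
    refine ⟨√(η / (8 * 2 ^ k)), by positivity, ?_⟩
    rw [mul_pow, Real.sq_sqrt (by positivity)]
    field_simp; norm_num
  obtain ⟨t, -, htK⟩ := hK.elim_nhds_subcover (fun x => Metric.ball x δ)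
    fun x _ => Metric.ball_mem_nhds x hδ
  set B := μ (Metric.ball (0 : E) δ) with hB
  have hBt : B ≠ ⊤ := measure_ball_lt_top.ne
  have hB0 : B ≠ 0 := (Metric.measure_ball_pos μ 0 hδ).ne'
  have hKt : μ K ≠ ⊤ := hK.measure_lt_top.ne
  have hC : 2 * B⁻¹ ^ (2 : ℝ) * μ K ≠ ⊤ := ENNReal.mul_ne_top (ENNReal.mul_ne_top (by simp)
    (ENNReal.rpow_ne_top_of_nonneg zero_le_two (ENNReal.inv_ne_top.2 hB0))) hKt
  refine ⟨δ, hδ, t, (2 * B⁻¹ ^ (2 : ℝ) * μ K).toReal + 1, by positivity, fun w hw hwK => ?_⟩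
  have h1 : ∀ x ∈ K, ‖w x‖ₑ ^ (2 : ℝ) ≤ 2 * B⁻¹ ^ (2 : ℝ) *
        ∑ c ∈ t, ‖∫ y in Metric.ball c δ, w y ∂μ‖ₑ ^ (2 : ℝ) +
      2 * B⁻¹ * ∫⁻ ζ in Metric.ball 0 (2 * δ), ‖w (x + ζ) - w x‖ₑ ^ (2 : ℝ) ∂μ := by
    intro x hx
    obtain ⟨c, hc, hxc⟩ := mem_iUnion₂.1 (htK hx)
    refine (enorm_sq_le_of_mem_ball μ hw.continuous hδ hxc).trans ?_
    gcongr
    exact Finset.single_le_sum (f := fun c => ‖∫ y in Metric.ball c δ, w y ∂μ‖ₑ ^ (2 : ℝ))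
      (fun _ _ => zero_le) hc
  have hcont : Continuous fun p : E × E => ‖w (p.1 + p.2) - w p.1‖ₑ :=
    ((hw.continuous.comp (by fun_prop)).sub (hw.continuous.comp (by fun_prop))).enorm
  have h2 : ∫⁻ x, ∫⁻ ζ in Metric.ball 0 (2 * δ), ‖w (x + ζ) - w x‖ₑ ^ (2 : ℝ) ∂μ ∂μ ≤
      2 ^ k * B * ENNReal.ofReal ((2 * δ) ^ 2) * ∫⁻ x, ‖fderiv ℝ w x‖ₑ ^ (2 : ℝ) ∂μ := by
    rw [lintegral_lintegral_swap]
    swap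
    · exact (hcont.measurable.pow_const 2).aemeasurable
    have : μ (Metric.ball (0 : E) (2 * δ)) = 2 ^ k * B := by
      rw [Measure.addHaar_ball_mul_of_pos μ 0 zero_lt_two, ENNReal.ofReal_pow zero_le_two]
      simp [hB, hk]
    rw [← this]
    calc _ ≤ ∫⁻ ζ in Metric.ball 0 (2 * δ), ENNReal.ofReal ((2 * δ) ^ 2) *
          ∫⁻ x, ‖fderiv ℝ w x‖ₑ ^ (2 : ℝ) ∂μ ∂μ := by
          refine setLIntegral_mono' Metric.isOpen_ball.measurableSet fun ζ hζ => ?_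
          refine (lintegral_enorm_sub_sq_le μ hw ζ).trans ?_
          gcongr
          rw [ENNReal.rpow_two, ← ofReal_norm, ← ENNReal.ofReal_pow (norm_nonneg _)]
          exact ENNReal.ofReal_le_ofReal (pow_le_pow_left₀ (norm_nonneg _)
            (mem_ball_zero_iff.1 hζ).le 2)
      _ = _ := by rw [setLIntegral_const]; ring
  have hKm := hK.isClosed.measurableSet
  have h0 : ∫⁻ x, ‖w x‖ₑ ^ (2 : ℝ) ∂μ = ∫⁻ x in K, ‖w x‖ₑ ^ (2 : ℝ) ∂μ := by
    refine (setLIntegral_eq_of_support_subset fun x hx => ?_).symm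
    by_contra hcon
    exact hx (by simp [hwK x hcon])
  rw [h0]
  refine (setLIntegral_mono' hKm h1).trans ?_
  have hmeas : Measurable fun x => ∫⁻ ζ in Metric.ball 0 (2 * δ), ‖w (x + ζ) - w x‖ₑ ^ (2 : ℝ) ∂μ :=
    (hcont.measurable.pow_const 2).lintegral_prod_right'
  rw [lintegral_add_left measurable_const, setLIntegral_const, add_comm,
    lintegral_const_mul' _ _ (ENNReal.mul_ne_top (by simp) (ENNReal.inv_ne_top.2 hB0))]
  gcongr ?_ + ?_
  · refine (mul_le_mul_right ((setLIntegral_le_lintegral _ _).trans h2) _).trans ?_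
    rw [← mul_assoc]
    gcongr
    have : 2 * B⁻¹ * (2 ^ k * B * ENNReal.ofReal ((2 * δ) ^ 2)) =
        2 * 2 ^ k * (B⁻¹ * B) * ENNReal.ofReal ((2 * δ) ^ 2) := by ring
    rw [this, ENNReal.inv_mul_cancel hB0 hBt, mul_one]
    refine le_trans (le_of_eq ?_) (ENNReal.ofReal_le_ofReal hδη)
    rw [ENNReal.ofReal_mul (by positivity), ENNReal.ofReal_mul (by positivity),
      ENNReal.ofReal_pow (by positivity)]
    simp
  · rw [mul_right_comm]
    gcongr
    rw [← ENNReal.ofReal_toReal hC]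
    exact ENNReal.ofReal_le_ofReal (by simp)

end EuclideanPoincare

/-! ### Rellich's theorem -/

section Rellich
open Filter Topology
open scoped ENNReal

/-- Up to an arbitrarily small multiple of `‖u‖ ^ 2`, the norm of `T u` is controlled by finitely
many functionals. Their joint range on the unit ball is a bounded set in finite dimension, hence has
finite nets, and these classify the image up to any precision. -/
theorem totallyBounded_image_ball {H F κ : Type*} [SeminormedAddCommGroup H] [NormedSpace ℝ H]
    [NormedAddCommGroup F] [NormedSpace ℝ F] (T : H →L[ℝ] F)
    (h : ∀ η : ℝ, 0 < η → ∃ (s : Finset κ) (l : κ → H →L[ℝ] ℝ) (C : ℝ),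
      ∀ u, ‖T u‖ ^ 2 ≤ η * ‖u‖ ^ 2 + C * ∑ k ∈ s, (l k u) ^ 2) :
    TotallyBounded (T '' Metric.ball 0 1) := by
  refine Metric.totallyBounded_of_finite_discretization fun e he => ?_
  -- Two points of the unit ball differ by at most 2, so this term contributes `e ^ 2 / 4`; the mesh
  -- `δ` lets the functionals contribute another `e ^ 2 / 4`.
  obtain ⟨s, l, C, hC⟩ := h (e ^ 2 / 16) (by positivity)
  set δ : ℝ := √(e ^ 2 / (16 * (|C| + 1) * (s.card + 1))) with hδ
  have hδ0 : 0 < δ := by positivity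
  have hδ2 : (|C| + 1) * ((s.card + 1) * (2 * δ) ^ 2) = e ^ 2 / 4 := by
    rw [mul_pow, hδ, Real.sq_sqrt (by positivity)]
    field_simp; norm_num
  have hb : TotallyBounded ((ContinuousLinearMap.pi fun k : s => l k) '' Metric.ball 0 1) :=
    (((ContinuousLinearMap.pi fun k : s => l k).lipschitz.isBounded_image
      Metric.isBounded_ball).isCompact_closure).totallyBounded.subset subset_closure
  obtain ⟨t, htf, ht⟩ := Metric.totallyBounded_iff.1 hb δ hδ0
  choose p hp1 hp2 using fun x : T '' Metric.ball (0 : H) 1 => x.2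
  have hq : ∀ x, ∃ q : t, (ContinuousLinearMap.pi fun k : s => l k) (p x) ∈ Metric.ball q.1 δ :=
    fun x => by
      obtain ⟨q, hq, hq'⟩ := mem_iUnion₂.1 (ht (mem_image_of_mem _ (hp1 x)))
      exact ⟨⟨q, hq⟩, hq'⟩
  choose q hq using hq
  obtain ⟨n, ⟨f⟩⟩ := htf.to_subtype.exists_equiv_fin
  refine ⟨ULift (Fin n), inferInstance, fun x => ⟨f (q x)⟩, fun x y hxy => ?_⟩
  replace hxy : q x = q y := f.injective (ULift.up_injective hxy)
  have hxy' : ∀ k ∈ s, (l k (p x - p y)) ^ 2 ≤ (2 * δ) ^ 2 := by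
    intro k hk
    have h1 := (dist_le_pi_dist _ _ (⟨k, hk⟩ : s)).trans_lt (Metric.mem_ball.1 (hq x))
    have h2 := (dist_le_pi_dist _ _ (⟨k, hk⟩ : s)).trans_lt (Metric.mem_ball.1 (hq y))
    rw [← hxy] at h2
    simp only [ContinuousLinearMap.coe_pi', Real.dist_eq] at h1 h2
    rw [map_sub, ← sq_abs]
    refine pow_le_pow_left₀ (abs_nonneg _) ?_ 2
    rw [abs_le]
    constructor <;> linarith [(abs_lt.1 h1).1, (abs_lt.1 h1).2, (abs_lt.1 h2).1, (abs_lt.1 h2).2]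
  have h1 : ‖T (p x - p y)‖ ^ 2 ≤ e ^ 2 / 2 := by
    refine (hC _).trans ?_
    have h2 : ‖p x - p y‖ ^ 2 ≤ 2 ^ 2 := by
      refine pow_le_pow_left₀ (norm_nonneg _) ((norm_sub_le _ _).trans ?_) 2
      linarith [mem_ball_zero_iff.1 (hp1 x), mem_ball_zero_iff.1 (hp1 y)]
    have h3 : C * ∑ k ∈ s, (l k (p x - p y)) ^ 2 ≤
        (|C| + 1) * ((s.card + 1) * (2 * δ) ^ 2) := by
      refine mul_le_mul (by linarith [le_abs_self C]) ?_
        (Finset.sum_nonneg fun _ _ => sq_nonneg _) (by positivity)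
      refine (Finset.sum_le_card_nsmul s _ _ hxy').trans ?_
      rw [nsmul_eq_mul]
      exact mul_le_mul_of_nonneg_right (by linarith) (sq_nonneg _)
    rw [hδ2] at h3
    nlinarith [sq_nonneg e]
  have h2 : dist (x : F) y = ‖T (p x - p y)‖ := by
    rw [map_sub, hp2, hp2, dist_eq_norm]
  rw [h2]
  refine lt_of_pow_lt_pow_left₀ 2 he.le ?_
  nlinarith [pow_pos he 2]

variable {d : ℕ} {N : Type*} [TopologicalSpace N] [ChartedSpace (EuclideanSpace ℝ (Fin d)) N]
  [RiemannianBundle (fun x : N => TangentSpace (𝓡 d) x)]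
  [MeasurableSpace N] [BorelSpace N] [IsManifold (𝓡 d) ∞ N]
  [IsContMDiffRiemannianBundle (𝓡 d) ∞ (EuclideanSpace ℝ (Fin d))
    (fun x : N => TangentSpace (𝓡 d) x)] [T2Space N] [CompactSpace N]

theorem lintegral_enorm_sq_vol {f : N → ℝ} (hf : Continuous f) :
    ∫⁻ x, ‖f x‖ₑ ^ (2 : ℝ) ∂(vol d N) = ENNReal.ofReal (∫ x, f x ^ 2 ∂(vol d N)) := by
  rw [ofReal_integral_eq_lintegral_ofReal (integrable_vol (f := fun x => f x ^ 2) (hf.pow 2))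
    (Eventually.of_forall fun x => sq_nonneg _)]
  refine lintegral_congr fun x => ?_
  rw [← sq_abs, ENNReal.ofReal_pow (abs_nonneg _), ← Real.norm_eq_abs, ofReal_norm,
    ENNReal.rpow_two]

theorem integral_localize_sq_le (i : N) (u : SmoothFn d N) :
    ∫ x, (localize i u).toFun x ^ 2 ∂(vol d N) ≤ ‖u‖ ^ 2 := by
  have h1 : ∫ x, (localize i u).toFun x ^ 2 ∂(vol d N) ≤ ∫ x, u.toFun x ^ 2 ∂(vol d N) := by
    refine integral_mono (integrable_vol ((localize i u).contMDiff.continuous.pow 2))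
      (integrable_vol (u.contMDiff.continuous.pow 2)) fun x => ?_
    simp only [localize_apply, mul_pow]
    exact mul_le_of_le_one_left (sq_nonneg _) (pow_le_one₀ ((chartPartition d N).nonneg i x)
      ((chartPartition d N).le_one i x))
  refine h1.trans ?_
  rw [← u.norm_toLp_sq]
  exact pow_le_pow_left₀ (norm_nonneg _) (by simpa using u.norm_toLp_le) 2

theorem chartExpr_localize_add (i : N) (u v : SmoothFn d N) (y : EuclideanSpace ℝ (Fin d)) :
    chartExpr i (localize i (u + v)).toFun y =
      chartExpr i (localize i u).toFun y + chartExpr i (localize i v).toFun y := by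
  by_cases hy : y ∈ (chartAt (EuclideanSpace ℝ (Fin d)) i).target
  · rw [chartExpr_of_mem hy, chartExpr_of_mem hy, chartExpr_of_mem hy, localize_apply,
      localize_apply, localize_apply, SmoothFn.add_apply]
    ring
  · simp [chartExpr, indicator_of_notMem hy]

theorem chartExpr_localize_smul (i : N) (c : ℝ) (u : SmoothFn d N)
    (y : EuclideanSpace ℝ (Fin d)) :
    chartExpr i (localize i (c • u)).toFun y = c * chartExpr i (localize i u).toFun y := by
  by_cases hy : y ∈ (chartAt (EuclideanSpace ℝ (Fin d)) i).target
  · rw [chartExpr_of_mem hy, chartExpr_of_mem hy, localize_apply, localize_apply,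
      SmoothFn.smul_apply]
    ring
  · simp [chartExpr, indicator_of_notMem hy]

theorem integrable_chartExpr_localize (i : N) (u : SmoothFn d N) :
    Integrable (chartExpr (d := d) i (localize i u).toFun) := by
  have hA : IsCompact (tsupport (chartPartition d N i)) := (isClosed_tsupport _).isCompact
  have hAs := tsupport_chartPartition_subset (d := d) i
  exact (contDiff_chartExpr hA hAs (v := localize i u)
    fun x hx => localize_eq_zero i u hx).continuous.integrable_of_hasCompactSupport
    (hasCompactSupport_chartExpr hA hAs fun x hx => localize_eq_zero i u hx)

/-- The integrals of the localizations over the balls of a chart. -/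
theorem exists_ballIntegral (i : N) (δ : ℝ) (c : EuclideanSpace ℝ (Fin d)) :
    ∃ l : SmoothFn d N →L[ℝ] ℝ, ∀ u,
      l u = ∫ y in Metric.ball c δ, chartExpr i (localize i u).toFun y := by
  have hA : IsCompact (tsupport (chartPartition d N i)) := (isClosed_tsupport _).isCompact
  have hAs := tsupport_chartPartition_subset (d := d) i
  obtain ⟨C₁, hC₁, h₁⟩ := exists_lintegral_chartExpr_le hA hAs
  set V := volume.real (Metric.ball c δ) with hV
  refine ⟨LinearMap.mkContinuous
    { toFun := fun u => ∫ y in Metric.ball c δ, chartExpr i (localize i u).toFun y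
      map_add' := fun u v => by
        rw [← integral_add (integrable_chartExpr_localize i u).integrableOn
          (integrable_chartExpr_localize i v).integrableOn]
        exact integral_congr_ae (Eventually.of_forall fun y => chartExpr_localize_add i u v y)
      map_smul' := fun a u => by
        rw [RingHom.id_apply, smul_eq_mul, ← integral_const_mul]
        exact integral_congr_ae (Eventually.of_forall fun y => chartExpr_localize_smul i a u y) }
    (√(V * C₁)) fun u => ?_, fun u => rfl⟩
  change ‖∫ y in Metric.ball c δ, chartExpr i (localize i u).toFun y‖ ≤ _
  set w := chartExpr (d := d) i (localize i u).toFun with hw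
  have hwc : Continuous w := (contDiff_chartExpr hA hAs (v := localize i u)
    fun x hx => localize_eq_zero i u hx).continuous
  have h := ENNReal.lintegral_mul_le_Lp_mul_Lq (volume.restrict (Metric.ball c δ))
    Real.HolderConjugate.two_two (f := fun y => ‖w y‖ₑ) (g := fun _ => 1)
    hwc.enorm.measurable.aemeasurable aemeasurable_const
  have h2 : ‖∫ y in Metric.ball c δ, w y‖ₑ ≤ _ := (enorm_integral_le_lintegral_enorm _).trans
    ((lintegral_congr fun y => by simp).trans_le h)
  have h3 : ∫⁻ y in Metric.ball c δ, ‖w y‖ₑ ^ (2 : ℝ) ≤ ENNReal.ofReal (C₁ * ‖u‖ ^ 2) := by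
    refine (setLIntegral_le_lintegral _ _).trans ((h₁ (localize i u)
      (fun x hx => localize_eq_zero i u hx) 2 two_pos).2.1.trans ?_)
    rw [lintegral_enorm_sq_vol (localize i u).contMDiff.continuous,
      ← ENNReal.ofReal_mul hC₁.le]
    exact ENNReal.ofReal_le_ofReal (mul_le_mul_of_nonneg_left (integral_localize_sq_le i u) hC₁.le)
  have h4 : ‖∫ y in Metric.ball c δ, w y‖ₑ ^ (2 : ℝ) ≤
      ENNReal.ofReal (C₁ * ‖u‖ ^ 2) * ENNReal.ofReal V := by
    refine (ENNReal.rpow_le_rpow h2 zero_le_two).trans ?_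
    rw [ENNReal.mul_rpow_of_nonneg _ _ zero_le_two, ← ENNReal.rpow_mul, ← ENNReal.rpow_mul]
    norm_num
    refine mul_le_mul' (by exact_mod_cast h3) (le_of_eq ?_)
    rw [hV, Measure.real, ENNReal.ofReal_toReal measure_ball_lt_top.ne]
  rw [ENNReal.rpow_two, ← ofReal_norm, ← ENNReal.ofReal_pow (norm_nonneg _),
    ← ENNReal.ofReal_mul (by positivity), ENNReal.ofReal_le_ofReal_iff (by positivity)] at h4
  refine le_of_sq_le_sq ?_ (by positivity)
  rw [mul_pow, Real.sq_sqrt (by positivity)]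
  linarith

/-- The Euclidean inequality carried to the manifold. The small parameter is divided by the
constants lost in passing to the chart and back and in differentiating the partition function. -/
theorem exists_integral_localize_sq_le (i : N) {η : ℝ} (hη : 0 < η) :
    ∃ (s : Finset (EuclideanSpace ℝ (Fin d)))
      (l : EuclideanSpace ℝ (Fin d) → SmoothFn d N →L[ℝ] ℝ) (C : ℝ), 0 < C ∧ ∀ u,
      ∫ x, (localize i u).toFun x ^ 2 ∂(vol d N) ≤ η * ‖u‖ ^ 2 + C * ∑ c ∈ s, (l c u) ^ 2 := by
  have hA : IsCompact (tsupport (chartPartition d N i)) := (isClosed_tsupport _).isCompact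
  have hAs := tsupport_chartPartition_subset (d := d) i
  obtain ⟨C₁, hC₁, h₁⟩ := exists_lintegral_chartExpr_le hA hAs
  obtain ⟨C₂, hC₂, h₂⟩ := exists_norm_grad_localize_le (d := d) i
  obtain ⟨δ, hδ, t, C₃, hC₃, h₃⟩ := exists_lintegral_sq_le volume (isCompact_chart_image hA hAs)
    (show 0 < η / (C₁ * C₁ * (C₁ ^ 2 * (2 * C₂ ^ 2))) by positivity)
  choose l hl using exists_ballIntegral (d := d) i δ
  refine ⟨t, l, C₁ * C₃, by positivity, fun u => ?_⟩
  have k1 := (h₁ (localize i u) (fun x hx => localize_eq_zero i u hx) 2 two_pos).1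
  have k2 := (h₁ (localize i u) (fun x hx => localize_eq_zero i u hx) 2 two_pos).2.2
  have k3 := h₃ _ ((contDiff_chartExpr hA hAs (v := localize i u)
    fun x hx => localize_eq_zero i u hx).of_le (by simp))
    (fun y hy => chartExpr_eq_zero (fun x hx => localize_eq_zero i u hx) hy)
  have k4 : ∫⁻ x, ENNReal.ofReal (C₁ * ‖grad (d := d) (localize i u).toFun x‖) ^ (2 : ℝ)
      ∂(vol d N) ≤ ENNReal.ofReal (C₁ ^ 2 * (2 * C₂ ^ 2) * ‖u‖ ^ 2) := by
    rw [norm_sq_smoothFn, ← integral_const_mul, ofReal_integral_eq_lintegral_ofReal]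
    · refine lintegral_mono fun x => ?_
      rw [ENNReal.rpow_two, ← ENNReal.ofReal_pow (by positivity)]
      refine ENNReal.ofReal_le_ofReal ?_
      rw [mul_pow, mul_assoc]
      refine mul_le_mul_of_nonneg_left ?_ (sq_nonneg _)
      refine (pow_le_pow_left₀ (norm_nonneg _) (h₂ u x) 2).trans ?_
      rw [mul_pow, mul_comm 2, mul_assoc]
      refine mul_le_mul_of_nonneg_left ?_ (sq_nonneg _)
      nlinarith [sq_nonneg (‖grad (d := d) u.toFun x‖ - |u.toFun x|), sq_abs (u.toFun x)]
    · exact ((integrable_vol (u.contMDiff.continuous.pow 2)).add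
        (integrable_norm_grad_sq u)).const_mul _
    · exact Eventually.of_forall fun x => by positivity
  rw [lintegral_enorm_sq_vol (localize i u).contMDiff.continuous] at k1
  have k5 : ∑ c ∈ t, ‖∫ y in Metric.ball c δ, chartExpr i (localize i u).toFun y‖ₑ ^ (2 : ℝ) =
      ENNReal.ofReal (∑ c ∈ t, (l c u) ^ 2) := by
    rw [ENNReal.ofReal_sum_of_nonneg fun _ _ => sq_nonneg _]
    refine Finset.sum_congr rfl fun c _ => ?_
    rw [← hl, ENNReal.rpow_two, ← ofReal_norm, ← ENNReal.ofReal_pow (norm_nonneg _),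
      Real.norm_eq_abs, sq_abs]
  rw [k5] at k3
  have k6 := k1.trans (mul_le_mul_right (k3.trans (add_le_add_left
    (mul_le_mul_right (k2.trans (mul_le_mul_right k4 _)) _) _)) _)
  have hS : 0 ≤ ∑ c ∈ t, (l c u) ^ 2 := Finset.sum_nonneg fun _ _ => sq_nonneg _
  rw [← ENNReal.ofReal_mul hC₁.le, ← ENNReal.ofReal_mul (by positivity),
    ← ENNReal.ofReal_mul hC₃.le, ← ENNReal.ofReal_add (by positivity) (by positivity),
    ← ENNReal.ofReal_mul hC₁.le, ENNReal.ofReal_le_ofReal_iff (by positivity)] at k6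
  refine k6.trans (le_of_eq ?_)
  field_simp

theorem totallyBounded_smoothToL2 : TotallyBounded (smoothToL2 d N '' Metric.ball 0 1) := by
  refine totallyBounded_image_ball (κ := Σ _ : N, EuclideanSpace ℝ (Fin d)) _ fun η hη => ?_
  set m : ℝ := ((partitionIndex d N).card : ℝ) with hm
  -- One factor `m` is lost in squaring a sum of `m` pieces, another in adding `m` error terms.
  choose s l C hC hu using fun i : N => exists_integral_localize_sq_le (d := d) i
    (show 0 < η / (m * m + 1) by positivity)
  refine ⟨(partitionIndex d N).sigma s, fun k => l k.1 k.2, m * ∑ i ∈ partitionIndex d N, C i,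
    fun u => ?_⟩
  have h1 : ‖smoothToL2 d N u‖ ^ 2 = ∫ x, u.toFun x ^ 2 ∂(vol d N) := u.norm_toLp_sq
  have h2 : ∫ x, u.toFun x ^ 2 ∂(vol d N) ≤
      m * ∑ i ∈ partitionIndex d N, ∫ x, (localize i u).toFun x ^ 2 ∂(vol d N) := by
    have hi : ∀ i, Integrable (fun x => (localize i u).toFun x ^ 2) (vol d N) :=
      fun i => integrable_vol ((localize i u).contMDiff.continuous.pow 2)
    rw [← integral_finsetSum _ fun i _ => hi i, ← integral_const_mul]
    refine integral_mono (integrable_vol (u.contMDiff.continuous.pow 2))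
      ((integrable_finsetSum _ fun i _ => hi i).const_mul _) fun x => ?_
    simp only
    rw [← sum_localize_apply]
    exact sq_sum_le_card_mul_sum_sq
  rw [h1]
  refine h2.trans ?_
  have h3 : ∑ i ∈ partitionIndex d N, ∫ x, (localize i u).toFun x ^ 2 ∂(vol d N) ≤
      m * (η / (m * m + 1) * ‖u‖ ^ 2) + (∑ i ∈ partitionIndex d N, C i) *
        ∑ k ∈ (partitionIndex d N).sigma s, (l k.1 k.2 u) ^ 2 := by
    refine (Finset.sum_le_sum fun i _ => hu i u).trans ?_
    rw [Finset.sum_add_distrib, Finset.sum_const, nsmul_eq_mul, Finset.sum_sigma, Finset.sum_mul]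
    refine add_le_add le_rfl (Finset.sum_le_sum fun i hi => ?_)
    refine mul_le_mul_of_nonneg_left ?_ (hC i).le
    exact Finset.single_le_sum (f := fun i => ∑ c ∈ s i, (l i c u) ^ 2)
      (fun _ _ => Finset.sum_nonneg fun _ _ => sq_nonneg _) hi
  refine (mul_le_mul_of_nonneg_left h3 (Nat.cast_nonneg _)).trans ?_
  rw [mul_add, ← mul_assoc m (∑ i ∈ partitionIndex d N, C i)]
  refine add_le_add ?_ le_rfl
  rw [← mul_assoc, ← mul_assoc]
  refine mul_le_mul_of_nonneg_right ?_ (sq_nonneg _)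
  rw [mul_div_assoc', div_le_iff₀ (by positivity)]
  nlinarith

/-- Rellich's theorem: `W^{1,2}` embeds compactly into `L²`. -/
theorem isCompactOperator_toL2 : IsCompactOperator (toL2 d N) := by
  refine ⟨closure (smoothToL2 d N '' Metric.ball 0 1),
    totallyBounded_smoothToL2.closure.isCompact_of_isClosed isClosed_closure, ?_⟩
  filter_upwards [Metric.ball_mem_nhds (0 : W12 d N) one_pos] with u hu
  -- The unit ball of the completion lies in the closure of the smooth functions of norm less than
  -- 1.
  have h1 : u ∈ closure (Metric.ball (0 : W12 d N) 1 ∩ range ((↑) : SmoothFn d N → W12 d N)) :=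
    denseRange_coe_W12.open_subset_closure_inter Metric.isOpen_ball hu
  refine closure_mono ?_ (image_closure_subset_closure_image (toL2 d N).continuous
    (mem_image_of_mem _ h1))
  rintro _ ⟨_, ⟨hv, v, rfl⟩, rfl⟩
  refine ⟨v, ?_, (toL2_coe v).symm⟩
  rw [mem_ball_zero_iff] at hv ⊢
  rwa [UniformSpace.Completion.norm_coe] at hv

end Rellich

/-! ### The energy barrier between the wells -/

section Barrier
open Filter Topology
open scoped ENNReal NNReal

/-- A smooth step from `0` to `1` across the interval `[-1/2, 1/2]`. -/
structure IsSmoothStep (h : ℝ → ℝ) (K : ℝ≥0) : Prop where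
  contDiff : ContDiff ℝ ∞ h
  lipschitz : LipschitzWith K h
  abs_deriv_le : ∀ s, |deriv h s| ≤ K
  nonneg : ∀ s, 0 ≤ h s
  le_one : ∀ s, h s ≤ 1
  eq_zero : ∀ s ≤ -1 / 2, h s = 0
  eq_one : ∀ s, 1 / 2 ≤ s → h s = 1

theorem exists_isSmoothStep : ∃ h K, IsSmoothStep h K := by
  have hc : ContDiff ℝ ∞ fun s : ℝ => Real.smoothTransition (s + 1 / 2) :=
    Real.smoothTransition.contDiff.comp (contDiff_id.add contDiff_const)
  have h0 : ∀ s : ℝ, s ≤ -1 / 2 → Real.smoothTransition (s + 1 / 2) = 0 := fun s hs =>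
    Real.smoothTransition.zero_of_nonpos (by linarith)
  have h1 : ∀ s : ℝ, 1 / 2 ≤ s → Real.smoothTransition (s + 1 / 2) = 1 := fun s hs =>
    Real.smoothTransition.one_of_one_le (by linarith)
  have hd0 : ∀ s : ℝ, s ∉ Icc (-1 / 2 : ℝ) (1 / 2) →
      deriv (fun s : ℝ => Real.smoothTransition (s + 1 / 2)) s = 0 := by
    intro s hs
    rw [mem_Icc, not_and_or, not_le, not_le] at hs
    rcases hs with hs | hs
    · have : (fun s : ℝ => Real.smoothTransition (s + 1 / 2)) =ᶠ[𝓝 s] fun _ => 0 := by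
        filter_upwards [Iio_mem_nhds hs] with t ht using h0 t ht.le
      rw [this.deriv_eq]; simp
    · have : (fun s : ℝ => Real.smoothTransition (s + 1 / 2)) =ᶠ[𝓝 s] fun _ => 1 := by
        filter_upwards [Ioi_mem_nhds hs] with t ht using h1 t ht.le
      rw [this.deriv_eq]; simp
  obtain ⟨C, hC⟩ := isCompact_Icc.exists_bound_of_continuousOn
    (hc.continuous_deriv (by simp)).continuousOn (s := Icc (-1 / 2 : ℝ) (1 / 2))
  have hb : ∀ s, ‖deriv (fun s : ℝ => Real.smoothTransition (s + 1 / 2)) s‖ ≤ C.toNNReal := by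
    intro s
    by_cases hs : s ∈ Icc (-1 / 2 : ℝ) (1 / 2)
    · exact (hC s hs).trans (Real.le_coe_toNNReal C)
    · rw [hd0 s hs]; simp
  exact ⟨_, C.toNNReal, hc, lipschitzWith_of_nnnorm_deriv_le (hc.differentiable (by simp)) hb, hb,
    fun s => Real.smoothTransition.nonneg _, fun s => Real.smoothTransition.le_one _, h0, h1⟩

theorem IsSmoothStep.deriv_eq_zero {h : ℝ → ℝ} {K : ℝ≥0} (hh : IsSmoothStep h K) {s : ℝ}
    (hs : 1 / 2 < |s|) : deriv h s = 0 := by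
  rcases lt_abs.1 hs with hs | hs
  · have : h =ᶠ[𝓝 s] fun _ => 1 := by
      filter_upwards [Ioi_mem_nhds hs] with t ht using hh.eq_one t (le_of_lt ht)
    rw [this.deriv_eq]; simp
  · have : h =ᶠ[𝓝 s] fun _ => 0 := by
      filter_upwards [Iio_mem_nhds (show s < -1 / 2 by linarith)] with t ht
      exact hh.eq_zero t (le_of_lt ht)
    rw [this.deriv_eq]; simp

/-- Up to `η` and a multiple of `W`, a function behaves as if its values were -1 and 1: then `s + 1
= 2 * h s` and `-s ≤ 1`. This estimates `∫ g u` through `∫ h(u)` and the potential energy. -/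
theorem IsDoubleWell.exists_add_one_le {W : ℝ → ℝ} (hW : IsDoubleWell W) {h : ℝ → ℝ} {K : ℝ≥0}
    (hh : IsSmoothStep h K) {η : ℝ} (hη : 0 < η) :
    ∃ C > 0, ∀ s, s + 1 ≤ 2 * h s + η + C * W s ∧ -s ≤ 1 + η + C * W s := by
  obtain ⟨k, hk, hkW⟩ := hW.exists_mul_sq_le
  have hy : ∀ t : ℝ, t ≤ η + t ^ 2 / (4 * η) := fun t => by
    have : 0 ≤ (t - 2 * η) ^ 2 / (4 * η) := by positivity
    have e : (t - 2 * η) ^ 2 / (4 * η) = t ^ 2 / (4 * η) - t + η := by field_simp; ring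
    linarith
  -- The first summand comes from Young's inequality `t ≤ η + t ^ 2 / (4 * η)`. The second covers `0
  -- < s < 1 / 2`, where the step may not yet be 1 and `s + 1 ≤ 6 * (s - 1) ^ 2`.
  refine ⟨1 / (4 * η * k) + 6 / k, by positivity, fun s => ?_⟩
  have hs1 : (|s| - 1) ^ 2 / (4 * η) + 6 * (|s| - 1) ^ 2 ≤ (1 / (4 * η * k) + 6 / k) * W s := by
    refine le_trans (le_of_eq ?_) (mul_le_mul_of_nonneg_left (hkW s) (by positivity))
    field_simp
  have h6 : 0 ≤ 6 * (|s| - 1) ^ 2 := by positivity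
  have h4 : 0 ≤ (|s| - 1) ^ 2 / (4 * η) := by positivity
  have hy1 := hy (|s| - 1)
  have h0 := hh.nonneg s
  constructor
  · rcases le_or_gt s (-1) with hs | hs
    · linarith
    · rcases le_or_gt s 0 with hs2 | hs2
      · have := hy (s + 1)
        rw [abs_of_nonpos hs2] at hs1
        have e : (-s - 1) ^ 2 = (s + 1) ^ 2 := by ring
        rw [e] at hs1
        nlinarith [sq_nonneg (s + 1)]
      · rw [abs_of_pos hs2] at hs1 hy1
        rcases le_or_gt (1 / 2) s with hs3 | hs3
        · rw [hh.eq_one s hs3]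
          nlinarith [sq_nonneg (s - 1)]
        · rw [abs_of_pos hs2] at h4
          nlinarith [sq_nonneg (s - 1)]
  · linarith [neg_abs_le s]

variable {d : ℕ} {N : Type*} [TopologicalSpace N] [ChartedSpace (EuclideanSpace ℝ (Fin d)) N]
  [RiemannianBundle (fun x : N => TangentSpace (𝓡 d) x)]
  [MeasurableSpace N] [BorelSpace N] [IsManifold (𝓡 d) ∞ N]
  [IsContMDiffRiemannianBundle (𝓡 d) ∞ (EuclideanSpace ℝ (Fin d))
    (fun x : N => TangentSpace (𝓡 d) x)] [T2Space N] [CompactSpace N]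

theorem IsDoubleWell.continuous_energyE {W : ℝ → ℝ} (hW : IsDoubleWell W) (ε : ℝ) :
    Continuous (energyE W ε : W12 d N → ℝ) := by
  obtain ⟨K, hK⟩ := hW.exists_lipschitzWith_deriv
  exact (continuous_const.mul continuous_dirichlet).add (continuous_const.mul
    ((continuous_potential hW.hasDerivAt hK).comp (toL2 d N).continuous))

theorem IsDoubleWell.integrable_comp {W : ℝ → ℝ} (hW : IsDoubleWell W) (f : Lp ℝ 2 (vol d N)) :
    Integrable (fun x => W (f x)) (vol d N) := by
  obtain ⟨K, hK⟩ := hW.exists_lipschitzWith_deriv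
  exact integrable_potential hW.hasDerivAt hK f

theorem IsDoubleWell.energyE_nonneg {W : ℝ → ℝ} (hW : IsDoubleWell W) {ε : ℝ} (hε : 0 < ε)
    (u : W12 d N) : 0 ≤ energyE W ε u :=
  add_nonneg (mul_nonneg (by linarith) (dirichlet_nonneg u))
    (mul_nonneg (inv_nonneg.2 hε.le) (integral_nonneg fun _ => hW.nonneg _))

theorem integral_comp_le_energyE (W : ℝ → ℝ) {ε : ℝ} (hε : 0 < ε)
    (u : W12 d N) : ∫ x, W (toL2 d N u x) ∂(vol d N) ≤ ε * energyE W ε u := by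
  have h := mul_nonneg (by linarith : 0 ≤ ε / 2) (dirichlet_nonneg u)
  have e : ε * energyE W ε u = ε * (ε / 2 * dirichlet u) + ∫ x, W (toL2 d N u x) ∂(vol d N) := by
    unfold energyE; field_simp
  rw [e]
  linarith [mul_nonneg hε.le h]

theorem energyE_coe {W : ℝ → ℝ} (hW : IsDoubleWell W) (ε : ℝ) (u : SmoothFn d N) :
    energyE W ε (u : W12 d N) = ∫ x, (ε / 2 * ‖grad (d := d) u.toFun x‖ ^ 2 +
      ε⁻¹ * W (u.toFun x)) ∂(vol d N) := by
  have h1 : ∫ x, W (toL2 d N (u : W12 d N) x) ∂(vol d N) = ∫ x, W (u.toFun x) ∂(vol d N) := by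
    refine integral_congr_ae ?_
    filter_upwards [coeFn_toL2_coe u] with x hx
    rw [hx]
  rw [energyE, dirichlet_coe, h1, integral_add ((integrable_norm_grad_sq u).const_mul _),
    integral_const_mul, integral_const_mul]
  exact (integrable_vol (hW.contDiff.continuous.comp u.contMDiff.continuous)).const_mul _

theorem continuous_integral_nemytskii {h : ℝ → ℝ} {K : ℝ≥0} (hh : LipschitzWith K h) :
    Continuous fun u : W12 d N => ∫ x, h (toL2 d N u x) ∂(vol d N) := by
  have e : ∀ u : W12 d N, ∫ x, h (toL2 d N u x) ∂(vol d N) =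
      inner ℝ (continuousL2 d (fun _ : N => (1 : ℝ)) continuous_const)
        (nemytskii hh (toL2 d N u)) := fun u => by
    rw [inner_continuousL2]
    refine integral_congr_ae ?_
    filter_upwards [coeFn_nemytskii hh (toL2 d N u)] with x hx
    rw [hx, one_mul]
  simp only [e]
  exact continuous_const.inner ((continuous_nemytskii hh).comp (toL2 d N).continuous)

theorem continuous_integral_nemytskii_sq {h : ℝ → ℝ} {K : ℝ≥0} (hh : LipschitzWith K h) :
    Continuous fun u : W12 d N => ∫ x, h (toL2 d N u x) ^ 2 ∂(vol d N) := by
  have e : ∀ u : W12 d N, ∫ x, h (toL2 d N u x) ^ 2 ∂(vol d N) =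
      ‖nemytskii hh (toL2 d N u)‖ ^ 2 := fun u => by
    rw [norm_L2_sq_eq]
    refine integral_congr_ae ?_
    filter_upwards [coeFn_nemytskii hh (toL2 d N u)] with x hx
    rw [hx]
  simp only [e]
  exact ((continuous_nemytskii hh).comp (toL2 d N).continuous).norm.pow 2

/-- The isoperimetric type lower bound for the energy. -/
theorem exists_integral_step_sq_le (hd : 2 ≤ d) {W : ℝ → ℝ} (hW : IsDoubleWell W) {h : ℝ → ℝ}
    {K : ℝ≥0} (hh : IsSmoothStep h K) :
    ∃ C > 0, ∀ ε, 0 < ε → ∀ u : W12 d N, ∫ x, h (toL2 d N u x) ^ 2 ∂(vol d N) ≤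
      (C * (energyE W ε u + ∫ x, h (toL2 d N u x) ∂(vol d N))) ^ ((d : ℝ) / (d - 1)) := by
  obtain ⟨C, hC, hCu⟩ := exists_eLpNorm_le_lintegral_grad (N := N) hd
  obtain ⟨k, hk, hkW⟩ := hW.exists_mul_sq_le
  have hd2 : (2 : ℝ) ≤ d := by exact_mod_cast hd
  set p : ℝ := d / (d - 1) with hp
  have hp0 : 0 < p := div_pos (by linarith) (by linarith)
  have hp2 : p ≤ 2 := by rw [hp, div_le_iff₀ (by linarith)]; linarith
  -- `W ≥ w ^ 2` where `|s| ≤ 1 / 2`, and outside that set the derivative of `h` vanishes.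
  set w := √(k / 4) with hw
  have hw0 : 0 < w := by positivity
  have hw2 : w ^ 2 = k / 4 := Real.sq_sqrt (by positivity)
  refine ⟨C * (K / w + 1), by positivity, fun ε hε u => ?_⟩
  -- Both sides are continuous on `W12`, so smooth functions suffice. The integrand is the square of
  -- `h(u)`, rather than the power `d / (d - 1)`, because it is the squared norm of a continuous map
  -- to L².
  refine UniformSpace.Completion.induction_on u (isClosed_le
    (continuous_integral_nemytskii_sq hh.lipschitz) ((continuous_const.mul
      ((hW.continuous_energyE ε).add (continuous_integral_nemytskii hh.lipschitz))).rpow_const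
        fun _ => Or.inr hp0.le)) fun u => ?_
  set v := u.comp h hh.contDiff with hv
  have hvc := v.contMDiff.continuous
  have e1 : ∫ x, h (toL2 d N (u : W12 d N) x) ∂(vol d N) = ∫ x, v.toFun x ∂(vol d N) := by
    refine integral_congr_ae ?_
    filter_upwards [coeFn_toL2_coe u] with x hx
    rw [hx]; rfl
  have e2 : ∫ x, h (toL2 d N (u : W12 d N) x) ^ 2 ∂(vol d N) =
      ∫ x, v.toFun x ^ 2 ∂(vol d N) := by
    refine integral_congr_ae ?_
    filter_upwards [coeFn_toL2_coe u] with x hx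
    rw [hx]; rfl
  have hv0 : ∀ x, 0 ≤ v.toFun x := fun x => hh.nonneg _
  have hv1 : ∀ x, v.toFun x ≤ 1 := fun x => hh.le_one _
  -- The Modica-Mortola trick: `w * |∇u|` is at most `ε / 2 * |∇u| ^ 2 + w ^ 2 / ε`, and `w ^ 2 ≤
  -- W(u)` where the derivative of the step is not zero.
  have hg : ∀ x, ‖grad (d := d) v.toFun x‖ ≤ K / w * (ε / 2 * ‖grad (d := d) u.toFun x‖ ^ 2 +
      ε⁻¹ * W (u.toFun x)) := by
    intro x
    have e : grad (d := d) v.toFun x = deriv h (u.toFun x) • grad (d := d) u.toFun x :=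
      grad_comp (hh.contDiff.differentiable (by simp)) (u.mdifferentiableAt x)
    rw [e, norm_smul, Real.norm_eq_abs]
    set t := ‖grad (d := d) u.toFun x‖ with ht
    have ht0 : 0 ≤ t := norm_nonneg _
    have hWn := hW.nonneg (u.toFun x)
    rcases lt_or_ge (1 / 2) |u.toFun x| with hs | hs
    · rw [hh.deriv_eq_zero hs, abs_zero, zero_mul]
      positivity
    · have h1 : w ^ 2 ≤ W (u.toFun x) := by
        rw [hw2]
        refine le_trans ?_ (hkW _)
        have h2 : 1 / 4 ≤ (|u.toFun x| - 1) ^ 2 := by nlinarith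
        linarith [mul_le_mul_of_nonneg_left h2 hk.le]
      have h2 : w * t ≤ ε / 2 * t ^ 2 + ε⁻¹ * W (u.toFun x) := by
        have h3 : w * t ≤ ε / 2 * t ^ 2 + ε⁻¹ * w ^ 2 := by
          have h4 : 0 ≤ ε⁻¹ / 2 * ((ε * t - w) ^ 2 + w ^ 2) := by positivity
          have e4 : ε⁻¹ / 2 * ((ε * t - w) ^ 2 + w ^ 2) = ε / 2 * t ^ 2 + ε⁻¹ * w ^ 2 - w * t := by
            field_simp; ring
          linarith
        have := mul_le_mul_of_nonneg_left h1 (inv_nonneg.2 hε.le)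
        linarith
      calc |deriv h (u.toFun x)| * t ≤ K * t :=
            mul_le_mul_of_nonneg_right (hh.abs_deriv_le _) ht0
        _ = K / w * (w * t) := by field_simp
        _ ≤ _ := mul_le_mul_of_nonneg_left h2 (by positivity)
  have hint1 : Integrable (fun x => ε / 2 * ‖grad (d := d) u.toFun x‖ ^ 2 +
      ε⁻¹ * W (u.toFun x)) (vol d N) := ((integrable_norm_grad_sq u).const_mul _).add
    ((integrable_vol (hW.contDiff.continuous.comp u.contMDiff.continuous)).const_mul _)
  have hJ : ∫ x, (‖grad (d := d) v.toFun x‖ + |v.toFun x|) ∂(vol d N) ≤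
      (K / w + 1) * (energyE W ε (u : W12 d N) + ∫ x, v.toFun x ∂(vol d N)) := by
    rw [integral_add (integrable_vol (continuous_norm_grad v)) (integrable_vol hvc.abs)]
    have h1 : ∫ x, ‖grad (d := d) v.toFun x‖ ∂(vol d N) ≤ K / w * energyE W ε (u : W12 d N) := by
      rw [energyE_coe hW, ← integral_const_mul]
      exact integral_mono (integrable_vol (continuous_norm_grad v)) (hint1.const_mul _) hg
    have h2 : ∫ x, |v.toFun x| ∂(vol d N) = ∫ x, v.toFun x ∂(vol d N) := by
      simp only [abs_of_nonneg (hv0 _)]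
    have h3 := hW.energyE_nonneg hε (u : W12 d N)
    have h4 : 0 ≤ ∫ x, v.toFun x ∂(vol d N) := integral_nonneg hv0
    have h5 : 0 ≤ K / w := by positivity
    rw [h2]
    nlinarith [mul_nonneg h5 h4]
  have hJ0 : 0 ≤ ∫ x, (‖grad (d := d) v.toFun x‖ + |v.toFun x|) ∂(vol d N) :=
    integral_nonneg fun x => by positivity
  have hS := hCu v
  have hi : Integrable (fun x => ‖grad (d := d) v.toFun x‖ + |v.toFun x|) (vol d N) :=
    integrable_vol ((continuous_norm_grad v).add hvc.abs)
  rw [← ofReal_integral_eq_lintegral_ofReal hi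
    (Eventually.of_forall fun x => by positivity), ← ENNReal.ofReal_mul hC.le,
    eLpNorm_eq_lintegral_rpow_enorm_toReal (by simpa using hp0) ENNReal.ofReal_ne_top,
    ENNReal.toReal_ofReal hp0.le, one_div, ENNReal.rpow_inv_le_iff hp0,
    ENNReal.ofReal_rpow_of_nonneg (by positivity) hp0.le] at hS
  -- Since `0 ≤ h ≤ 1` and `p ≤ 2`, `h ^ 2 ≤ h ^ p`.
  have hv2 : ENNReal.ofReal (∫ x, v.toFun x ^ 2 ∂(vol d N)) ≤ ∫⁻ x, ‖v.toFun x‖ₑ ^ p ∂(vol d N) := by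
    rw [← lintegral_enorm_sq_vol hvc]
    refine lintegral_mono fun x => ?_
    refine ENNReal.rpow_le_rpow_of_exponent_ge ?_ hp2
    rw [Real.enorm_eq_ofReal (hv0 x)]
    exact ENNReal.ofReal_le_one.2 (hv1 x)
  have hfin := hv2.trans hS
  rw [ENNReal.ofReal_le_ofReal_iff (by positivity)] at hfin
  rw [e1, e2]
  refine hfin.trans (Real.rpow_le_rpow (by positivity) ?_ hp0.le)
  rw [mul_assoc]
  exact mul_le_mul_of_nonneg_left hJ hC.le

/-- The energy barrier that separates the two wells. -/
theorem exists_barrier [Nonempty N] (hd : 2 ≤ d) {W : ℝ → ℝ} (hW : IsDoubleWell W) {h : ℝ → ℝ}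
    {K : ℝ≥0} (hh : IsSmoothStep h K) {g : N → ℝ} (hg : Continuous g) (hg0 : ∀ x, 0 ≤ g x) :
    ∃ r > 0, r < (vol d N).real univ ∧ ∃ ε₀ > 0, ∀ ε, 0 < ε → ε < ε₀ → ∀ u : W12 d N,
      ∫ x, h (toL2 d N u x) ∂(vol d N) = r → ∫ x, g x ∂(vol d N) + r ≤ energyF W g ε u := by
  obtain ⟨C, hC, hCu⟩ := exists_integral_step_sq_le (N := N) hd hW hh
  obtain ⟨k, hk, hkW⟩ := hW.exists_mul_sq_le
  obtain ⟨x₁, hx₁⟩ := hg.exists_forall_ge' (x₀ := Classical.arbitrary N) (by simp)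
  set V := (vol d N).real univ with hV
  have hV0 : 0 < V := vol_univ_pos d N
  set B := g x₁ with hB
  have hB0 : 0 ≤ B := hg0 _
  have hd2 : (2 : ℝ) ≤ d := by exact_mod_cast hd
  set p : ℝ := d / (d - 1) with hp
  have hp1 : 1 < p := by rw [hp, one_lt_div (by linarith)]; linarith
  -- In the end half of the energy is absorbed and the linear term costs at most `2 * B * r + r`; `M
  -- / 2 - 2 * B - 1 = 1` leaves exactly `r`.
  set M : ℝ := 4 * B + 4 with hM
  have hM0 : 0 < M := by positivity
  -- As `p > 1`, the left side is of higher order in `r`.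
  obtain ⟨r, hr0, hrV, hrp⟩ : ∃ r > 0, r < V ∧ (C * (M * r + r)) ^ p < r / 2 := by
    have ht : Tendsto (fun r : ℝ => (C * (M + 1)) ^ p * r ^ (p - 1)) (𝓝[>] 0) (𝓝 0) := by
      have h1 : Tendsto (fun r : ℝ => r ^ (p - 1)) (𝓝 0) (𝓝 0) := by
        have := (Real.continuous_rpow_const (by linarith : 0 ≤ p - 1)).tendsto 0
        rwa [Real.zero_rpow (by linarith)] at this
      simpa using (h1.mono_left nhdsWithin_le_nhds).const_mul ((C * (M + 1)) ^ p)
    have h2 := (ht.eventually_lt_const (show (0 : ℝ) < 1 / 2 by norm_num)).and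
      (Ioo_mem_nhdsGT hV0)
    obtain ⟨r, hr1, hr0, hrV⟩ := h2.exists
    refine ⟨r, hr0, hrV, ?_⟩
    have e1 : C * (M * r + r) = C * (M + 1) * r := by ring
    have e2 : r ^ p = r ^ (p - 1) * r := by
      rw [← Real.rpow_add_one hr0.ne']; ring_nf
    rw [e1, Real.mul_rpow (by positivity) hr0.le, e2, ← mul_assoc]
    nlinarith
  obtain ⟨C', hC', hCs⟩ := hW.exists_add_one_le hh (show 0 < r / (B * V + 1) by positivity)
  refine ⟨r, hr0, hrV, min (k / 8 / M) (1 / (2 * (B * C' + 1))), by positivity,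
    fun ε hε hε' u hu => ?_⟩
  have hε1 : ε * M ≤ k / 8 := ((lt_div_iff₀ hM0).1 (hε'.trans_le (min_le_left _ _))).le
  have hε2 : ε * (2 * (B * C' + 1)) ≤ 1 :=
    ((lt_div_iff₀ (by positivity)).1 (hε'.trans_le (min_le_right _ _))).le
  have hE0 := hW.energyE_nonneg hε u
  have hWE := integral_comp_le_energyE W hε u
  set f := toL2 d N u with hf
  have hint : Integrable (fun x => h (f x)) (vol d N) :=
    (integrable_L2 (nemytskii hh.lipschitz f)).congr (coeFn_nemytskii hh.lipschitz f)
  have hint2 : Integrable (fun x => h (f x) ^ 2) (vol d N) := by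
    refine (integrable_sq_L2 (nemytskii hh.lipschitz f)).congr ?_
    filter_upwards [coeFn_nemytskii hh.lipschitz f] with x hx
    rw [hx]
  have hWi := hW.integrable_comp (d := d) (N := N) f
  -- `h` and `h ^ 2` differ only where `|s| < 1 / 2`, and there `4 / k * W ≥ 1`.
  have hlow : r - 4 / k * ∫ x, W (f x) ∂(vol d N) ≤ ∫ x, h (f x) ^ 2 ∂(vol d N) := by
    rw [← hu, ← integral_const_mul, ← integral_sub hint (hWi.const_mul _)]
    refine integral_mono (hint.sub (hWi.const_mul _)) hint2 fun x => ?_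
    simp only
    rcases le_or_gt (1 / 2) |f x| with hs | hs
    · have h1 : 0 ≤ 4 / k * W (f x) := mul_nonneg (by positivity) (hW.nonneg _)
      rcases le_abs.1 hs with hs | hs
      · rw [hh.eq_one _ hs]; linarith
      · rw [hh.eq_zero _ (by linarith)]; linarith
    · have h1 : 1 ≤ 4 / k * W (f x) := by
        have h2 : k * (1 / 4) ≤ W (f x) := by
          refine le_trans (mul_le_mul_of_nonneg_left ?_ hk.le) (hkW _)
          nlinarith
        rw [div_mul_eq_mul_div, le_div_iff₀ hk]
        linarith
      linarith [hh.le_one (f x), sq_nonneg (h (f x))]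
  -- Otherwise the potential energy is so small that `∫ h(u) ^ 2 ≥ r / 2`, against the isoperimetric
  -- bound `(C * (M * r + r)) ^ p < r / 2`.
  have hbig : M * r < energyE W ε u := by
    by_contra! hcon
    have h1 := hCu ε hε u
    rw [← hf, hu] at h1
    have h2 : (C * (energyE W ε u + r)) ^ p ≤ (C * (M * r + r)) ^ p :=
      Real.rpow_le_rpow (by positivity) (by gcongr) (by linarith)
    have h3 : 4 / k * ∫ x, W (f x) ∂(vol d N) ≤ r / 2 := by
      have h4 : ∫ x, W (f x) ∂(vol d N) ≤ k / 8 * r := by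
        refine hWE.trans ((mul_le_mul_of_nonneg_left hcon hε.le).trans ?_)
        rw [← mul_assoc]
        exact mul_le_mul_of_nonneg_right hε1 hr0.le
      refine (mul_le_mul_of_nonneg_left h4 (by positivity)).trans (le_of_eq ?_)
      field_simp; norm_num
    linarith
  -- Relative to the constant -1, the linear term gains at most `2 * B * r` and two errors: one is
  -- at most `r`, the other at most half the energy for small ε.
  have hgu : ∫ x, g x * f x ∂(vol d N) ≤ -∫ x, g x ∂(vol d N) + B * (2 * r +
      r / (B * V + 1) * V + C' * ∫ x, W (f x) ∂(vol d N)) := by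
    have hi1 : Integrable (fun x => 2 * h (f x) + r / (B * V + 1)) (vol d N) :=
      (hint.const_mul 2).add (integrable_const _)
    have hi2 : Integrable (fun x => 2 * h (f x) + r / (B * V + 1) + C' * W (f x)) (vol d N) :=
      hi1.add (hWi.const_mul C')
    have hng : Integrable (fun x => -g x) (vol d N) := (integrable_vol hg).neg
    have e : ∫ x, (2 * h (f x) + r / (B * V + 1) + C' * W (f x)) ∂(vol d N) =
        2 * r + r / (B * V + 1) * V + C' * ∫ x, W (f x) ∂(vol d N) := by
      rw [integral_add hi1 (hWi.const_mul C'),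
        integral_add (hint.const_mul 2) (integrable_const _), integral_const_mul,
        integral_const_mul, hu, integral_const, smul_eq_mul, mul_comm V]
    rw [← e, ← integral_const_mul, ← integral_neg, ← integral_add hng (hi2.const_mul B)]
    refine integral_mono (integrable_mul_continuous hg f)
      (hng.add (hi2.const_mul B)) fun x => ?_
    have h1 := (hCs (f x)).1
    have h2 : 0 ≤ 2 * h (f x) + r / (B * V + 1) + C' * W (f x) := by
      have := hh.nonneg (f x); have := hW.nonneg (f x); positivity
    have h3 := mul_le_mul_of_nonneg_left h1 (hg0 x)
    have h4 := mul_le_mul_of_nonneg_right (hx₁ x) h2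
    linarith
  have hr' : r / (B * V + 1) * V * B ≤ r := by
    rw [div_mul_eq_mul_div, div_mul_eq_mul_div, div_le_iff₀ (by positivity)]
    nlinarith
  have hCW : B * (C' * ∫ x, W (f x) ∂(vol d N)) ≤ energyE W ε u / 2 := by
    have h1 : B * C' * ∫ x, W (f x) ∂(vol d N) ≤ B * C' * (ε * energyE W ε u) :=
      mul_le_mul_of_nonneg_left hWE (by positivity)
    have h2 : ε * (B * C') ≤ 1 / 2 := by linarith
    have h3 := mul_le_mul_of_nonneg_right h2 hE0
    linarith
  have hF : energyF W g ε u = energyE W ε u - ∫ x, g x * f x ∂(vol d N) := rfl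
  rw [hF]
  nlinarith
end Barrier

/-! ### Comparison of the functional with the energy -/

section EnergyBounds
open Filter Topology
open scoped ENNReal NNReal

variable {d : ℕ} {N : Type*} [TopologicalSpace N] [ChartedSpace (EuclideanSpace ℝ (Fin d)) N]
  [RiemannianBundle (fun x : N => TangentSpace (𝓡 d) x)]
  [MeasurableSpace N] [BorelSpace N] [IsManifold (𝓡 d) ∞ N]
  [IsContMDiffRiemannianBundle (𝓡 d) ∞ (EuclideanSpace ℝ (Fin d))
    (fun x : N => TangentSpace (𝓡 d) x)] [T2Space N] [CompactSpace N]

theorem coeFn_toL2_constFn (z : ℝ) :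
    toL2 d N (constFn d N z : W12 d N) =ᵐ[vol d N] fun _ => z := coeFn_toL2_coe _

theorem inner_constFn (u : W12 d N) (z : ℝ) : inner ℝ u (constFn d N z : W12 d N) =
    inner ℝ (toL2 d N u) (toL2 d N (constFn d N z : W12 d N)) := by
  refine UniformSpace.Completion.induction_on u (isClosed_eq (by fun_prop) (by fun_prop))
    fun u => ?_
  have h : inner ℝ u (constFn d N z) = sobolevInner u (constFn d N z) := rfl
  rw [UniformSpace.Completion.inner_coe, h, inner_L2_eq, sobolevInner]
  refine integral_congr_ae ?_
  filter_upwards [coeFn_toL2_coe u, coeFn_toL2_constFn (d := d) (N := N) z] with x h1 h2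
  have h3 : grad (d := d) (constFn d N z).toFun x = 0 := grad_const z x
  rw [h1, h2, h3, inner_zero_right, add_zero]
  rfl

/-- Constants have no gradient, so testing the equation of a critical point with `u - z` produces
the Dirichlet integral of `u`. -/
theorem dirichlet_eq_inner (u : W12 d N) (z : ℝ) :
    dirichlet u = inner ℝ u (u - constFn d N z) -
      inner ℝ (toL2 d N u) (toL2 d N (u - constFn d N z)) := by
  rw [map_sub, inner_sub_right, inner_sub_right, inner_constFn, dirichlet,
    real_inner_self_eq_norm_sq, real_inner_self_eq_norm_sq]
  ring

/-- Critical points that are `O(ε)` close to a well have energy `O(ε)`. -/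
theorem IsDoubleWell.exists_energyE_le_of_near {W : ℝ → ℝ} (hW : IsDoubleWell W) [Nonempty N]
    {g : N → ℝ} (hg : Continuous g) (hg0 : ∀ x, 0 ≤ g x) {z : ℝ} (hz : W z = 0) (c : ℝ) :
    ∃ C, 0 ≤ C ∧ ∀ ε, 0 < ε → ∀ a : W12 d N, IsCriticalPoint W g ε a →
      (∀ᵐ x ∂(vol d N), z < toL2 d N a x ∧ toL2 d N a x < z + c * ε) →
      energyE W ε a ≤ C * ε := by
  obtain ⟨K, hK⟩ := hW.exists_lipschitzWith_deriv
  obtain ⟨x₁, hx₁⟩ := hg.exists_forall_ge' (x₀ := Classical.arbitrary N) (by simp)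
  have hdz := hW.deriv_eq_zero hz
  set V := (vol d N).real univ with hV
  have hB0 : 0 ≤ g x₁ := hg0 x₁
  refine ⟨((g x₁ + K * |c|) * |c|) * V + K * c ^ 2 * V, by positivity, fun ε hε a ha hab => ?_⟩
  have hgrad := (isCriticalPoint_iff hW.hasDerivAt hK hg hε a).1 ha
  -- Tested with `a - z`, the equation reads `ε ∫|∇a|² = ∫ (g - W'(a)/ε)(a - z)`. The bracket is
  -- bounded above because `W'(a) = O(ε)`, and `a - z` is between 0 and `|c| * ε`.
  have h0 : inner ℝ (modelGrad (toL2 d N) hK (continuousL2 d g hg) ε a)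
      (a - constFn d N z) = 0 := by rw [hgrad, inner_zero_left]
  rw [inner_modelGrad, ← dirichlet_eq_inner, inner_L2_eq, inner_continuousL2,
    ← integral_const_mul] at h0
  set f := toL2 d N a with hf
  set k := toL2 d N (a - constFn d N z) with hk
  have hkf : ∀ᵐ x ∂(vol d N), k x = f x - z := by
    rw [hk, map_sub]
    filter_upwards [Lp.coeFn_sub f (toL2 d N (constFn d N z : W12 d N)),
      coeFn_toL2_constFn (d := d) (N := N) z] with x h1 h2
    rw [h1, Pi.sub_apply, h2]
  have hcε : ∀ᵐ x ∂(vol d N), 0 < k x ∧ k x ≤ |c| * ε := by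
    filter_upwards [hkf, hab] with x h1 h2
    rw [h1]
    exact ⟨by linarith, by linarith [mul_le_mul_of_nonneg_right (le_abs_self c) hε.le]⟩
  have hi1 := (integrable_mul_L2 (nemytskii hK f) k).const_mul ε⁻¹
  have hi2 := integrable_mul_continuous hg k
  have hD : ε * dirichlet a ≤ ((g x₁ + K * |c|) * |c|) * V * ε := by
    have e : ε * dirichlet a = ∫ x, (g x * k x - ε⁻¹ * (nemytskii hK f x * k x)) ∂(vol d N) := by
      rw [integral_sub hi2 hi1]; linarith
    rw [e]
    have hb : ∫ x, (g x * k x - ε⁻¹ * (nemytskii hK f x * k x)) ∂(vol d N) ≤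
        ∫ _, (g x₁ + K * |c|) * (|c| * ε) ∂(vol d N) := by
      refine integral_mono_ae (hi2.sub hi1) (integrable_const _) ?_
      filter_upwards [hkf, hcε, coeFn_nemytskii hK f] with x h1 h2 h3
      have h4 := hK.dist_le_mul (f x) z
      rw [Real.dist_eq, Real.dist_eq, hdz, sub_zero, ← h1, abs_of_pos h2.1] at h4
      have h5 : -(nemytskii hK f x) ≤ K * (|c| * ε) := by
        rw [h3]
        exact (neg_le_abs _).trans (h4.trans (mul_le_mul_of_nonneg_left h2.2 K.2))
      have h6 : g x - ε⁻¹ * nemytskii hK f x ≤ g x₁ + K * |c| := by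
        have := mul_le_mul_of_nonneg_left h5 (inv_nonneg.2 hε.le)
        have e2 : ε⁻¹ * (K * (|c| * ε)) = K * |c| := by field_simp
        linarith [hx₁ x]
      calc g x * k x - ε⁻¹ * (nemytskii hK f x * k x) = (g x - ε⁻¹ * nemytskii hK f x) * k x := by
            ring
        _ ≤ (g x₁ + K * |c|) * k x := mul_le_mul_of_nonneg_right h6 h2.1.le
        _ ≤ _ := mul_le_mul_of_nonneg_left h2.2 (by positivity)
    refine hb.trans (le_of_eq ?_)
    rw [integral_const, smul_eq_mul]; ring
  have hP : ε⁻¹ * ∫ x, W (f x) ∂(vol d N) ≤ K * c ^ 2 * V * ε := by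
    have hb : ∫ x, W (f x) ∂(vol d N) ≤ ∫ _, K * (|c| * ε) ^ 2 ∂(vol d N) := by
      refine integral_mono_ae (hW.integrable_comp f) (integrable_const _) ?_
      filter_upwards [hkf, hcε] with x h1 h2
      have h3 := abs_sub_sub_le_of_lipschitz_deriv hW.hasDerivAt hK z (k x)
      rw [hdz, hz, h1, add_sub_cancel, ← h1] at h3
      have h4 : k x ^ 2 ≤ (|c| * ε) ^ 2 := pow_le_pow_left₀ h2.1.le h2.2 2
      have h5 := mul_le_mul_of_nonneg_left h4 K.2
      have h6 := (abs_le.1 h3).2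
      simp only [zero_mul, sub_zero] at h6
      exact h6.trans h5
    rw [integral_const, smul_eq_mul] at hb
    refine (mul_le_mul_of_nonneg_left hb (inv_nonneg.2 hε.le)).trans (le_of_eq ?_)
    rw [mul_pow, sq_abs]; field_simp
    rw [hV]; ring
  have hD0 := mul_nonneg hε.le (dirichlet_nonneg a)
  unfold energyE
  linarith

/-- This is why the comparison paths below are kept above -1: along them `-∫ g u` exceeds its value
`∫ g` at -1 nowhere. -/
theorem energyF_le_of_ge {W : ℝ → ℝ} {g : N → ℝ} (hg : Continuous g) (hg0 : ∀ x, 0 ≤ g x) {ε : ℝ}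
    {u : W12 d N} (hu : ∀ᵐ x ∂(vol d N), -1 ≤ toL2 d N u x) :
    energyF W g ε u ≤ energyE W ε u + ∫ x, g x ∂(vol d N) := by
  have h : -∫ x, g x ∂(vol d N) ≤ ∫ x, g x * toL2 d N u x ∂(vol d N) := by
    rw [← integral_neg]
    refine integral_mono_ae (integrable_vol hg).neg (integrable_mul_continuous hg _) ?_
    filter_upwards [hu] with x hx
    nlinarith [hg0 x]
  unfold energyF
  linarith

/-- Functions of small energy do not reach the barrier. -/
theorem IsDoubleWell.exists_energyF_lt_of_energyE_lt [Nonempty N] {W : ℝ → ℝ}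
    (hW : IsDoubleWell W) {g : N → ℝ} (hg : Continuous g) (hg0 : ∀ x, 0 ≤ g x) {δ : ℝ}
    (hδ : 0 < δ) :
    ∃ L > 0, ∀ ε, 0 < ε → ε < 1 → ∀ u : W12 d N, energyE W ε u < L →
      energyF W g ε u < ∫ x, g x ∂(vol d N) + δ := by
  obtain ⟨h, K, hh⟩ := exists_isSmoothStep
  obtain ⟨x₁, hx₁⟩ := hg.exists_forall_ge' (x₀ := Classical.arbitrary N) (by simp)
  set V := (vol d N).real univ with hV
  set B := g x₁ with hB
  have hB0 : 0 ≤ B := hg0 _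
  have hV0 : 0 ≤ V := measureReal_nonneg
  obtain ⟨C, hC, hCs⟩ := hW.exists_add_one_le hh (show 0 < δ / (2 * (B * V + 1)) by positivity)
  set η := δ / (2 * (B * V + 1)) with hη
  have hη0 : 0 < η := by positivity
  -- Half of `δ` is spent on the error `η`, the other half on the energy and its multiple `B * C`.
  refine ⟨δ / (2 * (1 + B * C)), by positivity, fun ε hε hε1 u hu => ?_⟩
  have hE0 := hW.energyE_nonneg hε u
  have hWE := integral_comp_le_energyE W hε u
  set f := toL2 d N u with hf
  have hWi := hW.integrable_comp (d := d) (N := N) f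
  have h1 : -(∫ x, g x ∂(vol d N) + B * (η * V + C * ∫ x, W (f x) ∂(vol d N))) ≤
      ∫ x, g x * f x ∂(vol d N) := by
    have hi : Integrable (fun x => η + C * W (f x)) (vol d N) :=
      (integrable_const _).add (hWi.const_mul C)
    have e : ∫ x, (η + C * W (f x)) ∂(vol d N) = η * V + C * ∫ x, W (f x) ∂(vol d N) := by
      rw [integral_add (integrable_const _) (hWi.const_mul C), integral_const_mul, integral_const,
        smul_eq_mul, mul_comm V]
    rw [← e, ← integral_const_mul, ← integral_add (integrable_vol hg) (hi.const_mul B),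
      ← integral_neg]
    refine integral_mono ((integrable_vol hg).add (hi.const_mul B)).neg
      (integrable_mul_continuous hg f) fun x => ?_
    simp only
    have h2 : 0 ≤ η + C * W (f x) := by have := hW.nonneg (f x); positivity
    have h3 := mul_le_mul_of_nonneg_left (hCs (f x)).2 (hg0 x)
    have h4 := mul_le_mul_of_nonneg_right (hx₁ x) h2
    linarith
  have h2 : B * (η * V) ≤ δ / 2 := by
    have : B * (η * V) = δ / 2 * (B * V / (B * V + 1)) := by rw [hη]; field_simp
    rw [this]
    refine mul_le_of_le_one_right (by positivity) ?_
    rw [div_le_one (by positivity)]; linarith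
  have h3 : ∫ x, W (f x) ∂(vol d N) ≤ energyE W ε u :=
    hWE.trans (mul_le_of_le_one_left hE0 hε1.le)
  have h4 : B * (C * ∫ x, W (f x) ∂(vol d N)) ≤ B * C * energyE W ε u := by
    rw [← mul_assoc]; exact mul_le_mul_of_nonneg_left h3 (by positivity)
  have h5 : energyE W ε u * (1 + B * C) < δ / 2 := by
    rw [lt_div_iff₀ (by positivity)] at hu
    linarith
  have hF : energyF W g ε u = energyE W ε u - ∫ x, g x * f x ∂(vol d N) := rfl
  rw [hF]
  linarith

/-- The functional controls the energy. -/
theorem IsDoubleWell.exists_energyE_le [Nonempty N] {W : ℝ → ℝ} (hW : IsDoubleWell W) {g : N → ℝ}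
    (hg : Continuous g) (hg0 : ∀ x, 0 ≤ g x) :
    ∃ ε₀ > 0, ∃ C, ∀ ε, 0 < ε → ε < ε₀ → ∀ u : W12 d N,
      energyE W ε u ≤ 2 * energyF W g ε u + C := by
  obtain ⟨κ, hκ, C, hC⟩ := hW.exists_quadratic_le
  obtain ⟨x₁, hx₁⟩ := hg.exists_forall_ge' (x₀ := Classical.arbitrary N) (by simp)
  set V := (vol d N).real univ with hV
  set B := g x₁ with hB
  have hB0 : 0 ≤ B := hg0 _
  refine ⟨κ / (2 * (B + 1)), by positivity, 2 * (B * ((1 + |C| / κ) * V)), fun ε hε hε' u => ?_⟩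
  have hE0 := hW.energyE_nonneg hε u
  have hWE := integral_comp_le_energyE W hε u
  set f := toL2 d N u with hf
  have hWi := hW.integrable_comp (d := d) (N := N) f
  -- Quadratic growth bounds `s` by a constant plus a multiple of `W s`; for small ε the resulting
  -- `∫ W(u)` is absorbed in half the energy.
  have hs : ∀ s, s ≤ 1 + |C| / κ + κ⁻¹ * W s := fun s => by
    have h1 : κ * s ^ 2 ≤ |C| + W s := by linarith [hC s, le_abs_self C]
    have h2 : s ^ 2 ≤ |C| / κ + κ⁻¹ * W s := by
      have := mul_le_mul_of_nonneg_left h1 (inv_nonneg.2 hκ.le)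
      rw [← mul_assoc, inv_mul_cancel₀ hκ.ne', one_mul, mul_add] at this
      rw [div_eq_inv_mul]; exact this
    nlinarith [sq_nonneg (s - 1), sq_nonneg s]
  have h1 : ∫ x, g x * f x ∂(vol d N) ≤
      B * ((1 + |C| / κ) * V + κ⁻¹ * ∫ x, W (f x) ∂(vol d N)) := by
    have hi : Integrable (fun x => 1 + |C| / κ + κ⁻¹ * W (f x)) (vol d N) :=
      (integrable_const _).add (hWi.const_mul _)
    have e : ∫ x, (1 + |C| / κ + κ⁻¹ * W (f x)) ∂(vol d N) =
        (1 + |C| / κ) * V + κ⁻¹ * ∫ x, W (f x) ∂(vol d N) := by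
      rw [integral_add (integrable_const _) (hWi.const_mul _), integral_const_mul, integral_const,
        smul_eq_mul, mul_comm V]
    rw [← e, ← integral_const_mul]
    refine integral_mono (integrable_mul_continuous hg f) (hi.const_mul B) fun x => ?_
    simp only
    have h2 : 0 ≤ 1 + |C| / κ + κ⁻¹ * W (f x) := by have := hW.nonneg (f x); positivity
    exact (mul_le_mul_of_nonneg_left (hs (f x)) (hg0 x)).trans
      (mul_le_mul_of_nonneg_right (hx₁ x) h2)
  have h2 : B * (κ⁻¹ * ∫ x, W (f x) ∂(vol d N)) ≤ energyE W ε u / 2 := by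
    have h3 : B * κ⁻¹ * ε ≤ 1 / 2 := by
      rw [lt_div_iff₀ (by positivity)] at hε'
      rw [← div_eq_mul_inv, div_mul_eq_mul_div, div_le_iff₀ hκ]
      nlinarith
    have h4 : B * κ⁻¹ * ∫ x, W (f x) ∂(vol d N) ≤ B * κ⁻¹ * (ε * energyE W ε u) :=
      mul_le_mul_of_nonneg_left hWE (by positivity)
    have h5 := mul_le_mul_of_nonneg_right h3 hE0
    linarith
  have hF : energyF W g ε u = energyE W ε u - ∫ x, g x * f x ∂(vol d N) := rfl
  rw [hF]
  linarith

end EnergyBounds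

/-! ### Functions whose level sets have thin layers of small volume -/

section SweepFunctions
open Filter Topology
open scoped ENNReal NNReal

theorem pow_sub_pow_le {x y : ℝ} (hx : 0 ≤ x) (hxy : x ≤ y) (hy : y ≤ 1) (d : ℕ) :
    y ^ (d + 2) - x ^ (d + 2) ≤ (d + 1) * (y ^ 2 - x ^ 2) := by
  induction d with
  | zero => simp
  | succ d ih =>
    have h1 : x ^ (d + 2) ≤ x := pow_le_of_le_one hx (hxy.trans hy) (by omega)
    have h2 : y ^ (d + 1 + 2) - x ^ (d + 1 + 2) =
        y * (y ^ (d + 2) - x ^ (d + 2)) + x ^ (d + 2) * (y - x) := by ring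
    have h3 : 0 ≤ y ^ (d + 2) - x ^ (d + 2) := sub_nonneg.2 (pow_le_pow_left₀ hx hxy _)
    have h4 : x ^ (d + 2) * (y - x) ≤ x * (y - x) :=
      mul_le_mul_of_nonneg_right h1 (sub_nonneg.2 hxy)
    rw [h2]
    push_cast
    nlinarith [mul_le_of_le_one_left h3 hy, mul_nonneg (hx.trans hxy) (sub_nonneg.2 hxy)]

/-- The radii are square roots because the level functions are squared distances, which are smooth
at the centre. The volume of a ball is Lipschitz in the square of the radius near 0 only in
dimension at least 2. -/
theorem measure_annulus_le {E : Type*} [NormedAddCommGroup E] [NormedSpace ℝ E] [MeasurableSpace E]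
    [BorelSpace E] [FiniteDimensional ℝ E] (μ : Measure E) [μ.IsAddHaarMeasure]
    (hE : 2 ≤ Module.finrank ℝ E) (x : E) {ρ : ℝ} (hρ : 0 < ρ) :
    ∃ C : ℝ, 0 < C ∧ ∀ A B : ℝ, 0 ≤ A → A ≤ B → B ≤ 1 →
      μ (Metric.closedBall x (ρ * √B) \ Metric.ball x (ρ * √A)) ≤ ENNReal.ofReal (C * (B - A)) := by
  have : Nontrivial E := Module.nontrivial_of_finrank_pos (R := ℝ) (by omega)
  obtain ⟨k, hk⟩ := Nat.exists_eq_add_of_le' hE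
  set m := (μ (Metric.ball (0 : E) 1)).toReal with hm
  have hm' : μ (Metric.ball (0 : E) 1) = ENNReal.ofReal m :=
    (ENNReal.ofReal_toReal measure_ball_lt_top.ne).symm
  have hm0 : 0 ≤ m := ENNReal.toReal_nonneg
  refine ⟨ρ ^ (k + 2) * (k + 1) * m + 1, by positivity, fun A B hA hAB hB => ?_⟩
  have hsub : Metric.ball x (ρ * √A) ⊆ Metric.closedBall x (ρ * √B) :=
    (Metric.ball_subset_ball (by gcongr)).trans Metric.ball_subset_closedBall
  rw [measure_sdiff hsub measurableSet_ball.nullMeasurableSet measure_ball_lt_top.ne,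
    Measure.addHaar_closedBall μ x (by positivity), Measure.addHaar_ball μ x (by positivity), hm',
    ← ENNReal.ofReal_mul (by positivity), ← ENNReal.ofReal_mul (by positivity),
    ← ENNReal.ofReal_sub _ (by positivity), hk]
  refine ENNReal.ofReal_le_ofReal ?_
  have h1 := pow_sub_pow_le (Real.sqrt_nonneg A) (Real.sqrt_le_sqrt hAB) (Real.sqrt_le_one.2 hB) k
  rw [Real.sq_sqrt hA, Real.sq_sqrt (hA.trans hAB)] at h1
  have h2 := mul_le_mul_of_nonneg_left h1 (show 0 ≤ ρ ^ (k + 2) * m by positivity)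
  rw [mul_pow, mul_pow]
  nlinarith

variable {d : ℕ} {N : Type*} [TopologicalSpace N] [ChartedSpace (EuclideanSpace ℝ (Fin d)) N]
  [RiemannianBundle (fun x : N => TangentSpace (𝓡 d) x)]
  [MeasurableSpace N] [BorelSpace N] [IsManifold (𝓡 d) ∞ N]
  [IsContMDiffRiemannianBundle (𝓡 d) ∞ (EuclideanSpace ℝ (Fin d))
    (fun x : N => TangentSpace (𝓡 d) x)] [T2Space N] [CompactSpace N]

/-- Smooth functions whose level sets up to the level `3/4` sweep out a neighbourhood of a point, with
layers of volume proportional to their height. -/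
theorem exists_sweep_function (hd : 2 ≤ d) (c : N) :
    ∃ (f : SmoothFn d N) (C : ℝ), 0 ≤ C ∧ (∀ x, 0 ≤ f.toFun x) ∧ f.toFun c = 0 ∧
      ∀ t ε : ℝ, t ≤ 1 / 2 → 0 < ε → ε < 1 / 2 →
        (vol d N).real {x | |f.toFun x - t| ≤ ε / 2} ≤ C * ε := by
  set e := chartAt (EuclideanSpace ℝ (Fin d)) c with he
  have hext : ∀ x, extChartAt (𝓡 d) c x = e x := fun x => by simp [extChartAt, he]
  have hextt : (extChartAt (𝓡 d) c).target = e.target := by simp [extChartAt, he]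
  have hdist : ∀ x, dist (extChartAt (𝓡 d) c x) (extChartAt (𝓡 d) c c) = ‖e x - e c‖ := fun x => by
    rw [hext, hext, dist_eq_norm]
  obtain ⟨χ⟩ : Nonempty (SmoothBumpFunction (𝓡 d) c) := inferInstance
  set ρ := χ.rIn with hρ
  have hρ0 : 0 < ρ := χ.rIn_pos
  have hball : Metric.closedBall (e c) ρ ⊆ e.target := by
    have h := χ.closedBall_subset
    rw [hextt] at h
    have hd : ∀ y, dist y (extChartAt (𝓡 d) c c) = dist y (e c) := fun y => by rw [hext]
    exact fun y hy => h ⟨Metric.mem_closedBall.2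
      ((hd y).trans_le ((Metric.mem_closedBall.1 hy).trans χ.rIn_lt_rOut.le)), by simp⟩
  have hce : c ∈ e.source := mem_chart_source _ c
  have hsm : ContMDiff (𝓡 d) 𝓘(ℝ, ℝ) ∞ fun x => χ x • (‖e x - e c‖ ^ 2 / ρ ^ 2) := by
    refine χ.contMDiff_smul ?_
    have h1 : ContMDiffOn (𝓡 d) 𝓘(ℝ, EuclideanSpace ℝ (Fin d)) ∞ e e.source := contMDiffOn_chart
    have h2 : ContDiff ℝ ∞ fun y : EuclideanSpace ℝ (Fin d) => ‖y - e c‖ ^ 2 / ρ ^ 2 :=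
      ((contDiff_id.sub contDiff_const).norm_sq ℝ).div_const _
    exact h2.contMDiff.comp_contMDiffOn h1
  -- On the coordinate ball of radius `ρ` this is the rescaled squared distance; elsewhere it
  -- interpolates between 1 and something at least 1. So the set where `f < 1` is that ball, and
  -- lower levels never see the cutoff.
  set f : SmoothFn d N := SmoothFn.mk (fun x => (1 - χ x) + χ x • (‖e x - e c‖ ^ 2 / ρ ^ 2))
    ((contMDiff_const.sub χ.contMDiff).add hsm) with hf
  have hfx : ∀ x, f.toFun x = (1 - χ x) + χ x * (‖e x - e c‖ ^ 2 / ρ ^ 2) := fun x => rfl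
  have hin : ∀ x, f.toFun x < 1 → x ∈ e.source ∧ ‖e x - e c‖ < ρ ∧
      f.toFun x = ‖e x - e c‖ ^ 2 / ρ ^ 2 := by
    intro x hx
    have h1 : χ x ≠ 0 := fun h => by rw [hfx, h] at hx; simp at hx
    have h2 : x ∈ e.source := χ.support_subset_source h1
    have h3 : ‖e x - e c‖ < ρ := by
      by_contra! hcon
      have h4 : 1 ≤ ‖e x - e c‖ ^ 2 / ρ ^ 2 := by
        rw [one_le_div (by positivity)]; exact pow_le_pow_left₀ hρ0.le hcon 2
      have h5 := mul_le_mul_of_nonneg_left h4 (χ.nonneg (x := x))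
      rw [hfx] at hx
      linarith
    refine ⟨h2, h3, ?_⟩
    rw [hfx, χ.one_of_dist_le h2 ((hdist x).trans_le h3.le)]
    ring
  set A := e.symm '' Metric.closedBall (e c) ρ with hA
  have hAc : IsCompact A := (isCompact_closedBall (e c) ρ).image_of_continuousOn
    (e.continuousOn_symm.mono hball)
  have hAs : A ⊆ e.source := (e.mapsTo_symm.mono_left hball).image_subset
  have hAe : e '' A = Metric.closedBall (e c) ρ := by
    rw [hA, image_image]
    exact (image_congr fun y hy => e.right_inv (hball hy)).trans (image_id' _)
  obtain ⟨C₁, hC₁, h₁⟩ := exists_setLIntegral_vol_le c hAc hAs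
  obtain ⟨C₂, hC₂, h₂⟩ := measure_annulus_le (volume : Measure (EuclideanSpace ℝ (Fin d)))
    (by rwa [finrank_euclideanSpace_fin]) (e c) hρ0
  refine ⟨f, C₁ * C₂, by positivity, fun x => ?_, ?_, fun t ε ht hε hε2 => ?_⟩
  · rw [hfx]
    have := χ.nonneg (x := x)
    have := χ.le_one (x := x)
    have : 0 ≤ χ x * (‖e x - e c‖ ^ 2 / ρ ^ 2) := by positivity
    linarith
  · rw [hfx, χ.one_of_dist_le hce (by simpa using hρ0.le)]
    simp
  set S := {x | |f.toFun x - t| ≤ ε / 2} with hS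
  have hSm : MeasurableSet S :=
    (isClosed_le ((f.contMDiff.continuous.sub continuous_const).abs) continuous_const).measurableSet
  have hlt : ∀ x ∈ S, f.toFun x < 1 := fun x hx => by
    have := (abs_le.1 (show |f.toFun x - t| ≤ ε / 2 from hx)).2
    linarith
  have hSA : S ⊆ A := fun x hx => by
    obtain ⟨k1, k2, -⟩ := hin x (hlt x hx)
    exact ⟨e x, by rw [Metric.mem_closedBall, dist_eq_norm]; exact k2.le, e.left_inv k1⟩
  rcases lt_or_ge (t + ε / 2) 0 with htneg | htpos
  · have : S = ∅ := by
      ext x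
      simp only [hS, mem_ofPred_eq, mem_empty_iff_false, iff_false, not_le]
      have h0 : 0 ≤ f.toFun x := by
        rw [hfx]
        have := χ.nonneg (x := x)
        have := χ.le_one (x := x)
        have : 0 ≤ χ x * (‖e x - e c‖ ^ 2 / ρ ^ 2) := by positivity
        linarith
      exact lt_abs.2 (Or.inl (by linarith))
    rw [this]
    simp only [measureReal_empty]
    positivity
  have key := (h₁ (S.indicator 1) (measurable_one.indicator hSm)).1
  rw [lintegral_indicator_one₀ hSm.nullMeasurableSet, Measure.restrict_apply hSm,
    inter_eq_left.2 hSA, ← he, hAe] at key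
  have hle : ∫⁻ y in Metric.closedBall (e c) ρ, S.indicator (1 : N → ℝ≥0∞) (e.symm y) ≤
      volume (Metric.closedBall (e c) (ρ * √(t + ε / 2)) \
        Metric.ball (e c) (ρ * √(max (t - ε / 2) 0))) := by
    rw [← lintegral_indicator_one (measurableSet_closedBall.diff measurableSet_ball),
      ← lintegral_indicator measurableSet_closedBall]
    refine lintegral_mono fun y => ?_
    by_cases hy : y ∈ Metric.closedBall (e c) ρ
    swap
    · rw [indicator_of_notMem hy]; exact zero_le
    rw [indicator_of_mem hy]
    by_cases hyS : e.symm y ∈ S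
    swap
    · rw [indicator_of_notMem hyS]; exact zero_le
    rw [indicator_of_mem hyS, indicator_of_mem]
    · rfl
    obtain ⟨-, -, k3⟩ := hin _ (hlt _ hyS)
    have k4 := abs_le.1 (show |f.toFun (e.symm y) - t| ≤ ε / 2 from hyS)
    rw [k3, e.right_inv (hball hy)] at k4
    have hy2 : ‖y - e c‖ = ρ * √(‖y - e c‖ ^ 2 / ρ ^ 2) := by
      rw [Real.sqrt_div (sq_nonneg _), Real.sqrt_sq (norm_nonneg _), Real.sqrt_sq hρ0.le]
      field_simp
    refine ⟨?_, ?_⟩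
    · rw [Metric.mem_closedBall, dist_eq_norm, hy2]
      gcongr
      linarith
    · rw [Metric.mem_ball, dist_eq_norm, hy2, not_lt]
      gcongr
      exact max_le (by linarith) (by positivity)
  have h3 := h₂ (max (t - ε / 2) 0) (t + ε / 2) (le_max_right _ _)
    (max_le (by linarith) htpos) (by linarith)
  have h4 : C₂ * (t + ε / 2 - max (t - ε / 2) 0) ≤ C₂ * ε :=
    mul_le_mul_of_nonneg_left (by linarith [le_max_left (t - ε / 2) 0]) hC₂.le
  have h5 := key.trans (mul_le_mul_right (hle.trans (h3.trans (ENNReal.ofReal_le_ofReal h4))) _)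
  rw [← ENNReal.ofReal_mul hC₁.le] at h5
  rw [mul_assoc]
  exact ENNReal.toReal_le_of_le_ofReal (by positivity) h5

/-- By compactness finitely many sets `f c < 1 / 4` cover `N`. The level `1 / 4` is strictly below
the last sweeping level `1 / 2`, which leaves room for the width of the interface. -/
theorem exists_sweep_family (hd : 2 ≤ d) : ∃ (s : Finset N) (f : N → SmoothFn d N) (C : ℝ), 0 ≤ C ∧
    (∀ c x, 0 ≤ (f c).toFun x) ∧ (∀ x, ∃ c ∈ s, (f c).toFun x < 1 / 4) ∧
    ∀ c ∈ s, ∀ t ε : ℝ, t ≤ 1 / 2 → 0 < ε → ε < 1 / 2 →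
      (vol d N).real {x | |(f c).toFun x - t| ≤ ε / 2} ≤ C * ε := by
  choose f C hC hf0 hfc hf using exists_sweep_function (d := d) (N := N) hd
  obtain ⟨s, hs⟩ := (isCompact_univ (X := N)).elim_finite_subcover
    (fun c => {x | (f c).toFun x < 1 / 4})
    (fun c => isOpen_lt (f c).contMDiff.continuous continuous_const)
    (fun x _ => mem_iUnion.2 ⟨x, by simp [hfc]⟩)
  refine ⟨s, f, ∑ c ∈ s, C c, Finset.sum_nonneg fun c _ => hC c, hf0, fun x => ?_,
    fun c hc t ε ht hε hε2 => (hf c t ε ht hε hε2).trans ?_⟩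
  · obtain ⟨c, hc, hx⟩ := mem_iUnion₂.1 (hs (mem_univ x))
    exact ⟨c, hc, hx⟩
  · exact mul_le_mul_of_nonneg_right (Finset.single_le_sum (f := C) (fun c _ => hC c) hc) hε.le

end SweepFunctions

/-! ### The sweepout from -1 to 1 -/

section Sweepout
open Filter Topology
open scoped ENNReal NNReal

theorem IsSmoothStep.exists_lipschitzWith_deriv {h : ℝ → ℝ} {K : ℝ≥0} (hh : IsSmoothStep h K) :
    ∃ K', LipschitzWith K' (deriv h) := by
  refine ContDiff.lipschitzWith_of_hasCompactSupport (𝕂 := ℝ) (n := ∞)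
    (HasCompactSupport.intro (isCompact_Icc (a := -1 / 2) (b := 1 / 2)) fun s hs => ?_)
    (ContDiff.deriv' (by simpa using hh.contDiff)) (by simp)
  refine hh.deriv_eq_zero ?_
  rw [mem_Icc, not_and_or, not_le, not_le] at hs
  rcases hs with hs | hs
  · exact lt_abs.2 (Or.inr (by linarith))
  · exact lt_abs.2 (Or.inl hs)

variable {d : ℕ} {N : Type*} [TopologicalSpace N] [ChartedSpace (EuclideanSpace ℝ (Fin d)) N]
  [RiemannianBundle (fun x : N => TangentSpace (𝓡 d) x)]
  [MeasurableSpace N] [BorelSpace N] [IsManifold (𝓡 d) ∞ N]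
  [IsContMDiffRiemannianBundle (𝓡 d) ∞ (EuclideanSpace ℝ (Fin d))
    (fun x : N => TangentSpace (𝓡 d) x)] [T2Space N] [CompactSpace N]

/-- Families of smooth functions that are bounded and Lipschitz in the `C¹` norm. -/
structure IsC1Lipschitz (v : ℝ → SmoothFn d N) (L : ℝ) : Prop where
  abs_le : ∀ t x, |(v t).toFun x| ≤ L
  grad_le : ∀ t x, ‖grad (d := d) (v t).toFun x‖ ≤ L
  abs_sub_le : ∀ t s x, |(v t).toFun x - (v s).toFun x| ≤ L * |t - s|
  grad_sub_le : ∀ t s x, ‖grad (d := d) (v t).toFun x - grad (d := d) (v s).toFun x‖ ≤ L * |t - s|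

/-- The product of smooth functions. -/
def SmoothFn.mul (u v : SmoothFn d N) : SmoothFn d N :=
  SmoothFn.mk (fun x => u.toFun x * v.toFun x) (u.contMDiff.mul v.contMDiff)

theorem SmoothFn.grad_mul (u v : SmoothFn d N) (x : N) : grad (d := d) (u.mul v).toFun x =
    u.toFun x • grad (d := d) v.toFun x + v.toFun x • grad (d := d) u.toFun x :=
  AllenCahn.grad_mul (u.mdifferentiableAt x) (v.mdifferentiableAt x)

theorem norm_smul_sub_smul_le {E : Type*} [NormedAddCommGroup E] [NormedSpace ℝ E] {a b L L' r : ℝ}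
    {v w : E} (ha : |a| ≤ L) (hab : |a - b| ≤ L * r) (hw : ‖w‖ ≤ L') (hvw : ‖v - w‖ ≤ L' * r)
    (hL : 0 ≤ L) : ‖a • v - b • w‖ ≤ 2 * L * L' * r := by
  have e : a • v - b • w = a • (v - w) + (a - b) • w := by
    rw [smul_sub, sub_smul]; abel
  rw [e]
  refine (norm_add_le _ _).trans ?_
  rw [norm_smul, norm_smul, Real.norm_eq_abs, Real.norm_eq_abs]
  have h1 := mul_le_mul ha hvw (norm_nonneg _) hL
  have h2 := mul_le_mul hab hw (norm_nonneg _) ((abs_nonneg _).trans hab)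
  linarith

theorem IsC1Lipschitz.mul {v w : ℝ → SmoothFn d N} {L L' : ℝ} (hv : IsC1Lipschitz v L)
    (hw : IsC1Lipschitz w L') (hL : 0 ≤ L) (hL' : 0 ≤ L') :
    IsC1Lipschitz (fun t => (v t).mul (w t)) (4 * L * L') where
  abs_le t x := by
    change |(v t).toFun x * (w t).toFun x| ≤ _
    rw [abs_mul]
    have := mul_le_mul (hv.abs_le t x) (hw.abs_le t x) (abs_nonneg _) hL
    nlinarith [mul_nonneg hL hL']
  grad_le t x := by
    rw [SmoothFn.grad_mul]
    refine (norm_add_le _ _).trans ?_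
    rw [norm_smul, norm_smul, Real.norm_eq_abs, Real.norm_eq_abs]
    have h1 := mul_le_mul (hv.abs_le t x) (hw.grad_le t x) (norm_nonneg _) hL
    have h2 := mul_le_mul (hw.abs_le t x) (hv.grad_le t x) (norm_nonneg _) hL'
    nlinarith [mul_nonneg hL hL']
  abs_sub_le t s x := by
    have := norm_smul_sub_smul_le (v := (w t).toFun x) (w := (w s).toFun x) (hv.abs_le t x)
      (hv.abs_sub_le t s x) (hw.abs_le s x) (hw.abs_sub_le t s x) hL
    have h0 : 0 ≤ L * L' * |t - s| := by positivity
    change |(v t).toFun x * (w t).toFun x - (v s).toFun x * (w s).toFun x| ≤ _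
    rw [Real.norm_eq_abs, smul_eq_mul, smul_eq_mul] at this
    linarith
  grad_sub_le t s x := by
    rw [SmoothFn.grad_mul, SmoothFn.grad_mul, add_sub_add_comm]
    refine (norm_add_le _ _).trans ?_
    have h1 := norm_smul_sub_smul_le (hv.abs_le t x) (hv.abs_sub_le t s x) (hw.grad_le s x)
      (hw.grad_sub_le t s x) hL
    have h2 := norm_smul_sub_smul_le (hw.abs_le t x) (hw.abs_sub_le t s x) (hv.grad_le s x)
      (hv.grad_sub_le t s x) hL'
    linarith

/-- A product of steps replaces the minimum: it is the transition profile of a union of balls, but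
remains smooth. With factors in `[0, 1]` its gradient is bounded by the sum of the gradients. -/
theorem exists_isC1Lipschitz_prod {κ : Type*} (s : Finset κ) (v : κ → ℝ → SmoothFn d N)
    (hv : ∀ k ∈ s, ∃ L, 0 ≤ L ∧ IsC1Lipschitz (v k) L) (h0 : ∀ k t x, 0 ≤ (v k t).toFun x)
    (h1 : ∀ k t x, (v k t).toFun x ≤ 1) :
    ∃ P : ℝ → SmoothFn d N, (∃ L, 0 ≤ L ∧ IsC1Lipschitz P L) ∧
      (∀ t x, (P t).toFun x = ∏ k ∈ s, (v k t).toFun x) ∧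
      ∀ t x, ‖grad (d := d) (P t).toFun x‖ ≤ ∑ k ∈ s, ‖grad (d := d) (v k t).toFun x‖ := by
  classical
  induction s using Finset.induction_on with
  | empty =>
    have hg : ∀ x, grad (d := d) (constFn d N 1).toFun x = 0 := fun x => grad_const 1 x
    refine ⟨fun _ => constFn d N 1, ⟨1, zero_le_one, ?_, ?_, ?_, ?_⟩, ?_, ?_⟩
    · intro t x
      exact (abs_one (α := ℝ)).le
    · intro t x
      rw [hg, norm_zero]; exact zero_le_one
    · intro t s x
      rw [sub_self, abs_zero, one_mul]; exact abs_nonneg _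
    · intro t s x
      rw [sub_self, norm_zero, one_mul]; exact abs_nonneg _
    · intro t x
      rfl
    · intro t x
      rw [hg, norm_zero, Finset.sum_empty]
  | insert k s hk ih =>
    obtain ⟨P, ⟨L, hL, hP⟩, hPp, hPg⟩ := ih fun k hk => hv k (Finset.mem_insert_of_mem hk)
    obtain ⟨L', hL', hvk⟩ := hv k (Finset.mem_insert_self k s)
    refine ⟨fun t => (v k t).mul (P t), ⟨_, by positivity, hvk.mul hP hL' hL⟩, fun t x => ?_,
      fun t x => ?_⟩
    · rw [Finset.prod_insert hk, ← hPp]; rfl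
    · rw [Finset.sum_insert hk, SmoothFn.grad_mul]
      have hP0 : 0 ≤ (P t).toFun x := by rw [hPp]; exact Finset.prod_nonneg fun _ _ => h0 _ _ _
      have hP1 : (P t).toFun x ≤ 1 := by
        rw [hPp]; exact Finset.prod_le_one (fun _ _ => h0 _ _ _) fun _ _ => h1 _ _ _
      refine (norm_add_le _ _).trans ?_
      rw [norm_smul, norm_smul, Real.norm_eq_abs, Real.norm_eq_abs, abs_of_nonneg hP0,
        abs_of_nonneg (h0 k t x), add_comm]
      exact add_le_add (mul_le_of_le_one_left (norm_nonneg _) hP1)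
        ((mul_le_of_le_one_left (norm_nonneg _) (h1 k t x)).trans (hPg t x))

theorem SmoothFn.sub_apply (u v : SmoothFn d N) (x : N) :
    (u - v).toFun x = u.toFun x - v.toFun x := by
  have e : u - v = u + (-1 : ℝ) • v := by rw [neg_one_smul, sub_eq_add_neg]
  rw [e, SmoothFn.add_apply, SmoothFn.smul_apply]; ring

theorem grad_sub (u v : SmoothFn d N) (x : N) :
    grad (d := d) (u - v).toFun x = grad (d := d) u.toFun x - grad (d := d) v.toFun x := by
  have e : u - v = u + (-1 : ℝ) • v := by rw [neg_one_smul, sub_eq_add_neg]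
  rw [e, grad_add, grad_smul, neg_one_smul, sub_eq_add_neg]

theorem IsC1Lipschitz.continuous {v : ℝ → SmoothFn d N} {L : ℝ} (hv : IsC1Lipschitz v L)
    (hL : 0 ≤ L) : Continuous v := by
  set V := (vol d N).real univ with hV
  have hV0 : 0 ≤ V := measureReal_nonneg
  have hb : ∀ t s, ‖v t - v s‖ ≤ L * √(2 * V) * |t - s| := by
    intro t s
    refine le_of_sq_le_sq ?_ (by positivity)
    rw [norm_sq_smoothFn, mul_pow, mul_pow, Real.sq_sqrt (by positivity)]
    have h1 : ∀ x, (v t - v s).toFun x ^ 2 + ‖grad (d := d) (v t - v s).toFun x‖ ^ 2 ≤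
        2 * (L * |t - s|) ^ 2 := by
      intro x
      rw [SmoothFn.sub_apply, grad_sub, ← sq_abs]
      have h2 := pow_le_pow_left₀ (abs_nonneg _) (hv.abs_sub_le t s x) 2
      have h3 := pow_le_pow_left₀ (norm_nonneg _) (hv.grad_sub_le t s x) 2
      linarith
    refine (integral_mono ((integrable_vol ((v t - v s).contMDiff.continuous.pow 2)).add
      (integrable_norm_grad_sq _)) (integrable_const _) h1).trans (le_of_eq ?_)
    rw [integral_const, smul_eq_mul, ← hV]
    ring
  exact (LipschitzWith.of_dist_le_mul (K := ⟨L * √(2 * V), by positivity⟩) fun t s => by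
    rw [dist_eq_norm, Real.dist_eq]; exact hb t s).continuous

/-- The step function across the level `t` of `f`, of width `ε`. -/
def levelStep {h : ℝ → ℝ} {K : ℝ≥0} (hh : IsSmoothStep h K) (f : SmoothFn d N) (ε t : ℝ) :
    SmoothFn d N :=
  f.comp (fun s => h ((s - t) / ε))
    (hh.contDiff.comp ((contDiff_id.sub contDiff_const).div_const _))

section LevelStep
variable {h : ℝ → ℝ} {K : ℝ≥0} (hh : IsSmoothStep h K) (f : SmoothFn d N)

theorem levelStep_apply (ε t : ℝ) (x : N) :
    (levelStep hh f ε t).toFun x = h ((f.toFun x - t) / ε) := rfl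

theorem grad_levelStep (ε t : ℝ) (x : N) : grad (d := d) (levelStep hh f ε t).toFun x =
    (deriv h ((f.toFun x - t) / ε) / ε) • grad (d := d) f.toFun x := by
  have hd : ∀ s, HasDerivAt (fun s => h ((s - t) / ε)) (deriv h ((s - t) / ε) / ε) s := fun s => by
    have h1 : HasDerivAt (fun s : ℝ => (s - t) / ε) (1 / ε) s :=
      ((hasDerivAt_id s).sub_const t).div_const ε
    have h2 := (hh.contDiff.differentiable (by simp) ((s - t) / ε)).hasDerivAt.comp s h1
    rw [mul_one_div] at h2
    exact h2
  have h3 : grad (d := d) (levelStep hh f ε t).toFun x =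
      deriv (fun s => h ((s - t) / ε)) (f.toFun x) • grad (d := d) f.toFun x :=
    grad_comp (fun s => (hd s).differentiableAt) (f.mdifferentiableAt x)
  rw [h3, (hd _).deriv]

theorem levelStep_eq_zero_or_one {ε t : ℝ} (hε : 0 < ε) {x : N} (hx : ε / 2 < |f.toFun x - t|) :
    (levelStep hh f ε t).toFun x = 0 ∨ (levelStep hh f ε t).toFun x = 1 := by
  rw [levelStep_apply]
  rcases lt_abs.1 hx with hx | hx
  · right
    refine hh.eq_one _ ?_
    rw [le_div_iff₀ hε]; linarith
  · left
    refine hh.eq_zero _ ?_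
    rw [div_le_iff₀ hε]; linarith

theorem norm_grad_levelStep_le {ε : ℝ} (hε : 0 < ε) {M : ℝ} {x : N}
    (hM : ‖grad (d := d) f.toFun x‖ ≤ M) (t : ℝ) :
    ‖grad (d := d) (levelStep hh f ε t).toFun x‖ ≤
      {x | |f.toFun x - t| ≤ ε / 2}.indicator (fun _ => K * M / ε) x := by
  rw [grad_levelStep, norm_smul, Real.norm_eq_abs, abs_div, abs_of_pos hε]
  by_cases hx : |f.toFun x - t| ≤ ε / 2
  · rw [indicator_of_mem (show x ∈ {x | |f.toFun x - t| ≤ ε / 2} from hx), div_mul_eq_mul_div]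
    exact div_le_div_of_nonneg_right
      (mul_le_mul (hh.abs_deriv_le _) hM (norm_nonneg _) K.2) hε.le
  · rw [indicator_of_notMem (show x ∉ {x | |f.toFun x - t| ≤ ε / 2} from hx)]
    rw [hh.deriv_eq_zero, abs_zero, zero_div, zero_mul]
    rw [abs_div, abs_of_pos hε, lt_div_iff₀ hε]
    linarith [not_le.1 hx]

theorem exists_isC1Lipschitz_levelStep {ε : ℝ} (hε : 0 < ε) :
    ∃ L, 0 ≤ L ∧ IsC1Lipschitz (levelStep hh f ε) L := by
  obtain ⟨K', hK'⟩ := hh.exists_lipschitzWith_deriv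
  obtain ⟨M, hM⟩ := (isCompact_univ (X := N)).exists_bound_of_continuousOn
    (continuous_norm_grad f).continuousOn
  have hM' : ∀ x, ‖grad (d := d) f.toFun x‖ ≤ max M 0 := fun x => by
    have := hM x (mem_univ x)
    rw [norm_norm] at this
    exact this.trans (le_max_left _ _)
  set m := max M 0 with hm
  have hm0 : 0 ≤ m := le_max_right _ _
  have hdist : ∀ t s x, |(f.toFun x - t) / ε - (f.toFun x - s) / ε| = |t - s| / ε := fun t s x => by
    rw [← sub_div, abs_div, abs_of_pos hε, abs_sub_comm]
    congr 2; ring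
  have a1 : 0 ≤ K * m / ε := by positivity
  have a2 : 0 ≤ K / ε := by positivity
  have a3 : 0 ≤ K' / ε / ε * m := by positivity
  refine ⟨1 + K * m / ε + K / ε + K' / ε / ε * m, by positivity, ?_, ?_, ?_, ?_⟩
  · intro t x
    rw [levelStep_apply, abs_of_nonneg (hh.nonneg _)]
    linarith [hh.le_one ((f.toFun x - t) / ε)]
  · intro t x
    refine (norm_grad_levelStep_le hh f hε (hM' x) t).trans ?_
    refine (indicator_le_self' (fun _ _ => by positivity) x).trans ?_
    linarith
  · intro t s x
    rw [levelStep_apply, levelStep_apply]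
    have h1 := hh.lipschitz.dist_le_mul ((f.toFun x - t) / ε) ((f.toFun x - s) / ε)
    rw [Real.dist_eq, Real.dist_eq, hdist] at h1
    refine h1.trans ?_
    rw [mul_div_assoc', mul_div_right_comm]
    exact mul_le_mul_of_nonneg_right (by linarith) (abs_nonneg _)
  · intro t s x
    rw [grad_levelStep, grad_levelStep, ← sub_smul, norm_smul, ← sub_div, Real.norm_eq_abs, abs_div,
      abs_of_pos hε]
    have h1 := hK'.dist_le_mul ((f.toFun x - t) / ε) ((f.toFun x - s) / ε)
    rw [Real.dist_eq, Real.dist_eq, hdist] at h1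
    calc _ ≤ K' * (|t - s| / ε) / ε * m :=
          mul_le_mul (div_le_div_of_nonneg_right h1 hε.le) (hM' x) (norm_nonneg _) (by positivity)
      _ = K' / ε / ε * m * |t - s| := by ring
      _ ≤ _ := mul_le_mul_of_nonneg_right (by linarith) (abs_nonneg _)

end LevelStep

theorem SmoothFn.ext {u v : SmoothFn d N} (h : ∀ x, u.toFun x = v.toFun x) : u = v :=
  ContMDiffMap.ext h

/-- The sweepout from `-1` to `1` through functions of uniformly bounded energy. -/
theorem IsDoubleWell.exists_joinedIn {W : ℝ → ℝ} (hW : IsDoubleWell W) (hd : 2 ≤ d) :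
    ∃ C : ℝ, ∀ ε, 0 < ε → ε < 1 / 2 →
      JoinedIn {u : W12 d N | energyE W ε u ≤ C ∧ ∀ᵐ x ∂(vol d N), -1 ≤ toL2 d N u x}
        (constFn d N (-1)) (constFn d N 1) := by
  obtain ⟨h, K, hh⟩ := exists_isSmoothStep
  obtain ⟨s, f, C, hC, hf0, hfs, hfC⟩ := exists_sweep_family (d := d) (N := N) hd
  choose M hM using fun c : N => (isCompact_univ (X := N)).exists_bound_of_continuousOn
    (continuous_norm_grad (f c)).continuousOn
  obtain ⟨B, hB⟩ := (isCompact_Icc (a := (-1 : ℝ)) (b := 1)).exists_bound_of_continuousOn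
    hW.contDiff.continuous.continuousOn
  have hB0 : 0 ≤ B := (norm_nonneg _).trans (hB 0 ⟨by norm_num, by norm_num⟩)
  set m : ℝ := ∑ c ∈ s, |M c| with hm
  have hm0 : 0 ≤ m := Finset.sum_nonneg fun _ _ => abs_nonneg _
  have hMm : ∀ c ∈ s, ∀ x, ‖grad (d := d) (f c).toFun x‖ ≤ m := fun c hc x => by
    have h1 := hM c x (mem_univ x)
    rw [norm_norm] at h1
    exact (h1.trans (le_abs_self _)).trans
      (Finset.single_le_sum (f := fun c => |M c|) (fun _ _ => abs_nonneg _) hc)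
  -- Each of the `s.card` layers has volume at most `C * ε`, and its contribution to the energy
  -- density is at most the bracket divided by ε. In it, `2 * s.card` is half of the 4 from `u = 1 -
  -- 2 * P` times the Cauchy-Schwarz factor.
  refine ⟨(2 * s.card * (K * m) ^ 2 + B) * (s.card * C), fun ε hε hε2 => ?_⟩
  obtain ⟨P, ⟨L, hL, hP⟩, hPp, hPg⟩ := exists_isC1Lipschitz_prod s
    (fun c t => levelStep hh (f c) ε t)
    (fun c _ => exists_isC1Lipschitz_levelStep hh (f c) hε)
    (fun c t x => hh.nonneg _) (fun c t x => hh.le_one _)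
  set u : ℝ → SmoothFn d N := fun t => constFn d N 1 - (2 : ℝ) • P t with hu
  have hux : ∀ t x, (u t).toFun x = 1 - 2 * (P t).toFun x := fun t x => by
    rw [hu, SmoothFn.sub_apply, SmoothFn.smul_apply]; rfl
  have hug : ∀ t x, grad (d := d) (u t).toFun x = (-2 : ℝ) • grad (d := d) (P t).toFun x :=
    fun t x => by
      have h1 : grad (d := d) (constFn d N 1).toFun x = 0 := grad_const 1 x
      rw [hu, grad_sub, grad_smul, h1, zero_sub, neg_smul]
  have hP0 : ∀ t x, 0 ≤ (P t).toFun x := fun t x => by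
    rw [hPp]; exact Finset.prod_nonneg fun _ _ => hh.nonneg _
  have hP1 : ∀ t x, (P t).toFun x ≤ 1 := fun t x => by
    rw [hPp]; exact Finset.prod_le_one (fun _ _ => hh.nonneg _) fun _ _ => hh.le_one _
  have hcont : Continuous u := continuous_const.sub ((hP.continuous hL).const_smul (2 : ℝ))
  -- The level runs from `-1 / 4` to `1 / 2`. At `-1 / 4` all steps are 1 because `f ≥ 0`; at `1 /
  -- 2` some step vanishes at each point because `f c < 1 / 4` for some `c`. Both use `ε < 1 / 2`.
  refine JoinedIn.ofLine (f := fun s : ℝ => (u (-1 / 4 + 3 / 4 * s) : W12 d N)) ?_ ?_ ?_ ?_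
  · exact ((UniformSpace.Completion.continuous_coe _).comp
      (hcont.comp (by fun_prop))).continuousOn
  · congr 1
    refine SmoothFn.ext fun x => ?_
    rw [hux, hPp, Finset.prod_eq_one]
    · norm_num [constFn]
    · intro c _
      rw [levelStep_apply]
      refine hh.eq_one _ ?_
      rw [le_div_iff₀ hε]
      linarith [hf0 c x]
  · congr 1
    refine SmoothFn.ext fun x => ?_
    obtain ⟨c, hc, hcx⟩ := hfs x
    rw [hux, hPp, Finset.prod_eq_zero hc]
    · norm_num [constFn]
    · rw [levelStep_apply]
      refine hh.eq_zero _ ?_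
      rw [div_le_iff₀ hε]
      linarith
  rintro _ ⟨r, hr, rfl⟩
  set t : ℝ := -1 / 4 + 3 / 4 * r with ht
  have ht2 : t ≤ 1 / 2 := by linarith [hr.2]
  refine ⟨?_, ?_⟩
  swap
  · filter_upwards [coeFn_toL2_coe (u t)] with x hx
    rw [hx, hux]
    linarith [hP1 t x]
  set S : N → Set N := fun c => {x | |(f c).toFun x - t| ≤ ε / 2} with hS
  have hSm : ∀ c, MeasurableSet (S c) := fun c => (isClosed_le
    (((f c).contMDiff.continuous.sub continuous_const).abs) continuous_const).measurableSet
  have hpt : ∀ x, ε / 2 * ‖grad (d := d) (u t).toFun x‖ ^ 2 + ε⁻¹ * W ((u t).toFun x) ≤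
      ∑ c ∈ s, (S c).indicator (fun _ => (2 * s.card * (K * m) ^ 2 + B) / ε) x := by
    intro x
    have h1 : ‖grad (d := d) (u t).toFun x‖ ^ 2 ≤
        4 * (s.card * ∑ c ∈ s, (S c).indicator (fun _ => (K * m / ε) ^ 2) x) := by
      rw [hug, norm_smul, mul_pow]
      norm_num
      refine (pow_le_pow_left₀ (norm_nonneg _) ((hPg t x).trans (Finset.sum_le_sum fun c hc =>
        norm_grad_levelStep_le hh (f c) hε (hMm c hc x) t)) 2).trans ?_
      refine sq_sum_le_card_mul_sum_sq.trans ?_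
      refine mul_le_mul_of_nonneg_left (Finset.sum_le_sum fun c _ => ?_) (Nat.cast_nonneg _)
      by_cases hx : x ∈ S c
      · rw [indicator_of_mem hx, indicator_of_mem hx]
      · rw [indicator_of_notMem hx, indicator_of_notMem hx]; norm_num
    have h2 : W ((u t).toFun x) ≤ ∑ c ∈ s, (S c).indicator (fun _ => B) x := by
      by_cases hx : ∃ c ∈ s, x ∈ S c
      · obtain ⟨c, hc, hx⟩ := hx
        have h3 := hB ((u t).toFun x) ⟨by rw [hux]; linarith [hP1 t x],
          by rw [hux]; linarith [hP0 t x]⟩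
        refine ((le_abs_self _).trans h3).trans ?_
        refine le_trans (le_of_eq (indicator_of_mem hx (fun _ => B)).symm)
          (Finset.single_le_sum (f := fun c => (S c).indicator (fun _ => B) x)
          (fun _ _ => indicator_nonneg (fun _ _ => hB0) _) hc)
      -- Outside all layers every factor is 0 or 1, so `u` is -1 or 1 and the potential vanishes.
      · push Not at hx
        have h3 : (P t).toFun x = 0 ∨ (P t).toFun x = 1 := by
          rw [hPp]
          by_cases h4 : ∃ c ∈ s, (levelStep hh (f c) ε t).toFun x = 0
          · obtain ⟨c, hc, hc0⟩ := h4
            exact Or.inl (Finset.prod_eq_zero hc hc0)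
          · push Not at h4
            refine Or.inr (Finset.prod_eq_one fun c hc => ?_)
            exact (levelStep_eq_zero_or_one hh (f c) hε (not_le.1 (hx c hc))).resolve_left
              (h4 c hc)
        have h5 : W ((u t).toFun x) = 0 := by
          rw [hW.zero_iff, hux]
          rcases h3 with h3 | h3 <;> rw [h3] <;> norm_num
        rw [h5]
        exact Finset.sum_nonneg fun _ _ => indicator_nonneg (fun _ _ => hB0) _
    have h3 := add_le_add (mul_le_mul_of_nonneg_left h1 (by positivity : 0 ≤ ε / 2))
      (mul_le_mul_of_nonneg_left h2 (inv_nonneg.2 hε.le))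
    refine h3.trans (le_of_eq ?_)
    have e1 : ∀ a : ℝ, ∑ c ∈ s, (S c).indicator (fun _ => a) x =
        a * ∑ c ∈ s, (S c).indicator (fun _ => 1) x := fun a => by
      rw [Finset.mul_sum]
      refine Finset.sum_congr rfl fun c _ => ?_
      by_cases hx : x ∈ S c
      · rw [indicator_of_mem hx, indicator_of_mem hx, mul_one]
      · rw [indicator_of_notMem hx, indicator_of_notMem hx, mul_zero]
    rw [e1 ((K * m / ε) ^ 2), e1 B, e1 ((2 * s.card * (K * m) ^ 2 + B) / ε)]
    field_simp
    ring
  rw [energyE_coe hW]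
  have hint : ∀ c, Integrable ((S c).indicator fun _ => (2 * s.card * (K * m) ^ 2 + B) / ε)
      (vol d N) := fun c => (integrable_const _).indicator (hSm c)
  refine (integral_mono (((integrable_norm_grad_sq (u t)).const_mul _).add
    ((integrable_vol (hW.contDiff.continuous.comp (u t).contMDiff.continuous)).const_mul _))
    (integrable_finsetSum _ fun c _ => hint c) hpt).trans ?_
  rw [integral_finsetSum _ fun c _ => hint c]
  have h4 : ∀ c ∈ s, ∫ x, (S c).indicator (fun _ => (2 * s.card * (K * m) ^ 2 + B) / ε) x
      ∂(vol d N) ≤ (2 * s.card * (K * m) ^ 2 + B) * C := fun c hc => by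
    rw [integral_indicator (hSm c), setIntegral_const, smul_eq_mul]
    have h5 := hfC c hc t ε ht2 hε hε2
    calc _ ≤ C * ε * ((2 * s.card * (K * m) ^ 2 + B) / ε) :=
          mul_le_mul_of_nonneg_right h5 (by positivity)
      _ = _ := by field_simp
  refine (Finset.sum_le_card_nsmul s _ _ h4).trans (le_of_eq ?_)
  rw [nsmul_eq_mul]; ring

end Sweepout

/-! ### The min-max value -/

section MinMax
open Filter Topology
open scoped ENNReal NNReal

variable {d : ℕ} {N : Type*} [TopologicalSpace N] [ChartedSpace (EuclideanSpace ℝ (Fin d)) N]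
  [RiemannianBundle (fun x : N => TangentSpace (𝓡 d) x)]
  [MeasurableSpace N] [BorelSpace N] [IsManifold (𝓡 d) ∞ N]
  [IsContMDiffRiemannianBundle (𝓡 d) ∞ (EuclideanSpace ℝ (Fin d))
    (fun x : N => TangentSpace (𝓡 d) x)] [T2Space N] [CompactSpace N]

theorem dirichlet_smul_add_constFn (u : W12 d N) (t s z : ℝ) :
    dirichlet (t • u + s • (constFn d N z : W12 d N)) = t ^ 2 * dirichlet u := by
  have h1 := inner_constFn u z
  have h2 : dirichlet (constFn d N z : W12 d N) = 0 := dirichlet_constFn z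
  unfold dirichlet at h2 ⊢
  rw [map_add, map_smul, map_smul, norm_add_sq_real, norm_add_sq_real, inner_smul_left,
    inner_smul_left, inner_smul_right, inner_smul_right, h1, norm_smul, norm_smul, norm_smul,
    norm_smul]
  simp only [mul_pow, Real.norm_eq_abs, sq_abs]
  linear_combination s ^ 2 * h2

/-- Along the segment from `a` to `z` the Dirichlet integral shrinks and the values stay within `|c|
* ε` of the well, where `W` is at most quadratic. -/
theorem IsDoubleWell.exists_joinedIn_constFn [Nonempty N] {W : ℝ → ℝ} (hW : IsDoubleWell W)
    {g : N → ℝ} (hg : Continuous g) (hg0 : ∀ x, 0 ≤ g x) {z : ℝ} (hz : W z = 0) (hz1 : -1 ≤ z)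
    (c : ℝ) :
    ∃ C : ℝ, ∀ ε, 0 < ε → ε < 1 → ∀ a : W12 d N, IsCriticalPoint W g ε a →
      (∀ᵐ x ∂(vol d N), z < toL2 d N a x ∧ toL2 d N a x < z + c * ε) →
      JoinedIn {u : W12 d N | energyE W ε u ≤ C ∧ ∀ᵐ x ∂(vol d N), -1 ≤ toL2 d N u x}
        a (constFn d N z) := by
  obtain ⟨C, hC, hCa⟩ := hW.exists_energyE_le_of_near (d := d) hg hg0 hz c
  obtain ⟨K, hK⟩ := hW.exists_lipschitzWith_deriv
  have hdz := hW.deriv_eq_zero hz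
  set V := (vol d N).real univ with hV
  have hV0 : 0 ≤ V := measureReal_nonneg
  refine ⟨C + K * c ^ 2 * V, fun ε hε hε1 a ha hab => ?_⟩
  refine JoinedIn.ofLine (f := fun s : ℝ => (1 - s) • a + s • (constFn d N z : W12 d N))
    (by fun_prop) (by simp) (by simp) ?_
  rintro _ ⟨s, ⟨hs0, hs1⟩, rfl⟩
  set w : W12 d N := (1 - s) • a + s • (constFn d N z : W12 d N) with hw
  have hwx : ∀ᵐ x ∂(vol d N), 0 ≤ toL2 d N w x - z ∧ toL2 d N w x - z ≤ |c| * ε := by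
    rw [hw, map_add, map_smul, map_smul]
    filter_upwards [hab, Lp.coeFn_add ((1 - s) • toL2 d N a)
      (s • toL2 d N (constFn d N z : W12 d N)), Lp.coeFn_smul (1 - s) (toL2 d N a),
      Lp.coeFn_smul s (toL2 d N (constFn d N z : W12 d N)),
      coeFn_toL2_constFn (d := d) (N := N) z] with x h1 h2 h3 h4 h5
    rw [h2, Pi.add_apply, h3, h4, Pi.smul_apply, Pi.smul_apply, h5, smul_eq_mul, smul_eq_mul]
    have e : (1 - s) * toL2 d N a x + s * z - z = (1 - s) * (toL2 d N a x - z) := by ring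
    rw [e]
    have h6 : 0 ≤ toL2 d N a x - z := by linarith [h1.1]
    refine ⟨mul_nonneg (by linarith) h6, (mul_le_of_le_one_left h6 (by linarith)).trans ?_⟩
    linarith [h1.2, mul_le_mul_of_nonneg_right (le_abs_self c) hε.le]
  refine ⟨?_, by filter_upwards [hwx] with x hx; linarith [hx.1]⟩
  have hD : ε / 2 * dirichlet w ≤ C := by
    have h1 := hCa ε hε a ha hab
    have h2 : ε / 2 * dirichlet a ≤ energyE W ε a := le_add_of_nonneg_right
      (mul_nonneg (inv_nonneg.2 hε.le) (integral_nonneg fun _ => hW.nonneg _))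
    rw [hw, dirichlet_smul_add_constFn]
    have h3 : (1 - s) ^ 2 * dirichlet a ≤ dirichlet a :=
      mul_le_of_le_one_left (dirichlet_nonneg a) (pow_le_one₀ (by linarith) (by linarith))
    have h4 := mul_le_mul_of_nonneg_left h3 (by linarith : 0 ≤ ε / 2)
    have h5 : C * ε ≤ C := mul_le_of_le_one_right hC hε1.le
    linarith
  have hP : ε⁻¹ * ∫ x, W (toL2 d N w x) ∂(vol d N) ≤ K * c ^ 2 * V := by
    have hb : ∫ x, W (toL2 d N w x) ∂(vol d N) ≤ ∫ _, K * (|c| * ε) ^ 2 ∂(vol d N) := by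
      refine integral_mono_ae (hW.integrable_comp _) (integrable_const _) ?_
      filter_upwards [hwx] with x h2
      have h3 := abs_sub_sub_le_of_lipschitz_deriv hW.hasDerivAt hK z (toL2 d N w x - z)
      rw [hdz, hz, add_sub_cancel] at h3
      have h5 := mul_le_mul_of_nonneg_left (pow_le_pow_left₀ h2.1 h2.2 2) K.2
      have h6 := (abs_le.1 h3).2
      simp only [zero_mul, sub_zero] at h6
      exact h6.trans h5
    rw [integral_const, smul_eq_mul, ← hV] at hb
    have h7 : ε⁻¹ * (V * (K * (|c| * ε) ^ 2)) = K * c ^ 2 * V * ε := by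
      rw [mul_pow, sq_abs]; field_simp
    refine ((mul_le_mul_of_nonneg_left hb (inv_nonneg.2 hε.le)).trans (le_of_eq h7)).trans ?_
    exact mul_le_of_le_one_right (by positivity) hε1.le
  unfold energyE
  linarith

theorem exists_mem_admissiblePaths {S : Set (W12 d N)} {a b : W12 d N} (h : JoinedIn S a b) :
    ∃ γ ∈ admissiblePaths a b, ∀ t, γ t ∈ S := by
  obtain ⟨p, hp⟩ := h
  refine ⟨⟨fun t => p.extend ((t + 1) / 2), by fun_prop⟩, ⟨?_, ?_⟩, fun t => ?_⟩
  · simp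
  · simp
  · have ht : ((t : ℝ) + 1) / 2 ∈ Icc (0 : ℝ) 1 :=
      ⟨by linarith [t.2.1], by linarith [t.2.2]⟩
    change p.extend (((t : ℝ) + 1) / 2) ∈ S
    rw [p.extend_apply ht]
    exact hp _

/-- A common lower bound for the path maxima and a single path bounded above make the extended real
min-max value finite. -/
theorem exists_coe_eq_minMaxValue {W : ℝ → ℝ} {g : N → ℝ} {ε : ℝ} {a b : W12 d N} {m M : ℝ}
    (hm : ∀ γ ∈ admissiblePaths a b, ∃ t, m ≤ energyF W g ε (γ t))
    (hM : ∃ γ ∈ admissiblePaths a b, ∀ t, energyF W g ε (γ t) ≤ M) :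
    ∃ β : ℝ, (β : EReal) = minMaxValue W g ε a b ∧ m ≤ β ∧ β ≤ M := by
  have h1 : (m : EReal) ≤ minMaxValue W g ε a b := by
    refine le_iInf₂ fun γ hγ => ?_
    obtain ⟨t, ht⟩ := hm γ hγ
    exact (EReal.coe_le_coe_iff.2 ht).trans
      (le_iSup (fun t => (energyF W g ε (γ t) : EReal)) t)
  have h2 : minMaxValue W g ε a b ≤ (M : EReal) := by
    obtain ⟨γ, hγ, hγM⟩ := hM
    exact (iInf₂_le γ hγ).trans (iSup_le fun t => EReal.coe_le_coe_iff.2 (hγM t))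
  have h3 : ((minMaxValue W g ε a b).toReal : EReal) = minMaxValue W g ε a b :=
    EReal.coe_toReal (ne_top_of_le_ne_top (EReal.coe_ne_top M) h2)
      (ne_bot_of_le_ne_bot (EReal.coe_ne_bot m) h1)
  refine ⟨_, h3, ?_, ?_⟩
  · rw [← h3] at h1; exact EReal.coe_le_coe_iff.1 h1
  · rw [← h3] at h2; exact EReal.coe_le_coe_iff.1 h2

/-- An index above 1 gives a negative definite space of rank above 1, hence two independent vectors.
They need not be orthonormal: the circle of coefficients only has to avoid 0. -/
theorem exists_linearIndependent_of_morseIndex {W : ℝ → ℝ} {g : N → ℝ} {ε : ℝ} {u : W12 d N}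
    (h : ¬ morseIndex W g ε u ≤ 1) : ∃ e₁ e₂ : W12 d N, ∀ x y : ℝ, x ^ 2 + y ^ 2 = 1 →
      secondVariation W g ε u (x • e₁ + y • e₂) < 0 := by
  simp only [morseIndex, iSup_le_iff, not_forall] at h
  obtain ⟨V, hV, hr⟩ := h
  have hr' : 1 < Module.rank ℝ V := by
    by_contra! hcon
    refine hr ?_
    have := OrderHomClass.mono Cardinal.toENat hcon
    rwa [map_one] at this
  obtain ⟨x₀, hx₀⟩ := rank_pos_iff_exists_ne_zero.1 (zero_lt_one.trans hr')
  obtain ⟨y₀, hy₀⟩ := exists_linearIndependent_pair_of_one_lt_rank hr' hx₀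
  refine ⟨x₀, y₀, fun x y hxy => hV _ (V.add_mem (V.smul_mem _ x₀.2) (V.smul_mem _ y₀.2)) ?_⟩
  intro h0
  have h1 : x • x₀ + y • y₀ = 0 := Subtype.ext h0
  obtain ⟨hx, hy⟩ := LinearIndependent.pair_iff.1 hy₀ x y h1
  rw [hx, hy] at hxy
  norm_num at hxy

/-- The min-max value is attained at a critical point of Morse index at most one. -/
theorem IsDoubleWell.exists_critical_minMax {W : ℝ → ℝ} (hW : IsDoubleWell W) {g : N → ℝ}
    (hg : Continuous g) {ε : ℝ} (hε : 0 < ε) {a b : W12 d N} (ha : IsCriticalPoint W g ε a)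
    (hb : IsCriticalPoint W g ε b) {β : ℝ} (hβ : (β : EReal) = minMaxValue W g ε a b)
    (haβ : energyF W g ε a ≠ β) (hbβ : energyF W g ε b ≠ β) :
    ∃ u : W12 d N, IsCriticalPoint W g ε u ∧ energyF W g ε u = β ∧ morseIndex W g ε u ≤ 1 := by
  obtain ⟨K, hK⟩ := hW.exists_lipschitzWith_deriv
  obtain ⟨κ, hκ, C, hC⟩ := hW.exists_quadratic_le
  have hmain := abs_modelEnergy_sub_sub_le (G := continuousL2 d g hg) hW.hasDerivAt hK
    (norm_toL2_le (d := d) (N := N)) hε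
  have hder := hasFDerivAt_modelEnergy (G := continuousL2 d g hg) hW.hasDerivAt hK
    (norm_toL2_le (d := d) (N := N)) hε
  have hcont : Continuous (modelEnergy (toL2 d N) W (continuousL2 d g hg) ε) :=
    continuous_iff_continuousAt.2 fun u => (hder u).continuousAt
  have hFm := energyF_eq_modelEnergy (d := d) (N := N) W hg ε
  rw [hFm] at haβ hbβ
  obtain ⟨u, hu, hGu, hdp⟩ := exists_critical_not_descentPlane
    (F := modelEnergy (toL2 d N) W (continuousL2 d g hg) ε)
    (G := modelGrad (toL2 d N) hK (continuousL2 d g hg) ε) (Λ := ε + ε⁻¹ * K) (β := β)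
    hcont (continuous_modelGrad hK) (by positivity)
    (fun w h => by linarith [(abs_le.1 (hmain w h)).2])
    (fun u => exists_tendsto_of_palaisSmale hW.hasDerivAt hK norm_toL2_le isCompactOperator_toL2
      hε hκ hC u)
    ((isCriticalPoint_iff hW.hasDerivAt hK hg hε a).1 ha)
    ((isCriticalPoint_iff hW.hasDerivAt hK hg hε b).1 hb) haβ hbβ
    (fun γ hγ => by
      obtain ⟨t, -, ht⟩ := isCompact_univ.exists_isMaxOn ⟨⟨-1, by norm_num⟩, mem_univ _⟩
        (hcont.comp γ.continuous).continuousOn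
      refine ⟨t, ?_⟩
      have h1 : (β : EReal) ≤ ⨆ t, (energyF W g ε (γ t) : EReal) :=
        hβ.le.trans (iInf₂_le (f := fun (γ : C(Icc (-1 : ℝ) 1, W12 d N))
          (_ : γ ∈ admissiblePaths a b) => ⨆ t, (energyF W g ε (γ t) : EReal)) γ hγ)
      refine EReal.coe_le_coe_iff.1 (h1.trans (iSup_le fun s => EReal.coe_le_coe_iff.2 ?_))
      rw [hFm]
      exact ht (mem_univ s))
    (fun η hη => by
      have h1 : minMaxValue W g ε a b < ((β + η : ℝ) : EReal) := by
        rw [← hβ, EReal.coe_lt_coe_iff]; linarith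
      obtain ⟨γ, h2⟩ := iInf_lt_iff.1 h1
      obtain ⟨hγ, h2⟩ := iInf_lt_iff.1 h2
      refine ⟨γ, hγ, fun t => ?_⟩
      rw [← hFm]
      exact EReal.coe_lt_coe_iff.1
        ((le_iSup (fun t => (energyF W g ε (γ t) : EReal)) t).trans_lt h2))
  refine ⟨u, (isCriticalPoint_iff hW.hasDerivAt hK hg hε u).2 hGu, by rw [hFm]; exact hu, ?_⟩
  -- An index of at least 2 would give a negative definite plane, which is a descent plane.
  by_contra hcon
  obtain ⟨e₁, e₂, he⟩ := exists_linearIndependent_of_morseIndex hcon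
  obtain ⟨c, r, hcr⟩ := exists_isDescentPlane_of_modelHess_neg (T := toL2 d N)
    (G := continuousL2 d g hg) hW.hasDerivAt hK hW.hasDerivAt_deriv hW.continuous_iteratedDeriv
    norm_toL2_le hε (u := u) (e₁ := e₁) (e₂ := e₂) fun x y hxy => by
      rw [← secondVariation_eq_modelHess hW.hasDerivAt hK hW.hasDerivAt_deriv
        hW.continuous_iteratedDeriv hg hε]
      exact he x y hxy
  exact hdp e₁ e₂ c r hcr

/-- Every admissible path crosses the barrier. -/
theorem exists_integral_step_eq {h : ℝ → ℝ} {K : ℝ≥0} (hh : IsSmoothStep h K) {a b : W12 d N}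
    (ha : ∀ᵐ x ∂(vol d N), toL2 d N a x ≤ -1 / 2) (hb : ∀ᵐ x ∂(vol d N), 1 / 2 ≤ toL2 d N b x)
    {r : ℝ} (hr0 : 0 ≤ r) (hr : r ≤ (vol d N).real univ) {γ : C(Icc (-1 : ℝ) 1, W12 d N)}
    (hγ : γ ∈ admissiblePaths a b) : ∃ t, ∫ x, h (toL2 d N (γ t) x) ∂(vol d N) = r := by
  have : PreconnectedSpace (Icc (-1 : ℝ) 1) := Subtype.preconnectedSpace isPreconnected_Icc
  refine mem_range_of_exists_le_of_exists_ge
    ((continuous_integral_nemytskii hh.lipschitz).comp γ.continuous) ⟨⟨-1, by norm_num⟩, ?_⟩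
    ⟨⟨1, by norm_num⟩, ?_⟩
  · have h1 : ∫ x, h (toL2 d N a x) ∂(vol d N) = 0 := by
      rw [integral_eq_zero_of_ae]
      filter_upwards [ha] with x hx
      exact hh.eq_zero _ hx
    change ∫ x, h (toL2 d N (γ _) x) ∂(vol d N) ≤ r
    rw [hγ.1, h1]
    exact hr0
  · have h1 : ∫ x, h (toL2 d N b x) ∂(vol d N) = (vol d N).real univ := by
      have h2 : ∫ x, h (toL2 d N b x) ∂(vol d N) = ∫ _, (1 : ℝ) ∂(vol d N) := by
        refine integral_congr_ae ?_
        filter_upwards [hb] with x hx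
        exact hh.eq_one _ hx
      rw [h2]; simp
    change r ≤ ∫ x, h (toL2 d N (γ _) x) ∂(vol d N)
    rw [hγ.2, h1]
    exact hr

end MinMax

end
end AllenCahn

/-! ### Assembly of the theorem -/

theorem mainTheorem8 (n : ℕ) (hn : 2 ≤ n) (N : Type*) [TopologicalSpace N] [T2Space N]
    [CompactSpace N] [Nonempty N] [MeasurableSpace N] [BorelSpace N]
    [ChartedSpace (EuclideanSpace ℝ (Fin (n + 1))) N] [IsManifold (𝓡 (n + 1)) ∞ N]
    [RiemannianBundle (fun x : N => TangentSpace (𝓡 (n + 1)) x)]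
    [IsContMDiffRiemannianBundle (𝓡 (n + 1)) ∞ (EuclideanSpace ℝ (Fin (n + 1)))
      (fun x : N => TangentSpace (𝓡 (n + 1)) x)]
    (W : ℝ → ℝ) (hW : AllenCahn.IsDoubleWell W)
    (g : N → ℝ) (hg : Continuous g) (hgpos : ∀ x, 0 < g x)
    (c : ℝ) (hc₁ : ∀ x, g x < c * iteratedDeriv 2 W (-1))
    (hc₂ : ∀ x, g x < c * iteratedDeriv 2 W 1) :
    ∃ ε₀ > (0 : ℝ), ∃ L > (0 : ℝ), ∃ K : ℝ, ∀ ε : ℝ, 0 < ε → ε < ε₀ →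
      (∃ a : AllenCahn.W12 (n + 1) N, AllenCahn.IsLowerValley W g c ε a) ∧
      (∃ b : AllenCahn.W12 (n + 1) N, AllenCahn.IsUpperValley W g c ε b) ∧
      ∀ a b : AllenCahn.W12 (n + 1) N,
        AllenCahn.IsLowerValley W g c ε a → AllenCahn.IsUpperValley W g c ε b →
        (∃ u : AllenCahn.W12 (n + 1) N, AllenCahn.IsCriticalPoint W g ε u ∧
          (AllenCahn.energyF W g ε u : EReal) = AllenCahn.minMaxValue W g ε a b ∧
          AllenCahn.morseIndex W g ε u ≤ 1) ∧
        ∀ u : AllenCahn.W12 (n + 1) N, AllenCahn.IsCriticalPoint W g ε u →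
          (AllenCahn.energyF W g ε u : EReal) = AllenCahn.minMaxValue W g ε a b →
          L ≤ AllenCahn.energyE W ε u ∧ AllenCahn.energyE W ε u ≤ K := by
  have hd : 2 ≤ n + 1 := by omega
  have hg0 : ∀ x, 0 ≤ g x := fun x => (hgpos x).le
  have hz₁ : W (-1) = 0 := (hW.zero_iff _).2 (Or.inl rfl)
  have hz₂ : W 1 = 0 := (hW.zero_iff _).2 (Or.inr rfl)
  obtain ⟨ε₁, hε₁, hlower⟩ := hW.exists_valley (d := n + 1) hg hgpos hz₁
    hW.second_deriv_neg_one hc₁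
  obtain ⟨ε₂, hε₂, hupper⟩ := hW.exists_valley (d := n + 1) hg hgpos hz₂ hW.second_deriv_one hc₂
  obtain ⟨h, Kh, hh⟩ := AllenCahn.exists_isSmoothStep
  obtain ⟨r, hr0, hrV, ε₃, hε₃, hbarrier⟩ := AllenCahn.exists_barrier hd hW hh hg hg0
  obtain ⟨L, hL, hLow⟩ := hW.exists_energyF_lt_of_energyE_lt (d := n + 1) hg hg0 hr0
  obtain ⟨ε₄, hε₄, C₀, hC₀⟩ := hW.exists_energyE_le (d := n + 1) hg hg0
  obtain ⟨C₁, hC₁, hnear₁⟩ := hW.exists_energyE_le_of_near (d := n + 1) hg hg0 hz₁ c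
  obtain ⟨C₂, hC₂, hnear₂⟩ := hW.exists_energyE_le_of_near (d := n + 1) hg hg0 hz₂ c
  obtain ⟨C₃, hjoin₁⟩ := hW.exists_joinedIn_constFn (d := n + 1) hg hg0 hz₁ le_rfl c
  obtain ⟨C₄, hjoin₂⟩ := hW.exists_joinedIn_constFn (d := n + 1) hg hg0 hz₂ (by norm_num) c
  obtain ⟨C₅, hjoin⟩ := hW.exists_joinedIn (d := n + 1) (N := N) hd
  set I := ∫ x, g x ∂(AllenCahn.vol (n + 1) N) with hI
  set M := max C₅ (max C₃ C₄) with hM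
  -- `1 / (2 * (|c| + 1))` puts the lower valley below `-1 / 2`, where the step is 0. `r / (C₁ + 1)`
  -- and `r / (C₂ + 1)` keep the energy of the valleys below `r`, hence both endpoints below the
  -- barrier. The upper bound is that of the functional in terms of `β ≤ M + I`.
  refine ⟨min (min (min ε₁ ε₂) (min ε₃ ε₄)) (min (min (1 / 2) (1 / (2 * (|c| + 1))))
    (min (r / (C₁ + 1)) (r / (C₂ + 1)))), by positivity, L, hL, 2 * (M + I) + C₀,
    fun ε hε hεlt => ?_⟩
  simp only [lt_min_iff] at hεlt
  obtain ⟨⟨⟨k1, k2⟩, k3, k4⟩, ⟨k5, k6⟩, k7, k8⟩ := hεlt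
  have hε1 : ε < 1 := by linarith
  have hcε : |c * ε| ≤ 1 / 2 := by
    rw [lt_div_iff₀ (by positivity)] at k6
    rw [abs_mul, abs_of_pos hε]
    nlinarith [abs_nonneg c]
  refine ⟨?_, ?_, fun a b ha hb => ?_⟩
  · obtain ⟨a, h1, h2, h3⟩ := hlower ε hε k1
    exact ⟨a, h1, h2, h3⟩
  · obtain ⟨b, h1, h2, h3⟩ := hupper ε hε k2
    exact ⟨b, h1, h2, h3⟩
  have hlow : ∀ γ ∈ AllenCahn.admissiblePaths a b, ∃ t, I + r ≤ AllenCahn.energyF W g ε (γ t) := by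
    intro γ hγ
    obtain ⟨t, ht⟩ := AllenCahn.exists_integral_step_eq hh
      (by filter_upwards [ha.bounds] with x hx; linarith [hx.2, (abs_le.1 hcε).2])
      (by filter_upwards [hb.bounds] with x hx; linarith [hx.1]) hr0.le hrV.le hγ
    exact ⟨t, hbarrier ε hε k3 _ ht⟩
  have hup : ∃ γ ∈ AllenCahn.admissiblePaths a b, ∀ t, AllenCahn.energyF W g ε (γ t) ≤ M + I := by
    have hmono : ∀ C ≤ M, {u : AllenCahn.W12 (n + 1) N | AllenCahn.energyE W ε u ≤ C ∧
        ∀ᵐ x ∂(AllenCahn.vol (n + 1) N), -1 ≤ AllenCahn.toL2 (n + 1) N u x} ⊆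
        {u | AllenCahn.energyF W g ε u ≤ M + I} := fun C hCM u hu =>
      (AllenCahn.energyF_le_of_ge hg hg0 hu.2).trans (add_le_add (hu.1.trans hCM) le_rfl)
    -- The path runs from `a` to -1, then to 1 by the sweepout, then to `b`.
    exact AllenCahn.exists_mem_admissiblePaths
      ((((hjoin₁ ε hε hε1 a ha.critical ha.bounds).mono
        (hmono _ ((le_max_left _ _).trans (le_max_right _ _)))).trans
        ((hjoin ε hε k5).mono (hmono _ (le_max_left _ _)))).trans
        ((hjoin₂ ε hε hε1 b hb.critical hb.bounds).mono
        (hmono _ ((le_max_right _ _).trans (le_max_right _ _)))).symm)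
  obtain ⟨β, hβ, hβ1, hβ2⟩ := AllenCahn.exists_coe_eq_minMaxValue hlow hup
  have haβ : AllenCahn.energyF W g ε a < β := by
    have h1 := AllenCahn.energyF_le_of_ge (W := W) (ε := ε) hg hg0 (u := a)
      (by filter_upwards [ha.bounds] with x hx; exact hx.1.le)
    have h2 := hnear₁ ε hε a ha.critical ha.bounds
    rw [lt_div_iff₀ (by positivity)] at k7
    linarith
  have hbβ : AllenCahn.energyF W g ε b < β := by
    have h1 := AllenCahn.energyF_le_of_ge (W := W) (ε := ε) hg hg0 (u := b)
      (by filter_upwards [hb.bounds] with x hx; linarith [hx.1])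
    have h2 := hnear₂ ε hε b hb.critical hb.bounds
    rw [lt_div_iff₀ (by positivity)] at k8
    linarith
  refine ⟨?_, fun u _ hu => ?_⟩
  · obtain ⟨u, h1, h2, h3⟩ := hW.exists_critical_minMax hg hε ha.critical hb.critical hβ
      haβ.ne hbβ.ne
    exact ⟨u, h1, by rw [h2, hβ], h3⟩
  · have hu' : AllenCahn.energyF W g ε u = β := by
      rw [← hβ] at hu; exact EReal.coe_eq_coe_iff.1 hu
    refine ⟨?_, (hC₀ ε hε k4 u).trans (by linarith)⟩
    -- Energy below `L` would put the value of the functional below `I + r`, hence below `β`.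
    by_contra! hcon
    have := hLow ε hε hε1 u hcon
    linarith
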